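/- Let $F$ be a non-archimedean local field of characteristic different from $2$ and $\psi$ a non-trivial continuous unitary character of $F$. Let $(\cdot,\cdot)_F$ be the Hilbert symbol and let $\widetilde{GL(n)}=GL(n,F)\times\{\pm1\}$ with multiplication $(g_1,\epsilon_1)(g_2,\epsilon_2)=(g_1g_2,\epsilon_1\epsilon_2(\det g_1,\det g_2)_F)$; this is a group because $(\cdot,\cdot)_F$ is bimultiplicative. A representation of $\widetilde{GL(n)}$ is genuine if $(1,-1)$ acts by $-1$. Put $\psi_a(x)=\psi(ax)$, let $\gamma(\eta)$ denote the Weil index of $x\mapsto\eta(x^2)$, and let $$\chi_\psi((g,\epsilon))=\epsilon\,\gamma(\psi_{\frac12})\,\gamma(\psi_{\frac{\det g}{2}})^{-1},\qquad \alpha((g,\epsilon))=(\det g,-1)_F ;$$ $\chi_\psi$ is a character of $\widetilde{GL(n)}$. Let $R$ (resp. $R^{gen}$) be the direct sum over $n\ge 0$ of the Grothendieck groups of the smooth complex representations of finite length of $GL(n,F)$ (resp. of the genuine ones of $\widetilde{GL(n)}$); these are free abelian groups on the isomorphism classes of irreducible representations. Let $m:R\otimes R\to R$ and $m^*:R\to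 R\otimes R$ be the multiplication and comultiplication given by normalized parabolic induction $\pi_1\otimes\pi_2\mapsto\pi_1\times\pi_2$ and by $\pi\mapsto\sum_{k+l=n}$ (semisimplification of the normalized Jacquet module of $\pi$ with respect to the standard parabolic subgroup with Levi factor $GL(k)\times GL(l)$), and let $m_\sim,m^*_\sim$ be the analogous maps for $R^{gen}$, where Jacquet modules are pulled back along the natural epimorphism $((g_1,\epsilon_1),(g_2,\epsilon_2))\mapsto(\mathrm{diag}(g_1,g_2),\epsilon_1\epsilon_2(\det g_1,\det g_2)_F)$ from $\widetilde{GL(k)}\times\widetilde{GL(l)}$. Let $\tilde{\ }$ denote the contragredient, $\kappa$ the switch of tensor factors, and put $$M^*=(m\otimes id)\circ(\tilde{\ }\otimes m^*)\circ\kappa\circ m^*,\qquad M^*_\sim=(m_\sim\otimes id)\circ(\alpha\cdot\tilde{\ }\otimes m^*_\sim)\circ\kappa\circ m^*_\sim .$$ Then multiplication by $\chi_\psi$, $\pi\mapsto\chi_\psi\pi$ for $\pi$ smooth of finite length, induces an isomorphism of abelian groups $\chi_\psi:R\to R^{gen}$, and $$M^*_\sim=(\chi_\psi\otimes\chi_\psi)\circ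 M^*\circ\chi_\psi^{-1}.$$ In other words, if $\pi$ is a smooth representation of $GL(n,F)$ of finite length and $M^*(\pi)=\sum_i\beta_i\otimes\gamma_i$ (a finite sum with $\beta_i,\gamma_i\in R$), then $M^*_\sim(\chi_\psi\pi)=\sum_i\chi_\psi\beta_i\otimes\chi_\psi\gamma_i$. -/

import Mathlib

open scoped TensorProduct MatrixGroups

universe u

noncomputable section

namespace Metaplectic

/-! ## Smooth representations and Jordan–Hölder multiplicities -/

section Rep

variable {G : Type*} [Group G] {V W : Type*} [AddCommGroup V] [Module ℂ V]
  [AddCommGroup W] [Module ℂ W]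

/-- A vector is smooth if its stabilizer is a neighbourhood of `1` (i.e. an open subgroup). -/
def IsSmoothVec [TopologicalSpace G] (ρ : Representation ℂ G V) (v : V) : Prop :=
  ∀ᶠ g in nhds (1 : G), ρ g v = v

/-- A representation is smooth if all its vectors are. -/
def IsSmoothRep [TopologicalSpace G] (ρ : Representation ℂ G V) : Prop :=
  ∀ v, IsSmoothVec ρ v

/-- A representation has finite length if it has finite length as a module over the group
algebra. -/
def IsFiniteLengthRep (ρ : Representation ℂ G V) : Prop :=
  IsFiniteLength (MonoidAlgebra ℂ G) ρ.asModule

/-- The subrepresentation of smooth vectors, for a group whose inner automorphisms are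
continuous. -/
def smoothPart [TopologicalSpace G] (hconj : ∀ g : G, Continuous fun x : G => g * x * g⁻¹)
    (ρ : Representation ℂ G V) : Subrepresentation ρ where
  toSubmodule :=
    { carrier := {v | IsSmoothVec ρ v}
      zero_mem' := Filter.Eventually.of_forall fun g => map_zero (ρ g)
      add_mem' := by
        intro v w hv hw
        filter_upwards [hv, hw] with g h1 h2
        rw [map_add, h1, h2]
      smul_mem' := by
        intro c v hv
        filter_upwards [hv] with g h1
        rw [map_smul, h1] }
  apply_mem_toSubmodule := by
    intro h v hv
    have hc : Filter.Tendsto (fun x : G => h⁻¹ * x * h⁻¹⁻¹) (nhds 1) (nhds 1) := by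
      have := (hconj h⁻¹).tendsto 1
      simpa using this
    have hv' := hc.eventually hv
    change ∀ᶠ g in nhds (1 : G), ρ g (ρ h v) = ρ h v
    filter_upwards [hv'] with g hg
    have h1 : ρ h (ρ (h⁻¹ * g * h⁻¹⁻¹) v) = ρ h v := by rw [hg]
    rw [← Module.End.mul_apply, ← map_mul] at h1
    rw [← Module.End.mul_apply, ← map_mul]
    convert h1 using 3
    group

/-- The twist `χ ρ` of a representation by a character. -/
def twist (χ : G →* ℂ) (ρ : Representation ℂ G V) : Representation ℂ G V where
  toFun g := χ g • ρ g
  map_one' := by simp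
  map_mul' g h := by
    ext v
    simp only [map_mul, LinearMap.smul_apply, Module.End.mul_apply, map_smul, mul_smul]
    rw [smul_comm]

/-- The external tensor product of representations of two groups. -/
def extTensor {H : Type*} [Group H] (ρ : Representation ℂ G V) (σ : Representation ℂ H W) :
    Representation ℂ (G × H) (V ⊗[ℂ] W) where
  toFun x := TensorProduct.map (ρ x.1) (σ x.2)
  map_one' := by simp
  map_mul' x y := by
    simp only [Prod.fst_mul, Prod.snd_mul, map_mul]
    exact TensorProduct.map_mul _ _ _ _

/-- `A ≤ B` are invariant subspaces with `B / A ≅ σ`. -/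
def IsSubquotient {ρ : Representation ℂ G V} (A B : Subrepresentation ρ)
    (σ : Representation ℂ G W) : Prop :=
  A ≤ B ∧ ∃ f : Representation.IntertwiningMap B.toRepresentation σ,
    Function.Surjective f.toLinearMap ∧ ∀ v, f.toLinearMap v = 0 ↔ (v : V) ∈ A

/-- The Jordan–Hölder multiplicity of `σ` (irreducible) in `ρ` (of finite length): the largest
`m` for which there are invariant subspaces `A₁ ≤ B₁ ≤ A₂ ≤ B₂ ≤ ⋯ ≤ Aₘ ≤ Bₘ` with all
`Bᵢ / Aᵢ ≅ σ`. -/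
def jhMult (ρ : Representation ℂ G V) (σ : Representation ℂ G W) : ℕ :=
  sSup {m : ℕ | ∃ A B : Fin m → Subrepresentation ρ,
    (∀ i j, i < j → B i ≤ A j) ∧ ∀ i, IsSubquotient (A i) (B i) σ}

end Rep

/-! ## Block matrices -/

section Blocks

variable {F : Type u} [Field F]

/-- Reordering of `k + l = n` block indices. -/
def blockEquiv {k l n : ℕ} (h : k + l = n) : Fin k ⊕ Fin l ≃ Fin n :=
  finSumFinEquiv.trans (finCongr h)

/-- Block matrices `(Fin k ⊕ Fin l)` as `n × n` matrices, on invertible matrices. -/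
def glReindex (F : Type u) [Field F] {k l n : ℕ} (h : k + l = n) :
    GL (Fin k ⊕ Fin l) F →* GL (Fin n) F :=
  Units.map (Matrix.reindexAlgEquiv F F (blockEquiv h) : _ →* _)

/-- `(A, D) ↦ diag(A, D)` on invertible matrices, with block indices. -/
def glDiagAux (k l : ℕ) : GL (Fin k) F × GL (Fin l) F →* GL (Fin k ⊕ Fin l) F where
  toFun x :=
    { val := Matrix.fromBlocks x.1.1 0 0 x.2.1
      inv := Matrix.fromBlocks (x.1⁻¹).1 0 0 (x.2⁻¹).1
      val_inv := by
        rw [Matrix.fromBlocks_multiply]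
        simp only [Matrix.mul_zero, Matrix.zero_mul, add_zero, zero_add, Units.mul_inv,
          Matrix.fromBlocks_one]
      inv_val := by
        rw [Matrix.fromBlocks_multiply]
        simp only [Matrix.mul_zero, Matrix.zero_mul, add_zero, zero_add, Units.inv_mul,
          Matrix.fromBlocks_one] }
  map_one' := by ext1; exact Matrix.fromBlocks_one
  map_mul' x y := by
    ext1
    simp [Matrix.fromBlocks_multiply]

/-- The unipotent block matrix with upper right block `X`, with block indices. -/
def glUnipAux {k l : ℕ} (X : Matrix (Fin k) (Fin l) F) : GL (Fin k ⊕ Fin l) F where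
  val := Matrix.fromBlocks 1 X 0 1
  inv := Matrix.fromBlocks 1 (-X) 0 1
  val_inv := by simp [Matrix.fromBlocks_multiply]
  inv_val := by simp [Matrix.fromBlocks_multiply]

/-- The standard Levi subgroup `GL(k) × GL(l) → GL(n)`, `k + l = n` (block diagonal). -/
def glDiag {k l n : ℕ} (h : k + l = n) : GL (Fin k) F × GL (Fin l) F →* GL (Fin n) F :=
  (glReindex F h).comp (glDiagAux k l)

/-- The unipotent radical of the standard (block upper triangular) parabolic subgroup. -/
def glUnip {k l n : ℕ} (h : k + l = n) (X : Matrix (Fin k) (Fin l) F) : GL (Fin n) F :=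
  glReindex F h (glUnipAux X)

/-- The conjugation action of the Levi subgroup on the unipotent radical: `X ↦ A X D⁻¹`. -/
def levConj {k l : ℕ} (x : GL (Fin k) F × GL (Fin l) F) (X : Matrix (Fin k) (Fin l) F) :
    Matrix (Fin k) (Fin l) F :=
  x.1.1 * X * (x.2⁻¹).1

lemma glDiag_mul_glUnip {k l n : ℕ} (h : k + l = n) (x : GL (Fin k) F × GL (Fin l) F)
    (X : Matrix (Fin k) (Fin l) F) :
    glDiag h x * glUnip h X = glUnip h (levConj x X) * glDiag h x := by
  simp only [glDiag, glUnip, MonoidHom.comp_apply, ← map_mul]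
  congr 1
  ext1
  simp [glDiagAux, glUnipAux, levConj, Matrix.fromBlocks_multiply, Matrix.mul_assoc]

lemma det_glReindex {k l n : ℕ} (h : k + l = n) (x : GL (Fin k ⊕ Fin l) F) :
    Matrix.GeneralLinearGroup.det (glReindex F h x) = Matrix.GeneralLinearGroup.det x := by
  ext1
  simp only [glReindex, Matrix.GeneralLinearGroup.val_det_apply]
  exact Matrix.det_reindex_self _ _

lemma det_glDiag {k l n : ℕ} (h : k + l = n) (x : GL (Fin k) F × GL (Fin l) F) :
    Matrix.GeneralLinearGroup.det (glDiag h x) =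
      Matrix.GeneralLinearGroup.det x.1 * Matrix.GeneralLinearGroup.det x.2 := by
  rw [glDiag, MonoidHom.comp_apply, det_glReindex]
  ext1
  simp [glDiagAux]

lemma det_glUnip {k l n : ℕ} (h : k + l = n) (X : Matrix (Fin k) (Fin l) F) :
    Matrix.GeneralLinearGroup.det (glUnip h X) = 1 := by
  rw [glUnip, det_glReindex]
  ext1
  simp [glUnipAux]

end Blocks

/-! ## The field: absolute value, Hilbert symbol, Weil index -/

section Field

open ValuativeRel MeasureTheory
open scoped NNReal

variable (F : Type u) [Field F] [ValuativeRel F] [TopologicalSpace F]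
  [IsNonarchimedeanLocalField F]

lemma card_residue_ne_zero : ((Nat.card 𝓀[F] : ℕ) : ℝ≥0) ≠ 0 := by
  have : Nat.card 𝓀[F] ≠ 0 := Nat.card_pos.ne'
  exact_mod_cast this

/-- The normalized absolute value: the uniformizers have absolute value `q⁻¹`, where `q` is the
cardinality of the residue field. -/
def normAbs : F →*₀ ℝ≥0 :=
  (WithZeroMulInt.toNNReal (card_residue_ne_zero F)).comp
    ((IsNonarchimedeanLocalField.valueGroupWithZeroIsoInt F).toMulEquiv.toMonoidWithZeroHom.comp
      (valuation F).toMonoidWithZeroHom)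

variable {F}

/-- The square root `δ^{1/2}` of the modulus character of the standard parabolic subgroup
with Levi subgroup `GL(k) × GL(l)`: `δ(A, D) = |det A|ˡ |det D|⁻ᵏ`. -/
def sqrtMod (k l : ℕ) : GL (Fin k) F × GL (Fin l) F →* ℂ where
  toFun x := ((NNReal.sqrt (normAbs F x.1.1.det ^ l * (normAbs F x.2.1.det ^ k)⁻¹) : ℝ≥0) : ℂ)
  map_one' := by simp
  map_mul' x y := by
    simp only [Prod.fst_mul, Prod.snd_mul, Units.val_mul, Matrix.det_mul, map_mul, mul_pow,
      mul_inv]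
    rw [mul_mul_mul_comm, NNReal.sqrt_mul]
    push_cast
    rfl

/-- The Weil index `γ(η)` of the character of second degree `x ↦ η(x²)`: the phase of the
integral of `η(x²)` over all sufficiently large fractional ideals. -/
def weilIndex (η : AddChar F Circle) : ℂ :=
  letI : MeasurableSpace F := borel F
  haveI : BorelSpace F := ⟨rfl⟩
  let I : ValueGroupWithZero F → ℂ := fun r =>
    ∫ x in {x : F | valuation F x ≤ r}, (η (x ^ 2) : ℂ) ∂(Measure.addHaar : Measure F)
  Filter.limUnder Filter.atTop fun r => I r / (‖I r‖ : ℂ)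

end Field

section Hilbert

variable {F : Type u} [Field F]

open Classical in
/-- The Hilbert symbol `(a, b)_F`. -/
def hilbertSymbol (a b : Fˣ) : ℤˣ :=
  if ∃ x y z : F, (x ≠ 0 ∨ y ≠ 0 ∨ z ≠ 0) ∧ z ^ 2 = a * x ^ 2 + b * y ^ 2 then 1 else -1

lemma hilbertSymbol_comm (a b : Fˣ) : hilbertSymbol a b = hilbertSymbol b a := by
  unfold hilbertSymbol
  congr 1
  apply propext
  constructor <;>
  · rintro ⟨x, y, z, h, e⟩
    exact ⟨y, x, z, by tauto, by rw [e]; ring⟩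

variable (F) in
/-- Bimultiplicativity of the Hilbert symbol (multiplicativity in the first variable is enough
by symmetry). This is what makes `(g₁,ε₁)(g₂,ε₂) = (g₁g₂, ε₁ε₂(det g₁, det g₂))` a group law. -/
def HilbertBimult : Prop :=
  ∀ a a' b : Fˣ, hilbertSymbol (a * a') b = hilbertSymbol a b * hilbertSymbol a' b

lemma HilbertBimult.right (hH : HilbertBimult F) (a b b' : Fˣ) :
    hilbertSymbol a (b * b') = hilbertSymbol a b * hilbertSymbol a b' := by
  rw [hilbertSymbol_comm, hH, hilbertSymbol_comm b, hilbertSymbol_comm b']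

lemma HilbertBimult.one_left (hH : HilbertBimult F) (b : Fˣ) : hilbertSymbol 1 b = 1 := by
  have := hH 1 1 b
  rw [mul_one] at this
  exact left_eq_mul.mp this

lemma HilbertBimult.one_right (hH : HilbertBimult F) (b : Fˣ) : hilbertSymbol b 1 = 1 := by
  rw [hilbertSymbol_comm, hH.one_left]

end Hilbert

/-! ## The covering groups of the general linear groups -/

section Cover

variable {F : Type u} [Field F]

/-- The set `GL(n, F) × μ₂` underlying the two-fold cover of `GL(n, F)`. -/
@[ext]
structure CoverGL (hH : HilbertBimult F) (n : ℕ) : Type u where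
  mat : GL (Fin n) F
  sgn : ℤˣ

namespace CoverGL

variable {hH : HilbertBimult F} {n : ℕ}

open Matrix.GeneralLinearGroup (det)

instance : Mul (CoverGL hH n) :=
  ⟨fun x y => ⟨x.mat * y.mat, x.sgn * y.sgn * hilbertSymbol (det x.mat) (det y.mat)⟩⟩

instance : One (CoverGL hH n) := ⟨⟨1, 1⟩⟩

instance : Inv (CoverGL hH n) :=
  ⟨fun x => ⟨x.mat⁻¹, x.sgn * hilbertSymbol (det x.mat⁻¹) (det x.mat)⟩⟩

@[simp] lemma mul_mat (x y : CoverGL hH n) : (x * y).mat = x.mat * y.mat := rfl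
@[simp] lemma mul_sgn (x y : CoverGL hH n) :
    (x * y).sgn = x.sgn * y.sgn * hilbertSymbol (det x.mat) (det y.mat) := rfl
@[simp] lemma one_mat : (1 : CoverGL hH n).mat = 1 := rfl
@[simp] lemma one_sgn : (1 : CoverGL hH n).sgn = 1 := rfl
@[simp] lemma inv_mat (x : CoverGL hH n) : (x⁻¹).mat = x.mat⁻¹ := rfl
@[simp] lemma inv_sgn (x : CoverGL hH n) :
    (x⁻¹).sgn = x.sgn * hilbertSymbol (det x.mat⁻¹) (det x.mat) := rfl

instance : Group (CoverGL hH n) :=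
  Group.ofLeftAxioms
    (fun x y z => by
      ext1
      · simp [mul_assoc]
      · simp only [mul_sgn, mul_mat, map_mul, hH _ _ _, hH.right]
        simp only [mul_assoc, mul_comm, mul_left_comm])
    (fun x => by
      ext1
      · simp
      · simp [hH.one_left])
    (fun x => by
      ext1
      · simp
      · simp only [mul_sgn, inv_sgn, inv_mat, one_sgn]
        rw [mul_right_comm x.sgn, mul_assoc, Int.units_mul_self, Int.units_mul_self, mul_one])

/-- The topology of the product `GL(n, F) × μ₂`. -/
instance [TopologicalSpace F] : TopologicalSpace (CoverGL hH n) :=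
  TopologicalSpace.induced (fun x => (x.mat, x.sgn)) inferInstance

/-- The projection of the cover onto `GL(n, F)`. -/
def proj (hH : HilbertBimult F) (n : ℕ) : CoverGL hH n →* GL (Fin n) F where
  toFun := mat
  map_one' := rfl
  map_mul' _ _ := rfl

lemma conj_eq (g x : CoverGL hH n) : g * x * g⁻¹ = ⟨g.mat * x.mat * g.mat⁻¹, x.sgn⟩ := by
  ext1
  · rfl
  · simp only [mul_sgn, inv_sgn, mul_mat, inv_mat, map_mul, hH _ _ _]
    have h1 : hilbertSymbol (det x.mat) (det g.mat⁻¹) * hilbertSymbol (det g.mat) (det x.mat)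
        = 1 := by
      rw [hilbertSymbol_comm, ← hH, ← map_mul, inv_mul_cancel, map_one, hH.one_left]
    have h2 : hilbertSymbol (det g.mat) (det g.mat⁻¹) * hilbertSymbol (det g.mat⁻¹) (det g.mat)
        = 1 := by
      rw [hilbertSymbol_comm, Int.units_mul_self]
    calc _ = (g.sgn * g.sgn) * x.sgn * (hilbertSymbol (det x.mat) (det g.mat⁻¹) *
            hilbertSymbol (det g.mat) (det x.mat)) * (hilbertSymbol (det g.mat) (det g.mat⁻¹) *
            hilbertSymbol (det g.mat⁻¹) (det g.mat)) := by
          simp only [mul_assoc, mul_comm, mul_left_comm]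
      _ = x.sgn := by rw [h1, h2, Int.units_mul_self]; simp

lemma continuous_conj [TopologicalSpace F] [IsTopologicalRing F] (g : CoverGL hH n) :
    Continuous fun x : CoverGL hH n => g * x * g⁻¹ := by
  simp only [conj_eq]
  rw [continuous_induced_rng]
  have hc : Continuous fun x : CoverGL hH n => (x.mat, x.sgn) := continuous_induced_dom
  have h1 : Continuous fun x : CoverGL hH n => x.mat := continuous_fst.comp hc
  have h2 : Continuous fun x : CoverGL hH n => x.sgn := continuous_snd.comp hc
  exact ((continuous_const.mul h1).mul continuous_const).prodMk h2

/-- The natural epimorphism from the product of the covers of `GL(k)` and `GL(l)` onto the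
preimage of the Levi subgroup `GL(k) × GL(l)` in the cover of `GL(n)`, `k + l = n`. -/
def levi (hH : HilbertBimult F) {k l n : ℕ} (h : k + l = n) :
    CoverGL hH k × CoverGL hH l →* CoverGL hH n where
  toFun x := ⟨glDiag h (x.1.mat, x.2.mat),
    x.1.sgn * x.2.sgn * hilbertSymbol (det x.1.mat) (det x.2.mat)⟩
  map_one' := by
    ext1
    · exact map_one (glDiag h)
    · simp [hH.one_left]
  map_mul' x y := by
    ext1
    · exact map_mul (glDiag h) (x.1.mat, x.2.mat) (y.1.mat, y.2.mat)
    · simp only [Prod.fst_mul, Prod.snd_mul, mul_sgn, mul_mat, map_mul, det_glDiag, hH _ _ _,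
        hH.right]
      have e : hilbertSymbol (det x.2.mat) (det y.1.mat) =
        hilbertSymbol (det y.1.mat) (det x.2.mat) := hilbertSymbol_comm _ _
      rw [e]
      apply Units.ext
      push_cast
      ring

/-- The lift `N × {1}` of the unipotent radical of the standard parabolic subgroup. -/
def unip (hH : HilbertBimult F) {k l n : ℕ} (h : k + l = n) (X : Matrix (Fin k) (Fin l) F) :
    CoverGL hH n :=
  ⟨glUnip h X, 1⟩

lemma levi_mul_unip {k l n : ℕ} (h : k + l = n) (x : CoverGL hH k × CoverGL hH l)
    (X : Matrix (Fin k) (Fin l) F) :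
    levi hH h x * unip hH h X = unip hH h (levConj (x.1.mat, x.2.mat) X) * levi hH h x := by
  ext1
  · exact glDiag_mul_glUnip h (x.1.mat, x.2.mat) X
  · simp [unip, det_glUnip, hH.one_left, hH.one_right]

end CoverGL

end Cover

/-! ## Representations of a tower of groups: induction, Jacquet modules, Hopf algebra maps

The linear groups `GL(n, F)` and their covers are treated in parallel: the structure below only
bundles the data entering the constructions, and it is used for the two towers `linTower` and
`coverTower` defined at the end of this section. -/

section Tower

/-- A tower of groups `G n` over `GL(n, F)`, with the (lifts of) standard Levi subgroups and
unipotent radicals, and with the central elements `z n`, acting by the sign `s` in the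
representations to be considered. -/
structure GLTower (F : Type u) [Field F] where
  G : ℕ → Type u
  grp : ∀ n, Group (G n)
  top : ∀ n, TopologicalSpace (G n)
  continuous_conj : ∀ (n : ℕ) (g : G n), Continuous fun x : G n => g * x * g⁻¹
  proj : ∀ n, G n →* GL (Fin n) F
  levi : ∀ {k l n : ℕ}, k + l = n → (G k × G l →* G n)
  unip : ∀ {k l n : ℕ}, k + l = n → Matrix (Fin k) (Fin l) F → G n
  levi_mul_unip : ∀ {k l n : ℕ} (h : k + l = n) (x : G k × G l) (X : Matrix (Fin k) (Fin l) F),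
    levi h x * unip h X = unip h (levConj (proj k x.1, proj l x.2) X) * levi h x
  z : ∀ n, G n
  s : ℤˣ

attribute [instance] GLTower.grp GLTower.top

variable {F : Type u} [Field F] (T : GLTower F)

/-- Irreducible smooth complex representations of `G n` in which `z n` acts by the sign `s`. -/
structure IrrRep (n : ℕ) where
  V : Type u
  [addCommGroup : AddCommGroup V]
  [module : Module ℂ V]
  ρ : Representation ℂ (T.G n) V
  irreducible : ρ.IsIrreducible
  smooth : IsSmoothRep ρ
  central : ∀ v, ρ (T.z n) v = ((T.s : ℤ) : ℂ) • v

attribute [instance] IrrRep.addCommGroup IrrRep.module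

/-- Isomorphism of irreducible representations. -/
def irrSetoid (n : ℕ) : Setoid (IrrRep T n) where
  r π σ := Nonempty (Representation.Equiv π.ρ σ.ρ)
  iseqv := ⟨fun π => ⟨Representation.Equiv.refl π.ρ⟩, fun ⟨e⟩ => ⟨e.symm⟩,
    fun ⟨e⟩ ⟨f⟩ => ⟨e.trans f⟩⟩

/-- Isomorphism classes of irreducible representations of `G n`. -/
def IrrClass (n : ℕ) : Type (u + 1) := Quotient (irrSetoid T n)

variable {T} in
/-- A representation in the given isomorphism class. -/
def IrrClass.rep {n : ℕ} (c : IrrClass T n) : IrrRep T n := Quotient.out c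

/-- The direct sum over `n ≥ 0` of the Grothendieck groups of finite length smooth
representations of `G n` in which `z n` acts by `s`: the free abelian group on the isomorphism
classes of irreducible representations. -/
abbrev R : Type (u + 1) := (Σ n, IrrClass T n) →₀ ℤ

variable {T}

/-- The basis element of `R T` given by an irreducible class. -/
def IrrClass.basis {n : ℕ} (c : IrrClass T n) : R T := Finsupp.single ⟨n, c⟩ 1

/-- The class (semisimplification) in `R T` of a finite length representation of `G n`: the sum of
its irreducible subquotients, with multiplicities. -/
def cls {n : ℕ} {V : Type u} [AddCommGroup V] [Module ℂ V] (π : Representation ℂ (T.G n) V) :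
    R T :=
  ∑ᶠ c : IrrClass T n, (jhMult π c.rep.ρ : ℤ) • c.basis

/-- The class (semisimplification) in `R T ⊗ R T` of a finite length representation of
`G k × G l`: the sum of its irreducible subquotients `σ₁ ⊗ σ₂`, with multiplicities. -/
def clsProd {k l : ℕ} {V : Type u} [AddCommGroup V] [Module ℂ V]
    (π : Representation ℂ (T.G k × T.G l) V) : R T ⊗[ℤ] R T :=
  ∑ᶠ c : IrrClass T k × IrrClass T l,
    (jhMult π (extTensor c.1.rep.ρ c.2.rep.ρ) : ℤ) • (c.1.basis ⊗ₜ[ℤ] c.2.basis)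

/-- The span `V(N)` of the vectors `π(u) v - v`, for `u` in the unipotent radical. -/
def jacquetKer {k l n : ℕ} (h : k + l = n) {V : Type u} [AddCommGroup V] [Module ℂ V]
    (π : Representation ℂ (T.G n) V) : Submodule ℂ V :=
  Submodule.span ℂ {w | ∃ X v, w = π (T.unip h X) v - v}

lemma jacquetKer_le {k l n : ℕ} (h : k + l = n) {V : Type u} [AddCommGroup V] [Module ℂ V]
    (π : Representation ℂ (T.G n) V) (m : T.G k × T.G l) :
    jacquetKer h π ≤ (jacquetKer h π).comap (π (T.levi h m)) := by
  rw [jacquetKer, Submodule.span_le]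
  rintro _ ⟨X, v, rfl⟩
  apply Submodule.subset_span
  refine ⟨levConj (T.proj k m.1, T.proj l m.2) X, π (T.levi h m) v, ?_⟩
  rw [map_sub, ← Module.End.mul_apply, ← map_mul, T.levi_mul_unip, map_mul, Module.End.mul_apply]

/-- The unnormalized Jacquet module `V / V(N)`, as a representation of `G k × G l`. -/
def jacquetRaw {k l n : ℕ} (h : k + l = n) {V : Type u} [AddCommGroup V] [Module ℂ V]
    (π : Representation ℂ (T.G n) V) :
    Representation ℂ (T.G k × T.G l) (V ⧸ jacquetKer h π) where
  toFun m := (jacquetKer h π).mapQ (jacquetKer h π) (π (T.levi h m)) (jacquetKer_le h π m)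
  map_one' := by
    ext v
    simp
  map_mul' x y := by
    ext v
    simp

section Field

variable [ValuativeRel F] [TopologicalSpace F] [IsNonarchimedeanLocalField F]

variable (T) in
/-- `δ^{1/2}` on the Levi subgroup of `G n`. -/
def towerSqrtMod (k l : ℕ) : T.G k × T.G l →* ℂ :=
  (sqrtMod k l).comp ((T.proj k).prodMap (T.proj l))

/-- Right translation of functions `f : G n → V`, on those `f` with
`f (m u g) = δ^{1/2}(m) π(m) f(g)` for `m` in the Levi subgroup and `u` in the unipotent radical. -/
def indFull {k l n : ℕ} (h : k + l = n) {V : Type u} [AddCommGroup V] [Module ℂ V]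
    (π : Representation ℂ (T.G k × T.G l) V) :
    Representation ℂ (T.G n)
      ({ carrier := {f | ∀ m X g, f (T.levi h m * T.unip h X * g) =
            towerSqrtMod T k l m • π m (f g)}
         zero_mem' := by intro m X g; simp
         add_mem' := by
           intro f f' hf hf' m X g
           simp only [Pi.add_apply, hf m X g, hf' m X g, map_add, smul_add]
         smul_mem' := by
           intro c f hf m X g
           simp only [Pi.smul_apply, hf m X g, map_smul]
           rw [smul_comm] } : Submodule ℂ (T.G n → V)) where
  toFun x :=
    { toFun := fun f => ⟨fun g => f.1 (g * x), by
        intro m X g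
        have := f.2 m X (g * x)
        simpa only [mul_assoc] using this⟩
      map_add' := fun _ _ => rfl
      map_smul' := fun _ _ => rfl }
  map_one' := by
    ext f g
    simp
  map_mul' x y := by
    ext f g
    simp [mul_assoc]

/-- The normalized parabolically induced representation `π₁ × π₂` of `G n`, `k + l = n`. -/
def ind {k l n : ℕ} (h : k + l = n) {V₁ V₂ : Type u} [AddCommGroup V₁] [Module ℂ V₁]
    [AddCommGroup V₂] [Module ℂ V₂] (π₁ : Representation ℂ (T.G k) V₁)
    (π₂ : Representation ℂ (T.G l) V₂) :
    Representation ℂ (T.G n)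
      (smoothPart (T.continuous_conj n) (indFull h (extTensor π₁ π₂))).toSubmodule :=
  (smoothPart (T.continuous_conj n) (indFull h (extTensor π₁ π₂))).toRepresentation

variable (T) in
/-- `δ^{-1/2}` on the Levi subgroup of `G n`. -/
def towerSqrtModInv (k l : ℕ) : T.G k × T.G l →* ℂ where
  toFun m := (towerSqrtMod T k l m)⁻¹
  map_one' := by simp
  map_mul' x y := by rw [map_mul, mul_inv]

/-- The normalized Jacquet module of `π` with respect to the standard parabolic subgroup with Levi
subgroup `G k × G l` (pulled back to this product), `k + l = n`. -/
def jacquet {k l n : ℕ} (h : k + l = n) {V : Type u} [AddCommGroup V] [Module ℂ V]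
    (π : Representation ℂ (T.G n) V) :
    Representation ℂ (T.G k × T.G l) (V ⧸ jacquetKer h π) :=
  twist (towerSqrtModInv T k l) (jacquetRaw h π)

/-- The (smooth) contragredient representation. -/
def contragredient {n : ℕ} {V : Type u} [AddCommGroup V] [Module ℂ V]
    (π : Representation ℂ (T.G n) V) :
    Representation ℂ (T.G n) (smoothPart (T.continuous_conj n) π.dual).toSubmodule :=
  (smoothPart (T.continuous_conj n) π.dual).toRepresentation

variable (T)

/-- The multiplication `m : R ⊗ R → R`, the linear extension of `σ₁ ⊗ σ₂ ↦ σ₁ × σ₂`. -/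
def mulMap : R T ⊗[ℤ] R T →ₗ[ℤ] R T :=
  TensorProduct.lift (Finsupp.linearCombination ℤ fun a : Σ n, IrrClass T n =>
    Finsupp.linearCombination ℤ fun b : Σ n, IrrClass T n =>
      cls (n := a.1 + b.1) (ind rfl a.2.rep.ρ b.2.rep.ρ))

/-- The comultiplication `m* : R → R ⊗ R`, the linear extension of
`σ ↦ ∑_{k + l = n} (semisimplified normalized Jacquet module of σ for G k × G l)`. -/
def comulMap : R T →ₗ[ℤ] R T ⊗[ℤ] R T :=
  Finsupp.linearCombination ℤ fun a : Σ n, IrrClass T n =>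
    ∑ p ∈ (Finset.HasAntidiagonal.antidiagonal a.1).attach,
      clsProd (jacquet (Finset.HasAntidiagonal.mem_antidiagonal.mp p.2) a.2.rep.ρ)

/-- The linear extension of `σ ↦ α σ~`, where `σ~` is the contragredient of `σ`. -/
def contraMap (α : ∀ n, T.G n →* ℂ) : R T →ₗ[ℤ] R T :=
  Finsupp.linearCombination ℤ fun a : Σ n, IrrClass T n =>
    cls (twist (α a.1) (contragredient a.2.rep.ρ))

/-- The composition `(m ⊗ id) ∘ (α~ ⊗ m*) ∘ κ ∘ m*`, where `κ` switches the factors. -/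
def MStar (α : ∀ n, T.G n →* ℂ) : R T →ₗ[ℤ] R T ⊗[ℤ] R T :=
  (TensorProduct.map (mulMap T) LinearMap.id) ∘ₗ
    (TensorProduct.assoc ℤ (R T) (R T) (R T)).symm.toLinearMap ∘ₗ
    (TensorProduct.map (contraMap T α) (comulMap T)) ∘ₗ
    (TensorProduct.comm ℤ (R T) (R T)).toLinearMap ∘ₗ (comulMap T)

end Field

end Tower

/-! ## The linear groups and their covers -/

section Main

variable (F : Type u) [Field F] [ValuativeRel F] [TopologicalSpace F]
  [IsNonarchimedeanLocalField F]

/-- The groups `GL(n, F)` (no condition on representations). -/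
def linTower : GLTower F where
  G n := GL (Fin n) F
  grp _ := inferInstance
  top _ := inferInstance
  continuous_conj _ g := by fun_prop
  proj _ := MonoidHom.id _
  levi h := glDiag h
  unip h := glUnip h
  levi_mul_unip h x X := glDiag_mul_glUnip h x X
  z _ := 1
  s := 1

variable {F}

/-- The covers of the groups `GL(n, F)`, with their genuine representations: the non-trivial
element `(1, -1)` of `μ₂` acts by `-1`. -/
def coverTower (hH : HilbertBimult F) : GLTower F where
  G n := CoverGL hH n
  grp _ := inferInstance
  top _ := inferInstance
  continuous_conj _ g := CoverGL.continuous_conj g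
  proj n := CoverGL.proj hH n
  levi h := CoverGL.levi hH h
  unip h := CoverGL.unip hH h
  levi_mul_unip h x X := CoverGL.levi_mul_unip h x X
  z _ := ⟨1, -1⟩
  s := -1

/-- The character `α (g, ε) = (det g, -1)_F` of the cover of `GL(n, F)`. -/
def alphaChar (hH : HilbertBimult F) (n : ℕ) : CoverGL hH n →* ℂ where
  toFun x := ((hilbertSymbol (Matrix.GeneralLinearGroup.det x.mat) (-1) : ℤ) : ℂ)
  map_one' := by simp [hH.one_left]
  map_mul' x y := by simp [hH _ _ _]

/-- The function `χ_ψ (g, ε) = ε γ(ψ_{1/2}) γ(ψ_{det g / 2})⁻¹`, where `ψ_a(x) = ψ(ax)`. -/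
def chiFun (ψ : AddChar F Circle) (hH : HilbertBimult F) {n : ℕ} (x : CoverGL hH n) : ℂ :=
  ((x.sgn : ℤ) : ℂ) * weilIndex (ψ.mulShift (1 / 2)) *
    (weilIndex (ψ.mulShift ((x.mat : Matrix (Fin n) (Fin n) F).det / 2)))⁻¹

/-- The assertion that `χ_ψ` is a character of the cover of `GL(n, F)`, for every `n`. -/
def IsChiCharacter (ψ : AddChar F Circle) (hH : HilbertBimult F) : Prop :=
  ∀ n, chiFun ψ hH (1 : CoverGL hH n) = 1 ∧
    ∀ x y : CoverGL hH n, chiFun ψ hH (x * y) = chiFun ψ hH x * chiFun ψ hH y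

/-- `χ_ψ` as a character of the cover of `GL(n, F)`. -/
def chi {ψ : AddChar F Circle} {hH : HilbertBimult F} (hχ : IsChiCharacter ψ hH) (n : ℕ) :
    CoverGL hH n →* ℂ where
  toFun := chiFun ψ hH
  map_one' := (hχ n).1
  map_mul' := (hχ n).2

/-- The genuine representation `χ_ψ π` of the cover of `GL(n, F)`, for a representation `π` of
`GL(n, F)`. -/
def chiTwist {ψ : AddChar F Circle} {hH : HilbertBimult F} (hχ : IsChiCharacter ψ hH) {n : ℕ}
    {V : Type u} [AddCommGroup V] [Module ℂ V] (π : Representation ℂ (GL (Fin n) F) V) :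
    Representation ℂ (CoverGL hH n) V :=
  twist (chi hχ n) (π.comp (CoverGL.proj hH n))

variable (F) in
/-- The direct sum of the Grothendieck groups of the groups `GL(n, F)`. -/
abbrev RLin : Type (u + 1) := R (linTower F)

/-- The direct sum of the Grothendieck groups of genuine representations of the covers. -/
abbrev RGen (hH : HilbertBimult F) : Type (u + 1) := R (coverTower hH)

/-- The class in `RLin` of a finite length representation of `GL(n, F)`. -/
def clsLin {n : ℕ} {V : Type u} [AddCommGroup V] [Module ℂ V]
    (π : Representation ℂ (GL (Fin n) F) V) : RLin F :=
  cls (T := linTower F) (n := n) π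

/-- The class in `RGen` of a finite length genuine representation of the cover of `GL(n, F)`. -/
def clsGen {hH : HilbertBimult F} {n : ℕ} {V : Type u} [AddCommGroup V] [Module ℂ V]
    (π : Representation ℂ (CoverGL hH n) V) : RGen hH :=
  cls (T := coverTower hH) (n := n) π

variable (F) in
/-- `M* = (m ⊗ id) ∘ (~ ⊗ m*) ∘ κ ∘ m*` for the groups `GL(n, F)`. -/
def MStarLin : RLin F →ₗ[ℤ] RLin F ⊗[ℤ] RLin F :=
  MStar (linTower F) fun _ => 1

/-- `M*_~ = (m_~ ⊗ id) ∘ (α~ ⊗ m*_~) ∘ κ ∘ m*_~` for the covers of the groups `GL(n, F)`. -/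
def MStarGen (hH : HilbertBimult F) : RGen hH →ₗ[ℤ] RGen hH ⊗[ℤ] RGen hH :=
  MStar (coverTower hH) (alphaChar hH)

end Main

end Metaplectic

end

/-!
The proof has an arithmetic half and a representation-theoretic half, which meet in one fact: with
`f a = γ(ψ_{1/2}) / γ(ψ_{a/2})` (`weilRatio`), one has `f (a b) = f a · f b · (a, b)_F`
(`weilRatio_mul`). Everything known about `χ_ψ` is a consequence of it.

*Arithmetic.* For a continuous quadratic form `Q` on a finite-dimensional space, the integral of
`ψ ∘ Q` over a lattice `Λ` does not change when `Λ` is cut down to the orthogonal of a lattice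
`K ≤ Λ` on which `ψ ∘ Q` is trivial (`setIntegral_eq_inter_orth`), so for a non-degenerate form it
is the same for all large `Λ`. Its phase (`HasWeilPhase`) is an isometry invariant and is
multiplicative on orthogonal sums; in one variable it exists, and is the Weil index, because a
hyperbolic plane has a positive integral. Hence the form `c ⟨1, -a, -b, ab⟩`, a multiple of the norm
form of the quaternion algebra of `(a, b)`, has as phase a product of four Weil indices
`γ(ψ_c) γ(ψ_{-ca}) γ(ψ_{-cb}) γ(ψ_{cab})`, and it suffices to show that this phase is `(a, b)_F`
(`weilIndex_quaternion`), because `γ(ψ_{-c}) = γ(ψ_c)⁻¹`.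
If `(a, b)_F = 1`, then `b` is a norm from `F(√a)` and the form is a difference of two isometric
planes (`weilIndex_quaternion_split`). If `(a, b)_F = -1`, the form is anisotropic, and its phase is
`-1` (`IsQuaternionic.hasWeilPhase`). Indeed the sets `|Q| ≤ r` are then lattices, by a
Cauchy–Schwarz inequality that follows from Hensel's lemma; scaling `ψ` so that it is trivial on
the maximal ideal but not on the integers, `{|Q| ≤ 1}` is the orthogonal of `{|Q| < 1}`, of index
`q²`, and since multiplication by quaternions equidistributes the values of `Q` on the shell
`|Q| = 1` over the units of the residue field, the integral over `{|Q| ≤ 1}` is `-q` times the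
measure of `{|Q| < 1}`. Chevalley's theorem provides the index, and all of it works in residue
characteristic `2`.
Bimultiplicativity of the Hilbert symbol follows on comparing values of `c`
(`hilbertBimult_of_char`).

*Representations.* The formula for `f` says that `χ_ψ` is a character, that its restriction to the
preimage of a Levi subgroup is `χ_ψ ⊗ χ_ψ`, and that `χ_ψ² = α` (`alphaChar_eq`); also `χ_ψ` is
trivial on unipotent radicals and near the identity, where determinants are squares. Therefore
twisting by `χ_ψ` commutes with Jacquet modules and parabolic induction, while the contragredient
turns it into a twist by `χ_ψ⁻¹ = α⁻¹ χ_ψ`, which the factor `α` in `M*_~` repairs. Twisting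
preserves Jordan–Hölder multiplicities (`IsTwistOf.jhMult_eq`) and is a bijection on classes of
irreducible representations, because a genuine representation times `χ_ψ⁻¹` is trivial on `μ₂`.
So it carries each of the maps composing `M*` to its analogue (`TowerTwist.mapR_MStar`).
The argument uses only a list of compatibilities between two towers of groups, collected in
`TowerTwist`.
-/

set_option linter.unusedSectionVars false

noncomputable section

namespace Metaplectic

open ValuativeRel

/-! ### Balls, squares and characters of a local field -/

section LocalField

variable {F : Type u} [Field F] [ValuativeRel F] [TopologicalSpace F]
  [IsNonarchimedeanLocalField F]

variable (F) in
lemma exists_uniformizer :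
    ∃ ϖ : F, ϖ ≠ 0 ∧ valuation F ϖ < 1 ∧
      ∀ x : F, valuation F x < 1 → valuation F x ≤ valuation F ϖ := by
  obtain ⟨ϖ, hϖ⟩ := ValuativeRel.valuation_surjective (ValuativeRel.uniformizer F)
  refine ⟨ϖ, ?_, ?_, fun x hx => ?_⟩
  · rintro rfl
    rw [map_zero] at hϖ
    exact ValuativeRel.uniformizer_ne_zero hϖ.symm
  · rw [hϖ]; exact ValuativeRel.uniformizer_lt_one
  · rw [hϖ]
    exact ValuativeRel.le_uniformizer_iff.mpr hx

/-- The closed ball of radius `γ` about `0`. -/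
def ball (F : Type u) [Field F] [ValuativeRel F] (γ : ValueGroupWithZero F) : AddSubgroup F where
  carrier := {x | valuation F x ≤ γ}
  zero_mem' := by simp
  add_mem' hx hy := (valuation F).map_add_le hx hy
  neg_mem' := by simp

@[simp] lemma mem_ball {γ : ValueGroupWithZero F} {x : F} : x ∈ ball F γ ↔ valuation F x ≤ γ :=
  Iff.rfl

/-- Compact open subgroups, the lattices over which characters of second degree are integrated. -/
def IsCompactOpen {V : Type*} [AddCommGroup V] [TopologicalSpace V] (K : AddSubgroup V) : Prop :=
  IsCompact (K : Set V) ∧ IsOpen (K : Set V)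

lemma ball_isCompactOpen {γ : ValueGroupWithZero F} (hγ : γ ≠ 0) : IsCompactOpen (ball F γ) := by
  refine ⟨IsNonarchimedeanLocalField.isCompact_closedBall F γ,
    AddSubgroup.isOpen_of_mem_nhds _ (g := 0) ?_⟩
  exact Filter.mem_of_superset ((IsValuativeTopology.hasBasis_nhds_zero' F).mem_of_mem hγ)
    fun x (hx : valuation F x < γ) => hx.le

lemma exists_ball_subset {s : Set F} (hs : s ∈ nhds (0 : F)) :
    ∃ γ : ValueGroupWithZero F, γ ≠ 0 ∧ ((ball F γ : AddSubgroup F) : Set F) ⊆ s := by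
  obtain ⟨γ, hγ, h⟩ := (IsValuativeTopology.hasBasis_nhds_zero' F).mem_iff.mp hs
  obtain ⟨ϖ, h0, h1, -⟩ := exists_uniformizer F
  have h0' : valuation F ϖ ≠ 0 := by simpa using h0
  refine ⟨γ * valuation F ϖ, mul_ne_zero hγ h0', fun x hx => h ?_⟩
  exact lt_of_le_of_lt hx (mul_lt_of_lt_one_right (zero_lt_iff.mpr hγ) h1)

lemma exists_subset_ball {s : Set F} (hs : IsCompact s) :
    ∃ γ : ValueGroupWithZero F, γ ≠ 0 ∧ s ⊆ ball F γ := by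
  obtain ⟨γ, hγ⟩ := hs.elim_directed_cover
    (fun γ : (ValueGroupWithZero F)ˣ => ((ball F γ : AddSubgroup F) : Set F))
    (fun γ => (ball_isCompactOpen γ.ne_zero).2)
    (fun x _ => by
      rw [Set.mem_iUnion]
      by_cases hx : valuation F x = 0
      · exact ⟨1, by simp [hx]⟩
      · exact ⟨Units.mk0 _ hx, by simp⟩)
    (directed_of_isDirected_le fun a b hab x hx =>
      le_trans (mem_ball.mp hx) (Units.val_le_val.mpr hab))
  exact ⟨γ, γ.ne_zero, hγ⟩

instance secondCountable : SecondCountableTopology F := by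
  let := IsTopologicalAddGroup.rightUniformSpace F
  have := isUniformAddGroup_of_addCommGroup (G := F)
  have : Countable (WithZero (Multiplicative ℤ)) := inferInstanceAs (Countable (Option ℤ))
  have : Countable (ValueGroupWithZero F) :=
    (IsNonarchimedeanLocalField.valueGroupWithZeroIsoInt F).toEquiv.countable_iff.mpr inferInstance
  have : (nhds (0 : F)).IsCountablyGenerated :=
    Filter.HasCountableBasis.isCountablyGenerated
      ⟨IsValuativeTopology.hasBasis_nhds_zero' F, Set.to_countable _⟩
  have := IsUniformAddGroup.uniformity_countably_generated (α := F)
  let := UniformSpace.pseudoMetricSpace F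
  have : SigmaCompactSpace F :=
    SigmaCompactSpace.of_countable (Set.range fun γ => ((ball F γ : AddSubgroup F) : Set F))
      (Set.countable_range _)
      (by rintro _ ⟨γ, rfl⟩; exact IsNonarchimedeanLocalField.isCompact_closedBall F γ)
      (Set.eq_univ_of_forall fun x =>
        ⟨_, ⟨valuation F x, rfl⟩, show valuation F x ≤ valuation F x from le_rfl⟩)
  exact EMetric.secondCountable_of_sigmaCompact F

lemma mem_maximalIdeal_iff {x : 𝒪[F]} : x ∈ 𝓂[F] ↔ valuation F x < 1 := by
  rw [IsLocalRing.mem_maximalIdeal, mem_nonunits_iff,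
    (Valuation.integer.integers (valuation F)).isUnit_iff_valuation_eq_one]
  exact (show valuation F x ≤ 1 from x.2).lt_iff_ne.symm

/-- Hensel's lemma for `T² - T + u`: its discriminant is a square. -/
lemma exists_sq_eq_one_sub_four_mul {u : F} (hu : valuation F u < 1) :
    ∃ s : F, s ^ 2 = 1 - 4 * u := by
  let := IsTopologicalAddGroup.rightUniformSpace F
  have := isUniformAddGroup_of_addCommGroup (G := F)
  have H := (IsAdicComplete.henselianRing 𝒪[F] 𝓂[F]).is_henselian
  let U : 𝒪[F] := ⟨u, hu.le⟩
  have hU : U ∈ 𝓂[F] := mem_maximalIdeal_iff.mpr hu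
  obtain ⟨a, ha, -⟩ := H (Polynomial.X ^ 2 - Polynomial.X + Polynomial.C U) (by monicity!) 0
    (by simpa using hU) (by simp)
  have ha' : (a : F) ^ 2 - a + u = 0 := by
    have := congrArg (Subtype.val) ha
    simpa [Polynomial.IsRoot] using this
  exact ⟨2 * a - 1, by linear_combination 4 * ha'⟩

/-- The circle group has no small subgroups. -/
lemma circle_eq_one_of_forall_re_pos {z : Circle} (h : ∀ n : ℕ, 0 < ((z ^ n : Circle) : ℂ).re) :
    z = 1 := by
  have hle : ∀ w : Circle, (w : ℂ).re ≤ 1 := fun w =>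
    (Complex.re_le_norm _).trans_eq (Circle.norm_coe w)
  have hsq : ∀ w : Circle, ((w ^ 2 : Circle) : ℂ).re = 2 * (w : ℂ).re ^ 2 - 1 := fun w => by
    have h1 : (w : ℂ).re * (w : ℂ).re + (w : ℂ).im * (w : ℂ).im = 1 := by
      rw [← Complex.normSq_apply, Circle.normSq_coe]
    rw [Circle.coe_pow, pow_two, Complex.mul_re]
    linarith
  -- the defect `1 - Re` at least doubles under squaring, as long as `Re > 0`
  have hgrow : ∀ n : ℕ, 2 ^ n * (1 - (z : ℂ).re) ≤ 1 - ((z ^ 2 ^ n : Circle) : ℂ).re := by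
    intro n
    induction n with
    | zero => simp
    | succ n ih =>
      have h0 := h (2 ^ n)
      have h1 := hle (z ^ 2 ^ n)
      have h2 : z ^ 2 ^ (n + 1) = (z ^ 2 ^ n) ^ 2 := by rw [pow_succ, pow_mul]
      rw [h2, hsq, pow_succ]
      nlinarith
  have hre : (z : ℂ).re ≤ 1 := hle z
  have hz : (z : ℂ).re = 1 := by
    by_contra hne
    have hpos : 0 < 1 - (z : ℂ).re := sub_pos.mpr (lt_of_le_of_ne hre hne)
    obtain ⟨n, hn⟩ := pow_unbounded_of_one_lt (1 / (1 - (z : ℂ).re)) (one_lt_two (α := ℝ))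
    rw [div_lt_iff₀ hpos] at hn
    have := hgrow n
    have := h (2 ^ n)
    linarith
  have him : (z : ℂ).im = 0 := by
    have h1 : (z : ℂ).re * (z : ℂ).re + (z : ℂ).im * (z : ℂ).im = 1 := by
      rw [← Complex.normSq_apply, Circle.normSq_coe]
    rw [hz] at h1
    nlinarith
  exact Circle.ext (Complex.ext (by simpa using hz) (by simpa using him))

/-- A continuous character is trivial on a small lattice. -/
lemma exists_ball_trivial {ψ : AddChar F Circle} (hψ : Continuous ψ) :
    ∃ γ : ValueGroupWithZero F, γ ≠ 0 ∧ ∀ x, valuation F x ≤ γ → ψ x = 1 := by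
  have hU : {x : F | 0 < ((ψ x : Circle) : ℂ).re} ∈ nhds (0 : F) := by
    refine (isOpen_lt continuous_const (by fun_prop)).mem_nhds ?_
    simp
  obtain ⟨γ, hγ, h⟩ := exists_ball_subset hU
  refine ⟨γ, hγ, fun x hx => circle_eq_one_of_forall_re_pos fun n => ?_⟩
  rw [← AddChar.map_nsmul_eq_pow]
  exact h ((ball F γ).nsmul_mem hx n)

end LocalField

/-! ### Integrals of characters of second degree -/

section SecondDegree

open MeasureTheory MeasureTheory.Measure QuadraticMap
open scoped Pointwise

variable {F : Type u} [Field F] [TopologicalSpace F] {ψ : AddChar F Circle}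
  {V : Type*} [AddCommGroup V] [Module F V] [TopologicalSpace V] [IsTopologicalAddGroup V]
  [LocallyCompactSpace V] [SecondCountableTopology V] [MeasurableSpace V] [BorelSpace V]
  {W : Type*} [AddCommGroup W] [Module F W] [TopologicalSpace W] [IsTopologicalAddGroup W]
  [LocallyCompactSpace W] [SecondCountableTopology W] [MeasurableSpace W] [BorelSpace W]

omit [Module F V] [LocallyCompactSpace V] [SecondCountableTopology V] in
lemma setIntegral_add_right (μ : Measure V) [μ.IsAddRightInvariant] {S : Set V}
    (hS : MeasurableSet S) {k : V} (hk : ∀ x, x + k ∈ S ↔ x ∈ S) (f : V → ℂ) :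
    ∫ x in S, f (x + k) ∂μ = ∫ x in S, f x ∂μ := by
  rw [← integral_indicator hS, ← integral_indicator hS,
    ← integral_add_right_eq_self (S.indicator f) k]
  congr 1
  ext x
  by_cases h : x ∈ S
  · rw [Set.indicator_of_mem h, Set.indicator_of_mem ((hk x).mpr h)]
  · rw [Set.indicator_of_notMem h, Set.indicator_of_notMem (mt (hk x).mp h)]

lemma IsCompactOpen.measurableSet {K : AddSubgroup V} (hK : IsCompactOpen K) :
    MeasurableSet (K : Set V) := hK.2.measurableSet

lemma IsCompactOpen.measure_ne_top {K : AddSubgroup V} (hK : IsCompactOpen K) (μ : Measure V)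
    [μ.IsAddHaarMeasure] : μ K ≠ ⊤ := hK.1.measure_ne_top

lemma IsCompactOpen.measureReal_pos {K : AddSubgroup V} (hK : IsCompactOpen K) (μ : Measure V)
    [μ.IsAddHaarMeasure] : 0 < μ.real K :=
  ENNReal.toReal_pos (hK.2.measure_pos μ ⟨0, K.zero_mem⟩).ne' (hK.measure_ne_top μ)

omit [LocallyCompactSpace V] [SecondCountableTopology V] [MeasurableSpace V] [BorelSpace V] in
lemma IsCompactOpen.sup {K L : AddSubgroup V} (hK : IsCompactOpen K) (hL : IsCompactOpen L) :
    IsCompactOpen (K ⊔ L) := by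
  refine ⟨?_, AddSubgroup.isOpen_mono le_sup_left hK.2⟩
  have : ((K ⊔ L : AddSubgroup V) : Set V) = (K : Set V) + (L : Set V) := AddSubgroup.add_normal K L
  rw [this]
  exact hK.1.add hL.1

omit [LocallyCompactSpace V] [SecondCountableTopology V] [MeasurableSpace V] [BorelSpace V]
  [LocallyCompactSpace W] [SecondCountableTopology W] [MeasurableSpace W] [BorelSpace W] in
lemma IsCompactOpen.prod {K : AddSubgroup V} {L : AddSubgroup W} (hK : IsCompactOpen K)
    (hL : IsCompactOpen L) : IsCompactOpen (K.prod L) :=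
  ⟨hK.1.prod hL.1, hK.2.prod hL.2⟩

/-- A character that is non-trivial on a subgroup has integral zero over it. -/
lemma setIntegral_addChar_eq_zero (μ : Measure V) [μ.IsAddRightInvariant] {K : AddSubgroup V}
    (hK : MeasurableSet (K : Set V)) (χ : V → ℂ) {k₀ : V} (hk₀ : k₀ ∈ K) {c : ℂ} (hc : c ≠ 1)
    (hχ : ∀ k, χ (k + k₀) = c * χ k) : ∫ k in K, χ k ∂μ = 0 := by
  have h := setIntegral_add_right μ hK (k := k₀)
    (fun x => by simp [K.add_mem_cancel_right hk₀]) χ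
  simp only [hχ, integral_const_mul] at h
  have h' : (c - 1) * ∫ k in K, χ k ∂μ = 0 := by linear_combination h
  exact (mul_eq_zero.mp h').resolve_left (sub_ne_zero.mpr hc)

lemma map_quad_add (ψ : AddChar F Circle) (Q : QuadraticForm F V) (x k : V) :
    (ψ (Q (x + k)) : ℂ) = ψ (Q x) * ψ (Q k) * ψ (polar Q x k) := by
  have : Q (x + k) = Q x + Q k + polar Q x k := by simp [polar]
  rw [this, AddChar.map_add_eq_mul, AddChar.map_add_eq_mul]
  simp

/-- The orthogonal of `K` with respect to the bicharacter of `ψ ∘ Q`. -/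
def orth (ψ : AddChar F Circle) (Q : QuadraticForm F V) (K : AddSubgroup V) : AddSubgroup V where
  carrier := {x | ∀ k ∈ K, ψ (polar Q x k) = 1}
  zero_mem' k _ := by simp
  add_mem' {x y} hx hy k hk := by
    rw [polar_add_left, AddChar.map_add_eq_mul, hx k hk, hy k hk, one_mul]
  neg_mem' {x} hx k hk := by
    rw [polar_neg_left, AddChar.map_neg_eq_inv, hx k hk, inv_one]

lemma mem_orth {Q : QuadraticForm F V} {K : AddSubgroup V} {x : V} :
    x ∈ orth ψ Q K ↔ ∀ k ∈ K, ψ (polar Q x k) = 1 := Iff.rfl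

lemma continuous_polar [IsTopologicalRing F] {Q : QuadraticForm F V} (hQ : Continuous Q) :
    Continuous fun p : V × V => polar Q p.1 p.2 := by
  unfold polar
  fun_prop

lemma isClosed_orth [IsTopologicalRing F] (hψ : Continuous ψ) {Q : QuadraticForm F V}
    (hQ : Continuous Q) (K : AddSubgroup V) : IsClosed (orth ψ Q K : Set V) := by
  have : (orth ψ Q K : Set V) = ⋂ k ∈ K, {x | ψ (polar Q x k) = 1} := by
    ext x
    simp [mem_orth]
  rw [this]
  refine isClosed_biInter fun k _ => isClosed_eq (hψ.comp ?_) continuous_const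
  exact (continuous_polar hQ).comp (by fun_prop : Continuous fun x : V => (x, k))

/-- The points outside the orthogonal of `K` do not contribute to the integral of `ψ ∘ Q` over a
lattice containing `K`, if `ψ ∘ Q` is trivial on `K`: translates by `K` average to zero. -/
theorem setIntegral_eq_inter_orth [IsTopologicalRing F] (hψ : Continuous ψ)
    {Q : QuadraticForm F V} (hQ : Continuous Q) (μ : Measure V) [μ.IsAddHaarMeasure]
    {K Λ : AddSubgroup V} (hK : IsCompactOpen K) (hΛ : IsCompactOpen Λ) (hKΛ : K ≤ Λ)
    (h1 : ∀ k ∈ K, ψ (Q k) = 1) :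
    ∫ x in Λ, (ψ (Q x) : ℂ) ∂μ =
      ∫ x in ((Λ ⊓ orth ψ Q K : AddSubgroup V) : Set V), (ψ (Q x) : ℂ) ∂μ := by
  have hc : Continuous fun x => (ψ (Q x) : ℂ) := by fun_prop
  have hSm : MeasurableSet (orth ψ Q K : Set V) := (isClosed_orth hψ hQ K).measurableSet
  set A : Set V := (Λ : Set V) \ orth ψ Q K with hA
  have hAm : MeasurableSet A := hΛ.measurableSet.diff hSm
  have hint : IntegrableOn (fun x => (ψ (Q x) : ℂ)) Λ μ :=
    Measure.integrableOn_of_bounded (M := 1) (hΛ.measure_ne_top μ) hc.aestronglyMeasurable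
      (Filter.Eventually.of_forall fun x => (Circle.norm_coe _).le)
  rw [← integral_inter_add_sdiff hSm hint, AddSubgroup.coe_inf]
  suffices ∫ x in A, (ψ (Q x) : ℂ) ∂μ = 0 by rw [← hA, this, add_zero]
  have hAfin : μ A ≠ ⊤ := ne_top_of_le_ne_top (hΛ.measure_ne_top μ) (measure_mono Set.sdiff_subset)
  have hKorth : K ≤ orth ψ Q K := fun x hx k hk => by
    have : (ψ (Q (x + k)) : ℂ) = ψ (Q x) * ψ (Q k) * ψ (polar Q x k) := map_quad_add ψ Q x k
    rw [h1 _ (K.add_mem hx hk), h1 x hx, h1 k hk] at this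
    simpa [Circle.ext_iff] using this.symm
  have hAk : ∀ k ∈ K, ∀ x, x + k ∈ A ↔ x ∈ A := fun k hk x => by
    simp only [hA, Set.mem_sdiff, SetLike.mem_coe, Λ.add_mem_cancel_right (hKΛ hk),
      (orth ψ Q K).add_mem_cancel_right (hKorth hk)]
  have hL : ∫ k in K, (∫ x in A, (ψ (Q (x + k)) : ℂ) ∂μ) ∂μ =
      μ.real K * ∫ x in A, (ψ (Q x) : ℂ) ∂μ := by
    rw [setIntegral_congr_fun hK.measurableSet
      (g := fun _ => ∫ x in A, (ψ (Q x) : ℂ) ∂μ)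
      (fun k hk => setIntegral_add_right μ hAm (hAk k hk) _), setIntegral_const]
    simp
  have hR : ∫ x in A, (∫ k in K, (ψ (Q (x + k)) : ℂ) ∂μ) ∂μ = 0 := by
    refine setIntegral_eq_zero_of_forall_eq_zero fun x hx => ?_
    obtain ⟨k₀, hk₀, hne⟩ : ∃ k ∈ K, ψ (polar Q x k) ≠ 1 := by
      by_contra! h
      exact hx.2 h
    rw [setIntegral_congr_fun hK.measurableSet
      (g := fun k => (ψ (Q x) : ℂ) * ψ (polar Q x k))
      (fun k hk => by simp [map_quad_add, h1 k hk]), integral_const_mul,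
      setIntegral_addChar_eq_zero μ hK.measurableSet _ hk₀ (c := ψ (polar Q x k₀))
        (by simpa [Circle.ext_iff] using hne), mul_zero]
    intro k
    rw [polar_add_right, AddChar.map_add_eq_mul, mul_comm, Circle.coe_mul]
  have hswap := integral_integral_swap (μ := μ.restrict K) (ν := μ.restrict A)
    (f := fun k x => (ψ (Q (x + k)) : ℂ)) (by
      have : IsFiniteMeasure (μ.restrict (K : Set V)) :=
        ⟨by simpa using (hK.measure_ne_top μ).lt_top⟩
      have : IsFiniteMeasure (μ.restrict A) := ⟨by simpa using hAfin.lt_top⟩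
      refine Integrable.of_bound (C := 1) ?_
        (Filter.Eventually.of_forall fun p => (Circle.norm_coe _).le)
      refine Continuous.aestronglyMeasurable ?_
      simp only [Function.uncurry_def]
      fun_prop)
  rw [hL, hR] at hswap
  exact (mul_eq_zero.mp hswap).resolve_left (by exact_mod_cast (hK.measureReal_pos μ).ne')

/-- `z` is the phase of the integral of `ψ ∘ Q` over all sufficiently large lattices. -/
def HasWeilPhase (ψ : AddChar F Circle) (Q : QuadraticForm F V) (z : ℂ) : Prop :=
  ‖z‖ = 1 ∧ ∃ μ : Measure V, μ.IsAddHaarMeasure ∧ ∃ r : ℝ, 0 < r ∧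
    ∃ K : AddSubgroup V, IsCompactOpen K ∧
      ∀ Λ : AddSubgroup V, IsCompactOpen Λ → K ≤ Λ → ∫ x in Λ, (ψ (Q x) : ℂ) ∂μ = r * z

/-- A form of non-degeneracy: some lattice on which `ψ ∘ Q` is trivial has an
orthogonal contained in a lattice. -/
def IsTame (ψ : AddChar F Circle) (Q : QuadraticForm F V) : Prop :=
  ∃ K L : AddSubgroup V, IsCompactOpen K ∧ IsCompactOpen L ∧ (∀ k ∈ K, ψ (Q k) = 1) ∧
    orth ψ Q K ≤ L

/-- The integrals of `ψ ∘ Q` over large lattices stabilize. -/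
lemma IsTame.exists_integral_eq [IsTopologicalRing F] (hψ : Continuous ψ)
    {Q : QuadraticForm F V} (hQ : Continuous Q) (h : IsTame ψ Q) (μ : Measure V)
    [μ.IsAddHaarMeasure] : ∃ (K : AddSubgroup V) (I : ℂ), IsCompactOpen K ∧
      ∀ Λ : AddSubgroup V, IsCompactOpen Λ → K ≤ Λ → ∫ x in Λ, (ψ (Q x) : ℂ) ∂μ = I := by
  obtain ⟨K, L, hK, hL, h1, hKL⟩ := h
  refine ⟨K ⊔ L, ∫ x in ((orth ψ Q K : AddSubgroup V) : Set V), (ψ (Q x) : ℂ) ∂μ, hK.sup hL,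
    fun Λ hΛ h => ?_⟩
  rw [setIntegral_eq_inter_orth hψ hQ μ hK hΛ (le_sup_left.trans h) h1,
    inf_eq_right.mpr (hKL.trans (le_sup_right.trans h))]

/-- The choice of Haar measure is immaterial for the phase. -/
lemma HasWeilPhase.exists_integral_eq {Q : QuadraticForm F V} {z : ℂ} (h : HasWeilPhase ψ Q z)
    (μ : Measure V) [μ.IsAddHaarMeasure] : ∃ r : ℝ, 0 < r ∧
    ∃ K : AddSubgroup V, IsCompactOpen K ∧
      ∀ Λ : AddSubgroup V, IsCompactOpen Λ → K ≤ Λ → ∫ x in Λ, (ψ (Q x) : ℂ) ∂μ = r * z := by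
  obtain ⟨-, ν, hν, r, hr, K, hK, h⟩ := h
  have hc : 0 < addHaarScalarFactor μ ν := addHaarScalarFactor_pos_of_isAddHaarMeasure μ ν
  rw [isAddLeftInvariant_eq_smul μ ν]
  refine ⟨addHaarScalarFactor μ ν * r, mul_pos (by exact_mod_cast hc) hr, K, hK, fun Λ hΛ hKΛ => ?_⟩
  rw [Measure.restrict_smul, integral_smul_nnreal_measure, h Λ hΛ hKΛ]
  simp [NNReal.smul_def, mul_assoc]

lemma HasWeilPhase.unique {Q : QuadraticForm F V} {z w : ℂ} (hz : HasWeilPhase ψ Q z)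
    (hw : HasWeilPhase ψ Q w) : z = w := by
  obtain ⟨r, hr, K, hK, h⟩ := hz.exists_integral_eq addHaar
  obtain ⟨s, hs, L, hL, h'⟩ := hw.exists_integral_eq addHaar
  have e := (h _ (hK.sup hL) le_sup_left).symm.trans (h' _ (hK.sup hL) le_sup_right)
  have hn := congrArg norm e
  rw [norm_mul, norm_mul, hz.1, hw.1, mul_one, mul_one, Complex.norm_real, Complex.norm_real,
    Real.norm_of_nonneg hr.le, Real.norm_of_nonneg hs.le] at hn
  rw [hn] at e
  exact mul_left_cancel₀ (by exact_mod_cast hs.ne') e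

/-- The preimage of a lattice under an isomorphism is a lattice. -/
lemma IsCompactOpen.comap {K : AddSubgroup W} (hK : IsCompactOpen K) (T : V ≃ₜ+ W) :
    IsCompactOpen (K.comap (T : V →+ W)) :=
  ⟨T.toHomeomorph.isCompact_preimage.mpr hK.1, hK.2.preimage T.continuous⟩

/-- Isometric quadratic forms have the same Weil index. -/
lemma HasWeilPhase.of_isometry {Q : QuadraticForm F V} {Q' : QuadraticForm F W} {z : ℂ}
    (h : HasWeilPhase ψ Q' z) (T : V ≃ₜ+ W) (hT : ∀ x, Q' (T x) = Q x) : HasWeilPhase ψ Q z := by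
  obtain ⟨hz, μ, hμ, r, hr, K, hK, h⟩ := h
  refine ⟨hz, μ.map T.symm, T.symm.isAddHaarMeasure_map μ, r, hr, _, hK.comap T,
    fun Λ hΛ hKΛ => ?_⟩
  have hm : MeasurableEmbedding T.symm := T.symm.toHomeomorph.measurableEmbedding
  rw [hm.setIntegral_map, ← h _ (hΛ.comap T.symm) fun x hx => hKΛ (by simpa using hx)]
  refine integral_congr_ae (Filter.Eventually.of_forall fun x => ?_)
  simp [← hT]

lemma IsTame.of_isometry {Q : QuadraticForm F V} {Q' : QuadraticForm F W}
    (h : IsTame ψ Q') (T : V ≃ₜ+ W) (hT : ∀ x, Q' (T x) = Q x) : IsTame ψ Q := by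
  obtain ⟨K, L, hK, hL, h1, h2⟩ := h
  refine ⟨_, _, hK.comap T, hL.comap T, fun k hk => by rw [← hT]; exact h1 _ hk, fun x hx => ?_⟩
  refine h2 fun k hk => ?_
  have := hx (T.symm k) (by simpa using hk)
  simpa [polar, ← hT] using this

lemma IsTame.prod {Q : QuadraticForm F V} {Q' : QuadraticForm F W}
    (h : IsTame ψ Q) (h' : IsTame ψ Q') : IsTame ψ (Q.prod Q') := by
  obtain ⟨K, L, hK, hL, h1, h2⟩ := h
  obtain ⟨K', L', hK', hL', h1', h2'⟩ := h'
  refine ⟨_, _, hK.prod hK', hL.prod hL', fun k hk => ?_, fun x hx => ⟨?_, ?_⟩⟩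
  · rw [QuadraticMap.prod_apply, AddChar.map_add_eq_mul, h1 _ hk.1, h1' _ hk.2, one_mul]
  · refine h2 fun k hk => ?_
    simpa [polar_zero_right] using hx (k, 0) ⟨hk, K'.zero_mem⟩
  · refine h2' fun k hk => ?_
    simpa [polar_zero_right] using hx (0, k) ⟨K.zero_mem, hk⟩

lemma setIntegral_prod_quad {Q : QuadraticForm F V} {Q' : QuadraticForm F W} (μ : Measure V)
    [μ.IsAddHaarMeasure] (ν : Measure W) [ν.IsAddHaarMeasure] (K : AddSubgroup V)
    (L : AddSubgroup W) :
    ∫ x in ((K.prod L : AddSubgroup (V × W)) : Set (V × W)), (ψ (Q.prod Q' x) : ℂ) ∂(μ.prod ν) =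
      (∫ x in K, (ψ (Q x) : ℂ) ∂μ) * ∫ x in L, (ψ (Q' x) : ℂ) ∂ν := by
  rw [← setIntegral_prod_mul, AddSubgroup.coe_prod]
  simp [AddChar.map_add_eq_mul]

/-- The Weil index is multiplicative on orthogonal sums. -/
lemma HasWeilPhase.prod [IsTopologicalRing F] (hψ : Continuous ψ) {Q : QuadraticForm F V}
    {Q' : QuadraticForm F W} (hQ : Continuous Q) (hQ' : Continuous Q') (ht : IsTame ψ Q)
    (ht' : IsTame ψ Q') {z w : ℂ} (h : HasWeilPhase ψ Q z) (h' : HasWeilPhase ψ Q' w) :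
    HasWeilPhase ψ (Q.prod Q') (z * w) := by
  obtain ⟨r, hr, K, hK, hz⟩ := h.exists_integral_eq addHaar
  obtain ⟨s, hs, L, hL, hw⟩ := h'.exists_integral_eq addHaar
  have hc : Continuous (Q.prod Q') := by
    change Continuous fun x : V × W => Q x.1 + Q' x.2
    fun_prop
  obtain ⟨M, I, hM, hI⟩ := (ht.prod ht').exists_integral_eq hψ hc (addHaar.prod addHaar)
  refine ⟨by simp [h.1, h'.1], addHaar.prod addHaar, inferInstance, r * s, mul_pos hr hs, M, hM,
    fun Λ hΛ hMΛ => ?_⟩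
  -- all large lattices give the same value, so it may be computed on a product of two lattices
  have hpr : M ≤ (K ⊔ M.map (AddMonoidHom.fst V W)).prod (L ⊔ M.map (AddMonoidHom.snd V W)) :=
    fun x hx => ⟨AddSubgroup.mem_sup_right ⟨x, hx, rfl⟩, AddSubgroup.mem_sup_right ⟨x, hx, rfl⟩⟩
  have h1 : IsCompactOpen (K ⊔ M.map (AddMonoidHom.fst V W)) := hK.sup
    ⟨hM.1.image continuous_fst, isOpenMap_fst _ hM.2⟩
  have h2 : IsCompactOpen (L ⊔ M.map (AddMonoidHom.snd V W)) := hL.sup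
    ⟨hM.1.image continuous_snd, isOpenMap_snd _ hM.2⟩
  rw [hI Λ hΛ hMΛ, ← hI _ (h1.prod h2) hpr, setIntegral_prod_quad, hz _ h1 le_sup_left,
    hw _ h2 le_sup_left]
  push_cast
  ring

lemma HasWeilPhase.neg {Q : QuadraticForm F V} {z : ℂ} (h : HasWeilPhase ψ Q z) :
    HasWeilPhase ψ (-Q) (starRingEnd ℂ z) := by
  obtain ⟨hz, μ, hμ, r, hr, K, hK, h⟩ := h
  refine ⟨by simpa using hz, μ, hμ, r, hr, K, hK, fun Λ hΛ hKΛ => ?_⟩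
  have := congrArg (starRingEnd ℂ) (h Λ hΛ hKΛ)
  rw [← integral_conj] at this
  simpa [AddChar.map_neg_eq_inv, Circle.coe_inv_eq_conj, -Circle.coe_inv] using this

end SecondDegree

/-! ### Weil indices of forms in one and two variables -/

section Unary

open MeasureTheory MeasureTheory.Measure QuadraticMap ValuativeRel

variable {F : Type u} [Field F] [ValuativeRel F] [TopologicalSpace F]
  [IsNonarchimedeanLocalField F] {ψ : AddChar F Circle}

/-- The quadratic form `c x²`. -/
def unary (c : F) : QuadraticForm F F := c • QuadraticMap.sq

omit [ValuativeRel F] [TopologicalSpace F] [IsNonarchimedeanLocalField F] in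
@[simp] lemma unary_apply (c x : F) : unary c x = c * (x * x) := rfl

omit [ValuativeRel F] [TopologicalSpace F] [IsNonarchimedeanLocalField F] in
lemma polar_unary (c x y : F) : polar (unary c) x y = 2 * c * x * y := by
  simp only [polar, unary_apply]
  ring

lemma continuous_unary (c : F) : Continuous (unary c) :=
  (by fun_prop : Continuous fun x : F => c * (x * x))

lemma continuous_binary (c d : F) : Continuous ((unary c).prod (unary d)) :=
  (by fun_prop : Continuous fun x : F × F => c * (x.1 * x.1) + d * (x.2 * x.2))

omit [ValuativeRel F] [TopologicalSpace F] [IsNonarchimedeanLocalField F] in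
lemma exists_ne_one (hψ1 : ψ ≠ 1) : ∃ t : F, t ≠ 0 ∧ ψ t ≠ 1 := by
  obtain ⟨t, ht⟩ := AddChar.ne_one_iff.mp hψ1
  exact ⟨t, fun h => ht (by simp [h]), ht⟩

lemma isTame_unary (h2 : (2 : F) ≠ 0) (hψ : Continuous ψ) (hψ1 : ψ ≠ 1) {c : F} (hc : c ≠ 0) :
    IsTame ψ (unary c) := by
  obtain ⟨γ, hγ, h1⟩ := exists_ball_trivial hψ
  obtain ⟨t, ht0, ht⟩ := exists_ne_one hψ1
  have hv : ∀ {x : F}, x ≠ 0 → valuation F x ≠ 0 := fun {x} hx => by simpa using hx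
  set κ : ValueGroupWithZero F := min 1 (γ / valuation F c) with hκ
  have hκ0 : κ ≠ 0 := by
    rcases min_choice 1 (γ / valuation F c) with h | h <;> rw [hκ, h]
    · exact one_ne_zero
    · exact div_ne_zero hγ (hv hc)
  have hL : valuation F t / (valuation F (2 * c) * κ) ≠ 0 :=
    div_ne_zero (hv ht0) (mul_ne_zero (hv (mul_ne_zero h2 hc)) hκ0)
  refine ⟨ball F κ, ball F _, ball_isCompactOpen hκ0, ball_isCompactOpen hL, fun k hk => h1 _ ?_,
    fun x hx => ?_⟩
  · have h3 : valuation F k * valuation F k ≤ γ / valuation F c :=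
      (mul_le_of_le_one_left' ((mem_ball.mp hk).trans (min_le_left _ _))).trans
        ((mem_ball.mp hk).trans (min_le_right _ _))
    rw [unary_apply, map_mul, map_mul]
    rwa [le_div_iff₀ (zero_lt_iff.mpr (hv hc)), mul_comm] at h3
  · rw [mem_ball]
    rcases eq_or_ne x 0 with rfl | hx0
    · simp
    by_contra hlt
    rw [not_le, div_lt_iff₀ (zero_lt_iff.mpr (mul_ne_zero (hv (mul_ne_zero h2 hc)) hκ0))] at hlt
    refine ht ?_
    have hne : 2 * c * x ≠ 0 := mul_ne_zero (mul_ne_zero h2 hc) hx0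
    have := hx (t / (2 * c * x)) (by
      rw [mem_ball, map_div₀, div_le_iff₀ (zero_lt_iff.mpr (hv hne)), map_mul]
      calc valuation F t ≤ valuation F x * (valuation F (2 * c) * κ) := hlt.le
        _ = _ := by rw [mul_comm, mul_assoc, mul_left_comm])
    rwa [polar_unary, mul_div_cancel₀ _ hne] at this

variable [MeasurableSpace F] [BorelSpace F]

/-- The isometry of the plane `c (x² - y²)` with the plane `4 c x y`. -/
def hypEquiv (h2 : (2 : F) ≠ 0) : F × F ≃ₜ+ F × F where
  toFun p := (p.1 + p.2, p.1 - p.2)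
  invFun p := ((p.1 + p.2) / 2, (p.1 - p.2) / 2)
  left_inv p := by ext <;> simp <;> field_simp <;> ring
  right_inv p := by ext <;> simp <;> field_simp <;> ring
  map_add' p q := by ext <;> simp <;> ring
  continuous_toFun := by fun_prop
  continuous_invFun := by fun_prop

/-- The integral over lattices of `ψ ∘ Q`, for a hyperbolic plane `Q`, is positive. -/
lemma integral_hyperbolic (hψ : Continuous ψ) {c : F} (hc : c ≠ 0)
    {κ : ValueGroupWithZero F} (hκ : κ ≠ 0) :
    ∃ r : ℝ, 0 < r ∧ ∫ p in (((ball F κ).prod (ball F κ) : AddSubgroup (F × F)) : Set (F × F)),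
      (ψ (c * (p.1 * p.2)) : ℂ) ∂((addHaar : Measure F).prod addHaar) = r := by
  set B := ball F κ with hB
  have hBc : IsCompactOpen B := ball_isCompactOpen hκ
  let S : Set F := {x | x ∈ B ∧ ∀ y ∈ B, ψ (c * (x * y)) = 1}
  have hSm : MeasurableSet S := by
    have : S = (B : Set F) ∩ ⋂ y ∈ B, {x | ψ (c * (x * y)) = 1} := by
      ext x; simp [S]
    rw [this]
    exact hBc.measurableSet.inter (isClosed_biInter fun y _ =>
      isClosed_eq (hψ.comp (by fun_prop)) continuous_const).measurableSet
  have hin : ∀ x ∈ B, ∫ y in B, (ψ (c * (x * y)) : ℂ) ∂addHaar =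
      S.indicator (fun _ => ((addHaar : Measure F).real B : ℂ)) x := by
    intro x hx
    by_cases hxS : x ∈ S
    · rw [Set.indicator_of_mem hxS, setIntegral_congr_fun hBc.measurableSet
        (g := fun _ => (1 : ℂ)) (fun y hy => by simp [hxS.2 y hy])]
      simp
    · rw [Set.indicator_of_notMem hxS]
      obtain ⟨y, hy, hne⟩ : ∃ y ∈ B, ψ (c * (x * y)) ≠ 1 := by
        by_contra! h
        exact hxS ⟨hx, h⟩
      refine setIntegral_addChar_eq_zero _ hBc.measurableSet _ hy (c := ψ (c * (x * y)))
        (by simpa [Circle.ext_iff] using hne) fun k => ?_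
      rw [mul_add, mul_add, AddChar.map_add_eq_mul, mul_comm, Circle.coe_mul]
  have hS0 : 0 < (addHaar : Measure F).real S := by
    obtain ⟨γ, hγ, h1⟩ := exists_ball_trivial hψ
    have hcv : valuation F c ≠ 0 := by simpa using hc
    have hδ : min κ (γ / (valuation F c * κ)) ≠ 0 := by
      rcases min_choice κ (γ / (valuation F c * κ)) with h | h <;> rw [h]
      · exact hκ
      · exact div_ne_zero hγ (mul_ne_zero hcv hκ)
    refine ((ball_isCompactOpen hδ).measureReal_pos addHaar).trans_le
      (measureReal_mono
        (fun x hx => ⟨(mem_ball.mp hx).trans (min_le_left _ _), fun y hy => h1 _ ?_⟩)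
        (ne_top_of_le_ne_top (hBc.measure_ne_top _) (measure_mono fun x hx => hx.1)))
    rw [map_mul, map_mul]
    have hx' := (mem_ball.mp hx).trans (min_le_right _ _)
    rw [le_div_iff₀ (zero_lt_iff.mpr (mul_ne_zero hcv hκ))] at hx'
    calc valuation F c * (valuation F x * valuation F y)
        ≤ valuation F c * (valuation F x * κ) := by gcongr; exact mem_ball.mp hy
      _ = valuation F x * (valuation F c * κ) := mul_left_comm _ _ _
      _ ≤ γ := hx'
  have hSfin : (addHaar : Measure F) S ≠ ⊤ :=
    ne_top_of_le_ne_top (hBc.measure_ne_top _) (measure_mono fun x hx => hx.1)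
  refine ⟨(addHaar : Measure F).real S * (addHaar : Measure F).real B,
    mul_pos hS0 (hBc.measureReal_pos _), ?_⟩
  rw [AddSubgroup.coe_prod, setIntegral_prod, setIntegral_congr_fun hBc.measurableSet hin,
    setIntegral_indicator hSm]
  · have : (B : Set F) ∩ S = S := Set.inter_eq_right.mpr fun x hx => hx.1
    rw [this]
    simp
  · refine Measure.integrableOn_of_bounded (M := 1) ?_
      (Continuous.aestronglyMeasurable (by fun_prop))
      (Filter.Eventually.of_forall fun x => (Circle.norm_coe _).le)
    rw [Measure.prod_prod]
    exact ENNReal.mul_ne_top (hBc.measure_ne_top _) (hBc.measure_ne_top _)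

omit [ValuativeRel F] [IsNonarchimedeanLocalField F] [MeasurableSpace F] [BorelSpace F]
  [TopologicalSpace F] in
lemma unary_neg (c : F) : unary (-c) = -unary c := by
  ext x
  simp

/-- The Weil index of `c x²` exists: the integral over large lattices does not vanish, since its
square modulus is the integral of a hyperbolic plane. -/
lemma exists_hasWeilPhase_unary (h2 : (2 : F) ≠ 0) (hψ : Continuous ψ) (hψ1 : ψ ≠ 1) {c : F}
    (hc : c ≠ 0) : ∃ z, HasWeilPhase ψ (unary c) z := by
  obtain ⟨K, I, hK, hI⟩ :=
    (isTame_unary h2 hψ hψ1 hc).exists_integral_eq hψ (continuous_unary c) addHaar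
  have htame : IsTame ψ ((unary c).prod (unary (-c))) :=
    (isTame_unary h2 hψ hψ1 hc).prod (isTame_unary h2 hψ hψ1 (neg_ne_zero.mpr hc))
  let H : QuadraticForm F (F × F) :=
    (4 * c) • QuadraticMap.linMulLin (LinearMap.fst F F F) (LinearMap.snd F F F)
  have hHT : ∀ x, (unary c).prod (unary (-c)) (hypEquiv h2 x) = H x := fun x => by
    simp [H, hypEquiv]
    ring
  have hHc : Continuous H := (by fun_prop : Continuous fun x : F × F => (4 * c) * (x.1 * x.2))
  obtain ⟨M, J, hM, hJ⟩ := (htame.of_isometry (hypEquiv h2) hHT).exists_integral_eq hψ hHc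
    ((addHaar : Measure F).prod addHaar)
  have h4 : 4 * c ≠ 0 := by
    have : (4 : F) = 2 * 2 := by norm_num
    rw [this]
    exact mul_ne_zero (mul_ne_zero h2 h2) hc
  have hJ0 : HasWeilPhase ψ H 1 := by
    obtain ⟨κ, hκ, hMκ⟩ : ∃ κ : ValueGroupWithZero F, κ ≠ 0 ∧ M ≤ (ball F κ).prod (ball F κ) := by
      obtain ⟨κ₁, h₁, hs₁⟩ := exists_subset_ball (hM.1.image continuous_fst)
      obtain ⟨κ₂, h₂, hs₂⟩ := exists_subset_ball (hM.1.image continuous_snd)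
      refine ⟨max κ₁ κ₂, ?_, fun x hx => ⟨?_, ?_⟩⟩
      · exact (lt_of_lt_of_le (zero_lt_iff.mpr h₁) (le_max_left _ _)).ne'
      · exact le_trans (mem_ball.mp (hs₁ ⟨x, hx, rfl⟩)) (le_max_left _ _)
      · exact le_trans (mem_ball.mp (hs₂ ⟨x, hx, rfl⟩)) (le_max_right _ _)
    obtain ⟨r, hr, hint⟩ := integral_hyperbolic hψ h4 hκ
    refine ⟨by simp, (addHaar : Measure F).prod addHaar, inferInstance, r, hr, M, hM,
      fun Λ hΛ h => ?_⟩
    rw [hJ Λ hΛ h, ← hJ _ ((ball_isCompactOpen hκ).prod (ball_isCompactOpen hκ)) hMκ,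
      mul_one, ← hint]
    rfl
  have hprod : HasWeilPhase ψ ((unary c).prod (unary (-c))) 1 :=
    hJ0.of_isometry (hypEquiv h2).symm fun x => by rw [← hHT]; simp
  have hI0 : I ≠ 0 := by
    rintro rfl
    obtain ⟨r, hr, L, hL, h⟩ := hprod.exists_integral_eq ((addHaar : Measure F).prod addHaar)
    have h1 : IsCompactOpen (K ⊔ L.map (AddMonoidHom.fst F F)) := hK.sup
      ⟨hL.1.image continuous_fst, isOpenMap_fst _ hL.2⟩
    have h2 : IsCompactOpen (L.map (AddMonoidHom.snd F F)) :=
      ⟨hL.1.image continuous_snd, isOpenMap_snd _ hL.2⟩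
    have := h _ (h1.prod h2) fun x hx =>
      ⟨AddSubgroup.mem_sup_right ⟨x, hx, rfl⟩, ⟨x, hx, rfl⟩⟩
    rw [setIntegral_prod_quad, hI _ h1 le_sup_left, zero_mul, mul_one] at this
    exact hr.ne (by exact_mod_cast this)
  refine ⟨I / ‖I‖, by simp [hI0], addHaar, inferInstance, ‖I‖, norm_pos_iff.mpr hI0, K, hK,
    fun Λ hΛ h => ?_⟩
  rw [hI Λ hΛ h, mul_div_cancel₀]
  simpa using hI0

lemma weilIndex_eq {c : F} {z : ℂ} (h : HasWeilPhase ψ (unary c) z) :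
    weilIndex (ψ.mulShift c) = z := by
  obtain rfl : ‹MeasurableSpace F› = borel F := BorelSpace.measurable_eq
  let : MeasurableSpace F := borel F
  have : BorelSpace F := ⟨rfl⟩
  obtain ⟨r, hr, K, hK, hI⟩ := h.exists_integral_eq addHaar
  obtain ⟨γ, hγ, hKγ⟩ := exists_subset_ball hK.1
  unfold weilIndex
  refine Filter.Tendsto.limUnder_eq (tendsto_const_nhds.congr' ?_)
  filter_upwards [Filter.eventually_ge_atTop γ] with δ hδ
  have hδ0 : δ ≠ 0 := (lt_of_lt_of_le (zero_lt_iff.mpr hγ) hδ).ne'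
  have := hI (ball F δ) (ball_isCompactOpen hδ0) fun x hx => le_trans (mem_ball.mp (hKγ hx)) hδ
  have e : ∫ x in {x : F | valuation F x ≤ δ}, ((ψ.mulShift c) (x ^ 2) : ℂ) ∂(addHaar : Measure F)
      = r * z := by
    rw [← this]
    simp only [AddChar.mulShift_apply, unary_apply, pow_two]
    rfl
  simp only [e]
  rw [norm_mul, h.1, mul_one, Complex.norm_real, Real.norm_of_nonneg hr.le, mul_div_cancel_left₀]
  exact_mod_cast hr.ne'

lemma hasWeilPhase_unary (h2 : (2 : F) ≠ 0) (hψ : Continuous ψ) (hψ1 : ψ ≠ 1) {c : F}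
    (hc : c ≠ 0) : HasWeilPhase ψ (unary c) (weilIndex (ψ.mulShift c)) := by
  obtain ⟨z, hz⟩ := exists_hasWeilPhase_unary h2 hψ hψ1 hc
  rwa [weilIndex_eq hz]

lemma hasWeilPhase_binary (h2 : (2 : F) ≠ 0) (hψ : Continuous ψ) (hψ1 : ψ ≠ 1) {c d : F}
    (hc : c ≠ 0) (hd : d ≠ 0) : HasWeilPhase ψ ((unary c).prod (unary d))
      (weilIndex (ψ.mulShift c) * weilIndex (ψ.mulShift d)) :=
  (hasWeilPhase_unary h2 hψ hψ1 hc).prod hψ (continuous_unary c) (continuous_unary d)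
    (isTame_unary h2 hψ hψ1 hc) (isTame_unary h2 hψ hψ1 hd) (hasWeilPhase_unary h2 hψ hψ1 hd)

lemma weilIndex_neg (h2 : (2 : F) ≠ 0) (hψ : Continuous ψ) (hψ1 : ψ ≠ 1) {c : F}
    (hc : c ≠ 0) : weilIndex (ψ.mulShift (-c)) = (weilIndex (ψ.mulShift c))⁻¹ := by
  have h := hasWeilPhase_unary h2 hψ hψ1 hc
  have h' := h.neg
  rw [← unary_neg] at h'
  rw [weilIndex_eq h', Complex.inv_def, Complex.normSq_eq_norm_sq, h.1]
  simp

/-- Multiplication by a non-zero scalar. -/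
def scaleEquiv {s : F} (hs : s ≠ 0) : F ≃ₜ+ F where
  toFun x := s * x
  invFun x := s⁻¹ * x
  left_inv x := by field_simp
  right_inv x := by field_simp
  map_add' := mul_add s
  continuous_toFun := by fun_prop
  continuous_invFun := by fun_prop

lemma weilIndex_mul_sq (h2 : (2 : F) ≠ 0) (hψ : Continuous ψ) (hψ1 : ψ ≠ 1) {c s : F}
    (hc : c ≠ 0) (hs : s ≠ 0) :
    weilIndex (ψ.mulShift (c * s ^ 2)) = weilIndex (ψ.mulShift c) :=
  weilIndex_eq ((hasWeilPhase_unary h2 hψ hψ1 hc).of_isometry (scaleEquiv hs) fun x => by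
    simp [scaleEquiv]
    ring)

/-- Multiplication by `s + t √a` on `F(√a) = F ⊕ F √a`. -/
def normEquiv {a s t : F} (hn : s ^ 2 - a * t ^ 2 ≠ 0) : F × F ≃ₜ+ F × F where
  toFun p := (s * p.1 + a * t * p.2, t * p.1 + s * p.2)
  invFun p := ((s * p.1 - a * t * p.2) / (s ^ 2 - a * t ^ 2),
    (s * p.2 - t * p.1) / (s ^ 2 - a * t ^ 2))
  left_inv p := Prod.ext ((div_eq_iff hn).mpr (by ring)) ((div_eq_iff hn).mpr (by ring))
  right_inv p := by
    ext <;> simp only [← mul_div_assoc, ← add_div] <;> rw [div_eq_iff hn] <;> ring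
  map_add' p q := by ext <;> simp <;> ring
  continuous_toFun := by fun_prop
  continuous_invFun := by fun_prop

/-- The Weil index of the norm form `c (x² - a y²)` only depends on `c` modulo norms. -/
lemma weilIndex_norm (h2 : (2 : F) ≠ 0) (hψ : Continuous ψ) (hψ1 : ψ ≠ 1) {a c s t : F}
    (ha : a ≠ 0) (hc : c ≠ 0) (hn : s ^ 2 - a * t ^ 2 ≠ 0) :
    weilIndex (ψ.mulShift (c * (s ^ 2 - a * t ^ 2))) *
        weilIndex (ψ.mulShift (-(c * a * (s ^ 2 - a * t ^ 2)))) =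
      weilIndex (ψ.mulShift c) * weilIndex (ψ.mulShift (-(c * a))) := by
  have h := hasWeilPhase_binary h2 hψ hψ1 hc (neg_ne_zero.mpr (mul_ne_zero hc ha))
  have h' := hasWeilPhase_binary h2 hψ hψ1 (mul_ne_zero hc hn)
    (neg_ne_zero.mpr (mul_ne_zero (mul_ne_zero hc ha) hn))
  refine h'.unique (h.of_isometry (normEquiv hn) fun x => ?_)
  simp [normEquiv]
  ring

/-- The quaternary form `c ⟨1, -a, -b, ab⟩` has Weil index `1` if `(a, b)_F = 1`. -/
lemma weilIndex_quaternion_split (h2 : (2 : F) ≠ 0) (hψ : Continuous ψ) (hψ1 : ψ ≠ 1) {a b c : F}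
    (ha : a ≠ 0) (hb : b ≠ 0) (hc : c ≠ 0)
    (hab : ∃ x y z : F, (x ≠ 0 ∨ y ≠ 0 ∨ z ≠ 0) ∧ z ^ 2 = a * x ^ 2 + b * y ^ 2) :
    weilIndex (ψ.mulShift c) * weilIndex (ψ.mulShift (-(c * a))) =
      weilIndex (ψ.mulShift (c * b)) * weilIndex (ψ.mulShift (-(c * a * b))) := by
  have hne : ∀ {d : F}, d ≠ 0 → weilIndex (ψ.mulShift d) ≠ 0 := fun {d} hd h => by
    have := (hasWeilPhase_unary h2 hψ hψ1 hd).1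
    rw [h] at this
    simp at this
  by_cases hsq : ∃ s, a = s ^ 2
  · obtain ⟨s, rfl⟩ := hsq
    have hs : s ≠ 0 := fun h => ha (by simp [h])
    have key : ∀ d : F, d ≠ 0 →
        weilIndex (ψ.mulShift d) * weilIndex (ψ.mulShift (-(d * s ^ 2))) = 1 := fun d hd => by
      rw [weilIndex_neg h2 hψ hψ1 (mul_ne_zero hd ha), weilIndex_mul_sq h2 hψ hψ1 hd hs,
        mul_inv_cancel₀ (hne hd)]
    rw [key c hc, mul_right_comm, key _ (mul_ne_zero hc hb)]
  · obtain ⟨x, y, z, hxyz, e⟩ := hab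
    have hy : y ≠ 0 := by
      rintro rfl
      refine hsq ⟨z / x, ?_⟩
      have hx : x ≠ 0 := by
        rintro rfl
        have : z = 0 := by simpa using e
        simp [this] at hxyz
      field_simp
      linear_combination -e
    have hbn : b = (z / y) ^ 2 - a * (x / y) ^ 2 := by
      field_simp
      linear_combination -e
    have := weilIndex_norm h2 hψ hψ1 (a := a) (c := c) (s := z / y) (t := x / y) ha hc (hbn ▸ hb)
    rw [← hbn] at this
    exact this.symm

end Unary

/-! ### Anisotropic quadratic forms over a local field -/

section Anisotropic

open QuadraticMap ValuativeRel

/-- Chevalley's theorem for ternary quadratic forms. -/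
lemma exists_ternary_zero {k : Type*} [Field k] [Finite k] (c : Fin 3 → Fin 3 → k) :
    ∃ x : Fin 3 → k, x ≠ 0 ∧ ∑ i, ∑ j, c i j * (x i * x j) = 0 := by
  classical
  have := Fintype.ofFinite k
  let f : MvPolynomial (Fin 3) k :=
    ∑ i, ∑ j, MvPolynomial.C (c i j) * (MvPolynomial.X i * MvPolynomial.X j)
  have hf : f.IsHomogeneous 2 :=
    MvPolynomial.IsHomogeneous.sum _ _ _ fun i _ =>
      MvPolynomial.IsHomogeneous.sum _ _ _ fun j _ => by
      simpa using (MvPolynomial.isHomogeneous_C (Fin 3) (c i j)).mul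
        ((MvPolynomial.isHomogeneous_X k i).mul (MvPolynomial.isHomogeneous_X k j))
  obtain ⟨p, hp⟩ := CharP.exists k
  have hprime : p.Prime := (CharP.char_is_prime k p)
  have hdvd := char_dvd_card_solutions p (f := f) (hf.totalDegree_le.trans_lt (by simp))
  have heval : ∀ x, MvPolynomial.eval x f = ∑ i, ∑ j, c i j * (x i * x j) := fun x => by
    simp [f]
  have h0 : MvPolynomial.eval 0 f = 0 := by rw [heval]; simp
  have hpos : 0 < Fintype.card {x : Fin 3 → k // MvPolynomial.eval x f = 0} :=
    Fintype.card_pos_iff.mpr ⟨⟨0, h0⟩⟩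
  obtain ⟨⟨x, hx⟩, hne⟩ := Fintype.exists_ne_of_one_lt_card
    (hprime.one_lt.trans_le (Nat.le_of_dvd hpos hdvd)) ⟨0, h0⟩
  exact ⟨x, fun h => hne (Subtype.ext h), by rw [← heval, hx]⟩

variable {F : Type u} [Field F] [ValuativeRel F] [TopologicalSpace F]
  [IsNonarchimedeanLocalField F]

lemma residue_eq_zero_iff {x : 𝒪[F]} : IsLocalRing.residue 𝒪[F] x = 0 ↔ valuation F x < 1 := by
  rw [IsLocalRing.residue_eq_zero_iff, mem_maximalIdeal_iff]

lemma residue_eq_iff {x y : 𝒪[F]} :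
    IsLocalRing.residue 𝒪[F] x = IsLocalRing.residue 𝒪[F] y ↔ valuation F (x - y) < 1 := by
  rw [← sub_eq_zero, ← map_sub, residue_eq_zero_iff]
  rfl

/-- A representative in `F` of an element of the residue field. -/
def resLift (α : 𝓀[F]) : F :=
  (Function.surjInv (IsLocalRing.residue_surjective (R := 𝒪[F])) α : 𝒪[F])

lemma valuation_resLift_le (α : 𝓀[F]) : valuation F (resLift α) ≤ 1 :=
  (Function.surjInv (IsLocalRing.residue_surjective (R := 𝒪[F])) α).2

lemma residue_resLift (α : 𝓀[F]) :
    IsLocalRing.residue 𝒪[F] ⟨resLift α, valuation_resLift_le α⟩ = α :=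
  Function.surjInv_eq (IsLocalRing.residue_surjective (R := 𝒪[F])) α

lemma valuation_resLift_eq_one {α : 𝓀[F]} (hα : α ≠ 0) : valuation F (resLift α) = 1 :=
  le_antisymm (valuation_resLift_le α) (not_lt.mp fun h => hα (by
    rw [← residue_resLift α]
    exact residue_eq_zero_iff.mpr h))

lemma exists_resLift_sub_lt {s : F} (hs : valuation F s ≤ 1) :
    ∃ α : 𝓀[F], valuation F (s - resLift α) < 1 := by
  refine ⟨IsLocalRing.residue 𝒪[F] ⟨s, hs⟩, ?_⟩
  exact residue_eq_iff.mp (residue_resLift (IsLocalRing.residue 𝒪[F] ⟨s, hs⟩)).symm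

/-- A ternary quadratic form with integral coefficients has a primitive zero modulo the maximal
ideal. -/
lemma exists_primitive_zero_mod (c : Fin 3 → Fin 3 → F) (hc : ∀ i j, valuation F (c i j) ≤ 1) :
    ∃ x : Fin 3 → F, (∀ i, valuation F (x i) ≤ 1) ∧ (∃ i, valuation F (x i) = 1) ∧
      valuation F (∑ i, ∑ j, c i j * (x i * x j)) < 1 := by
  let c' : Fin 3 → Fin 3 → 𝒪[F] := fun i j => ⟨c i j, hc i j⟩
  obtain ⟨x, hx0, hx⟩ := exists_ternary_zero fun i j => IsLocalRing.residue 𝒪[F] (c' i j)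
  let x' : Fin 3 → 𝒪[F] := fun i => ⟨resLift (x i), valuation_resLift_le _⟩
  refine ⟨fun i => resLift (x i), fun i => valuation_resLift_le _, ?_, ?_⟩
  · obtain ⟨i, hi⟩ := Function.ne_iff.mp hx0
    exact ⟨i, valuation_resLift_eq_one hi⟩
  · have h : IsLocalRing.residue 𝒪[F] (∑ i, ∑ j, c' i j * (x' i * x' j)) = 0 := by
      rw [← hx]
      simp [x', residue_resLift]
    have := residue_eq_zero_iff.mp h
    simpa [c', x'] using this

variable {V : Type*} [AddCommGroup V] [Module F V] {Q : QuadraticForm F V}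

lemma quad_add (Q : QuadraticForm F V) (x y : V) : Q (x + y) = Q x + Q y + polar Q x y := by
  simp [polar]

lemma quad_add_smul (Q : QuadraticForm F V) (s : F) (x y : V) :
    Q (s • x + y) = s * s * Q x + Q y + s * polar Q x y := by
  rw [quad_add, QuadraticMap.map_smul, polar_smul_left]
  simp

/-- The Cauchy–Schwarz inequality for anisotropic forms: otherwise the discriminant of the plane
spanned by `x` and `y` would be a square by Hensel's lemma. -/
lemma valuation_polar_sq_le (h2 : (2 : F) ≠ 0) (hQ : Q.Anisotropic) (x y : V) :
    valuation F (polar Q x y) ^ 2 ≤ valuation F (Q x) * valuation F (Q y) := by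
  by_contra! hlt
  have hB : polar Q x y ≠ 0 := fun h => by simp [h] at hlt
  have hx : x ≠ 0 := by
    rintro rfl
    simp at hB
  have hQx : Q x ≠ 0 := fun h => hx (hQ x h)
  have hBv : 0 < valuation F (polar Q x y) ^ 2 := by
    have : valuation F (polar Q x y) ≠ 0 := by simpa using hB
    exact pow_pos (zero_lt_iff.mpr this) 2
  have hu : valuation F (Q x * Q y / polar Q x y ^ 2) < 1 := by
    rw [map_div₀, map_pow, map_mul]
    exact (div_lt_one₀ hBv).mpr hlt
  obtain ⟨s, hs⟩ := exists_sq_eq_one_sub_four_mul hu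
  have hs' : polar Q x y ^ 2 * s ^ 2 = polar Q x y ^ 2 - 4 * (Q x * Q y) := by
    rw [hs]
    field_simp
  set α : F := (-polar Q x y + polar Q x y * s) / (2 * Q x) with hα
  have hα' : 2 * Q x * α = -polar Q x y + polar Q x y * s :=
    mul_div_cancel₀ _ (mul_ne_zero h2 hQx)
  have h0 : Q (α • x + y) = 0 := by
    rw [quad_add_smul]
    have h4 : (4 * Q x : F) ≠ 0 := by
      have : (4 : F) = 2 * 2 := by norm_num
      rw [this]
      exact mul_ne_zero (mul_ne_zero h2 h2) hQx
    refine (mul_eq_zero.mp ?_).resolve_left h4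
    linear_combination (2 * Q x * α + polar Q x y + polar Q x y * s) * hα' + hs'
  have hy : y = (-α) • x := by
    have := hQ _ h0
    rw [neg_smul]
    exact eq_neg_of_add_eq_zero_right this
  have e1 : polar Q x y = -(2 * α * Q x) := by
    rw [hy, polar_smul_right, polar_self, smul_eq_mul]
    ring
  have e2 : Q y = α * α * Q x := by
    rw [hy, QuadraticMap.map_smul]
    simp
  -- here `4 u = 1`, which is impossible since `v 4 ≤ 1`
  have e3 : valuation F (polar Q x y) ^ 2 ≤ valuation F (Q x) * valuation F (Q y) := by
    rw [← map_pow, ← map_mul]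
    have : polar Q x y ^ 2 = 4 * (Q x * Q y) := by rw [e1, e2]; ring
    rw [this, map_mul]
    refine mul_le_of_le_one_left' ?_
    exact (4 : 𝒪[F]).2
  exact absurd e3 (not_le.mpr hlt)

lemma valuation_polar_le (h2 : (2 : F) ≠ 0) (hQ : Q.Anisotropic) {x y : V}
    {γ : ValueGroupWithZero F} (hx : valuation F (Q x) ≤ γ) (hy : valuation F (Q y) ≤ γ) :
    valuation F (polar Q x y) ≤ γ := by
  have h := (valuation_polar_sq_le h2 hQ x y).trans (mul_le_mul' hx hy)
  rw [← pow_two] at h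
  exact (pow_le_pow_iff_left₀ zero_le zero_le two_ne_zero).mp h

/-- The vectors at which an anisotropic form has absolute value at most `γ`. -/
def quadLattice (h2 : (2 : F) ≠ 0) (hQ : Q.Anisotropic) (γ : ValueGroupWithZero F) :
    AddSubgroup V where
  carrier := {x | valuation F (Q x) ≤ γ}
  zero_mem' := by simp
  add_mem' {x y} hx hy := by
    simp only [Set.mem_ofPred_eq] at hx hy ⊢
    rw [quad_add]
    exact (valuation F).map_add_le ((valuation F).map_add_le hx hy)
      (valuation_polar_le h2 hQ hx hy)
  neg_mem' {x} hx := by simpa using hx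

@[simp] lemma mem_quadLattice {h2 : (2 : F) ≠ 0} {hQ : Q.Anisotropic} {γ : ValueGroupWithZero F}
    {x : V} : x ∈ quadLattice h2 hQ γ ↔ valuation F (Q x) ≤ γ := Iff.rfl

lemma valuation_quad_smul (s : F) (x : V) :
    valuation F (Q (s • x)) = valuation F s * valuation F s * valuation F (Q x) := by
  rw [QuadraticMap.map_smul]
  simp

lemma valuation_quad_sum_lt_one (h2 : (2 : F) ≠ 0) (hQ : Q.Anisotropic) {x y : V}
    (hx : valuation F (Q x) < 1) (hy : valuation F (Q y) < 1) : valuation F (Q (x + y)) < 1 := by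
  obtain ⟨ϖ, -, h1, h⟩ := exists_uniformizer F
  exact ((quadLattice h2 hQ (valuation F ϖ)).add_mem (h _ hx) (h _ hy)).trans_lt h1

lemma valuation_quad_smul_lt_one {s : F} {x : V} (hs : valuation F s < 1)
    (hx : valuation F (Q x) ≤ 1) : valuation F (Q (s • x)) < 1 := by
  rw [valuation_quad_smul]
  exact (mul_le_of_le_one_right' hx).trans_lt ((mul_le_of_le_one_right' hs.le).trans_lt hs)

/-- The residue form of an anisotropic form has dimension at most two. -/
lemma exists_two_generators (h2 : (2 : F) ≠ 0) (hQ : Q.Anisotropic) :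
    ∃ x₁ x₂ : V, valuation F (Q x₁) ≤ 1 ∧ valuation F (Q x₂) ≤ 1 ∧
      ∀ y, valuation F (Q y) ≤ 1 → ∃ s₁ s₂ : F, valuation F s₁ ≤ 1 ∧ valuation F s₂ ≤ 1 ∧
        valuation F (Q (y - s₁ • x₁ - s₂ • x₂)) < 1 := by
  by_cases h₁ : ∃ x₁, valuation F (Q x₁) ≤ 1 ∧ ¬ valuation F (Q x₁) < 1
  swap
  · push Not at h₁
    exact ⟨0, 0, by simp, by simp, fun y hy => ⟨0, 0, by simp, by simp, by simpa using h₁ y hy⟩⟩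
  obtain ⟨x₁, hx₁, hx₁'⟩ := h₁
  by_cases h₂ : ∃ x₂, valuation F (Q x₂) ≤ 1 ∧ ∀ s, valuation F s ≤ 1 →
      ¬ valuation F (Q (x₂ - s • x₁)) < 1
  swap
  · push Not at h₂
    refine ⟨x₁, 0, hx₁, by simp, fun y hy => ?_⟩
    obtain ⟨s, hs, hlt⟩ := h₂ y hy
    exact ⟨s, 0, hs, by simp, by simpa using hlt⟩
  obtain ⟨x₂, hx₂, hx₂'⟩ := h₂
  refine ⟨x₁, x₂, hx₁, hx₂, fun y hy => ?_⟩
  obtain ⟨s, hs, hunit, hlt⟩ := exists_primitive_zero_mod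
    ![![Q x₁, polar Q x₁ x₂, polar Q x₁ y], ![0, Q x₂, polar Q x₂ y], ![0, 0, Q y]] (by
      intro i j
      fin_cases i <;> fin_cases j <;>
        simp [hx₁, hx₂, hy, valuation_polar_le h2 hQ hx₁ hx₂, valuation_polar_le h2 hQ hx₁ hy,
          valuation_polar_le h2 hQ hx₂ hy])
  have hlt' : valuation F (Q (s 0 • x₁ + (s 1 • x₂ + s 2 • y))) < 1 := by
    convert hlt using 2
    simp only [Fin.sum_univ_three, quad_add, QuadraticMap.map_smul, polar_add_right,
      polar_smul_left, polar_smul_right]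
    simp
    ring
  have hdiv : ∀ {a b : F}, valuation F a ≤ 1 → valuation F b = 1 → valuation F (a / b) ≤ 1 :=
    fun {a b} ha hb => by rw [map_div₀, hb, div_one]; exact ha
  have hsm : ∀ {c : F} {x : V}, valuation F c = 1 → valuation F (Q (c • x)) < 1 →
      valuation F (Q x) < 1 := fun {c x} hc h => by
    rwa [valuation_quad_smul, hc, one_mul, one_mul] at h
  have hne : ∀ {c : F}, valuation F c = 1 → c ≠ 0 := fun {c} hc h => by simp [h] at hc
  have h2u : valuation F (s 2) = 1 := by
    by_contra h
    have hs2 : valuation F (s 2) < 1 := lt_of_le_of_ne (hs 2) h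
    have h3 : valuation F (Q (s 0 • x₁ + s 1 • x₂)) < 1 := by
      have := valuation_quad_sum_lt_one h2 hQ hlt'
        (y := -(s 2 • y)) (by simpa using valuation_quad_smul_lt_one hs2 hy)
      rwa [← sub_eq_add_neg, ← add_assoc, add_sub_cancel_right] at this
    by_cases h1u : valuation F (s 1) = 1
    · refine hx₂' (-(s 0 / s 1)) (by simpa using hdiv (hs 0) h1u) (hsm h1u ?_)
      convert h3 using 3
      rw [smul_sub, smul_smul, mul_neg, mul_div_cancel₀ _ (hne h1u), neg_smul, sub_neg_eq_add,
        add_comm]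
    · have hs1 : valuation F (s 1) < 1 := lt_of_le_of_ne (hs 1) h1u
      have h4 := valuation_quad_sum_lt_one h2 hQ h3
        (y := -(s 1 • x₂)) (by simpa using valuation_quad_smul_lt_one hs1 hx₂)
      rw [← sub_eq_add_neg, add_sub_cancel_right] at h4
      obtain ⟨i, hi⟩ := hunit
      fin_cases i
      · exact hx₁' (hsm hi h4)
      · exact h1u hi
      · exact h hi
  refine ⟨-(s 0 / s 2), -(s 1 / s 2), by simpa using hdiv (hs 0) h2u,
    by simpa using hdiv (hs 1) h2u, hsm h2u ?_⟩
  convert hlt' using 3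
  rw [smul_sub, smul_sub, smul_smul, smul_smul, mul_neg, mul_neg, mul_div_cancel₀ _ (hne h2u),
    mul_div_cancel₀ _ (hne h2u), neg_smul, neg_smul]
  abel

/-- A residue form with vanishing bicharacter has dimension at most one: it is additive, the
residue characteristic is two, and every element of the finite residue field is a square. -/
lemma exists_generator_of_polar_lt
    (hpol : ∀ x y, valuation F (Q x) ≤ 1 → valuation F (Q y) ≤ 1 → valuation F (polar Q x y) < 1) :
    ∃ x₁ : V, valuation F (Q x₁) ≤ 1 ∧ ∀ y, valuation F (Q y) ≤ 1 → ∃ s : F, valuation F s ≤ 1 ∧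
      valuation F (Q (y - s • x₁)) < 1 := by
  by_cases h₁ : ∃ x₁, valuation F (Q x₁) ≤ 1 ∧ ¬ valuation F (Q x₁) < 1
  swap
  · push Not at h₁
    exact ⟨0, by simp, fun y hy => ⟨0, by simp, by simpa using h₁ y hy⟩⟩
  obtain ⟨x₁, hx₁, hx₁'⟩ := h₁
  have hu : valuation F (Q x₁) = 1 := le_antisymm hx₁ (not_lt.mp hx₁')
  have hQ0 : Q x₁ ≠ 0 := fun h => by simp [h] at hu
  have hv2 : valuation F (2 : F) < 1 := by
    have := hpol x₁ x₁ hx₁ hx₁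
    rwa [polar_self, two_smul, ← two_mul, map_mul, hu, mul_one] at this
  have hchar : CharP 𝓀[F] 2 := by
    have : (2 : 𝓀[F]) = 0 := by
      have := (residue_eq_zero_iff (x := (2 : 𝒪[F]))).mpr hv2
      rwa [map_ofNat] at this
    exact CharTwo.of_one_ne_zero_of_two_eq_zero one_ne_zero this
  refine ⟨x₁, hx₁, fun y hy => ?_⟩
  have hd : valuation F (Q y / Q x₁) ≤ 1 := by rwa [map_div₀, hu, div_one]
  have := Fintype.ofFinite 𝓀[F]
  obtain ⟨r, hr⟩ := (FiniteField.isSquare_of_char_two (ringChar.eq 𝓀[F] 2)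
    (IsLocalRing.residue 𝒪[F] ⟨Q y / Q x₁, hd⟩) : IsSquare _)
  have hs := valuation_resLift_le r
  refine ⟨resLift r, hs, ?_⟩
  have h1 : valuation F (Q y / Q x₁ - resLift r * resLift r) < 1 := by
    refine residue_eq_iff (x := ⟨Q y / Q x₁, hd⟩) (y := ⟨resLift r, hs⟩ * ⟨resLift r, hs⟩) |>.mp ?_
    rw [map_mul, residue_resLift, hr]
  have h2' : valuation F (Q y - resLift r * resLift r * Q x₁) < 1 := by
    have e : Q y - resLift r * resLift r * Q x₁ = (Q y / Q x₁ - resLift r * resLift r) * Q x₁ := by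
      field_simp
    rw [e, map_mul, hu, mul_one]
    exact h1
  have e : Q (y - resLift r • x₁) = (Q y - resLift r * resLift r * Q x₁) +
      (2 * (resLift r * resLift r * Q x₁) - resLift r * polar Q x₁ y) := by
    rw [sub_eq_add_neg, ← neg_smul, add_comm y, quad_add_smul]
    ring
  rw [e]
  refine (valuation F).map_add_lt h2' ((valuation F).map_sub_lt ?_ ?_)
  · rw [map_mul, map_mul, map_mul, hu, mul_one]
    exact (mul_le_of_le_one_right' (mul_le_one' hs hs)).trans_lt hv2
  · rw [map_mul]
    exact (mul_le_of_le_one_left' hs).trans_lt (hpol _ _ hx₁ hy)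

end Anisotropic

/-! ### The Weil index of an anisotropic quaternary form -/

section Quaternary

open QuadraticMap ValuativeRel MeasureTheory MeasureTheory.Measure

variable {F : Type u} [Field F] [ValuativeRel F] [TopologicalSpace F]
  [IsNonarchimedeanLocalField F] {ψ : AddChar F Circle}
  {V : Type*} [AddCommGroup V] [Module F V] [TopologicalSpace V] [IsTopologicalAddGroup V]
  [LocallyCompactSpace V] [SecondCountableTopology V] [MeasurableSpace V] [BorelSpace V]

/-- The properties of a multiple of the norm form of a quaternion division algebra that determine
its Weil index: anisotropy, compactness of the lattices `|Q| ≤ γ`, transitivity of the similitudes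
on non-zero vectors, and dimension at least four, expressed by the effect of multiplication by
elements of the maximal ideal on Haar measure. -/
structure IsQuaternionic (Q : QuadraticForm F V) : Prop where
  continuous : Continuous Q
  anisotropic : Q.Anisotropic
  isCompact : ∀ γ, IsCompact {x | valuation F (Q x) ≤ γ}
  exists_similitude : ∀ x y, x ≠ 0 → y ≠ 0 → ∃ (T : V ≃ₜ+ V) (l : F), T x = y ∧
    ∀ z, Q (T z) = l * Q z
  measure_scale : ∀ (ϖ : F) (S : Set V), ϖ ≠ 0 → valuation F ϖ < 1 →
    (Nat.card 𝓀[F] : ℝ) ^ 4 * addHaar.real S ≤ addHaar.real {x : V | ϖ • x ∈ S}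

variable {Q : QuadraticForm F V}

lemma IsQuaternionic.smul (h : IsQuaternionic Q) {c : F} (hc : c ≠ 0) :
    IsQuaternionic (c • Q) where
  continuous := (by have := h.continuous; fun_prop : Continuous fun x => c * Q x)
  anisotropic x hx := h.anisotropic x ((mul_eq_zero.mp hx).resolve_left hc)
  isCompact γ := by
    have hcv : valuation F c ≠ 0 := by simpa using hc
    convert h.isCompact (γ / valuation F c) using 2
    ext x
    rw [le_div_iff₀ (zero_lt_iff.mpr hcv), mul_comm, ← map_mul]
    rfl
  exists_similitude x y hx hy := by
    obtain ⟨T, l, hT, hl⟩ := h.exists_similitude x y hx hy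
    refine ⟨T, l, hT, fun z => ?_⟩
    simp only [_root_.smul_apply, smul_eq_mul, hl]
    ring
  measure_scale := h.measure_scale

/-- The lattice of vectors with `|Q| ≤ γ`. -/
abbrev IsQuaternionic.lattice (h2 : (2 : F) ≠ 0) (h : IsQuaternionic Q)
    (γ : ValueGroupWithZero F) : AddSubgroup V := quadLattice h2 h.anisotropic γ

lemma IsQuaternionic.isCompactOpen (h2 : (2 : F) ≠ 0) (h : IsQuaternionic Q)
    {γ : ValueGroupWithZero F} (hγ : γ ≠ 0) : IsCompactOpen (h.lattice h2 γ) :=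
  ⟨h.isCompact γ, (ball_isCompactOpen hγ).2.preimage h.continuous⟩

/-- A union of `card ι` translates of `M` has at most `card ι` times the measure of `M`. -/
lemma measureReal_le_of_cover {ι : Type*} [Fintype ι] (μ : Measure V) [μ.IsAddHaarMeasure]
    (f : ι → V) {L : Set V} {M : AddSubgroup V} (hM : IsCompactOpen M)
    (hcover : ∀ y ∈ L, ∃ i, y - f i ∈ M) : μ.real L ≤ Fintype.card ι * μ.real M := by
  have hm : ∀ i, μ ((fun y => y + -f i) ⁻¹' (M : Set V)) = μ M := fun i =>
    measure_preimage_add_right μ _ _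
  have hsub : L ⊆ ⋃ i, (fun y => y + -f i) ⁻¹' (M : Set V) := fun y hy => by
    obtain ⟨i, hi⟩ := hcover y hy
    exact Set.mem_iUnion.mpr ⟨i, by simpa [sub_eq_add_neg] using hi⟩
  calc μ.real L ≤ μ.real (⋃ i, (fun y => y + -f i) ⁻¹' (M : Set V)) :=
        measureReal_mono hsub ((measure_iUnion_fintype_le μ _).trans_lt (by
          simp only [hm]
          exact ENNReal.sum_lt_top.mpr fun _ _ => (hM.measure_ne_top μ).lt_top)).ne
    _ ≤ ∑ i, μ.real ((fun y => y + -f i) ⁻¹' (M : Set V)) := measureReal_iUnion_fintype_le _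
    _ = Fintype.card ι * μ.real M := by
        simp [Measure.real, hm]

section Layers

variable {ϖ : F}

lemma one_lt_card_residue : (1 : ℝ) < Nat.card 𝓀[F] := by
  exact_mod_cast Finite.one_lt_card (α := 𝓀[F])

/-- A uniformizer: a generator of the maximal ideal. -/
def IsUniformizer (ϖ : F) : Prop :=
  ϖ ≠ 0 ∧ valuation F ϖ < 1 ∧ ∀ x : F, valuation F x < 1 → valuation F x ≤ valuation F ϖ

lemma IsUniformizer.lt_one_iff (hϖ : IsUniformizer ϖ) {x : F} :
    valuation F x < 1 ↔ valuation F x ≤ valuation F ϖ :=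
  ⟨hϖ.2.2 x, fun h => h.trans_lt hϖ.2.1⟩

lemma IsUniformizer.valuation_pos (hϖ : IsUniformizer ϖ) : 0 < valuation F ϖ :=
  zero_lt_iff.mpr (by simpa using hϖ.1)

lemma IsQuaternionic.measure_le_of_generator (h2 : (2 : F) ≠ 0) (h : IsQuaternionic Q)
    (hϖ : IsUniformizer ϖ) {x₁ : V} (hx₁ : valuation F (Q x₁) ≤ 1)
    (hgen : ∀ y, valuation F (Q y) ≤ 1 → ∃ s : F, valuation F s ≤ 1 ∧
      valuation F (Q (y - s • x₁)) < 1) :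
    addHaar.real (h.lattice h2 1 : Set V) ≤
      Nat.card 𝓀[F] * addHaar.real (h.lattice h2 (valuation F ϖ) : Set V) := by
  have := Fintype.ofFinite 𝓀[F]
  rw [Nat.card_eq_fintype_card]
  refine measureReal_le_of_cover addHaar (fun α => resLift α • x₁)
    (h.isCompactOpen h2 hϖ.valuation_pos.ne') fun y hy => ?_
  obtain ⟨s, hs, hlt⟩ := hgen y hy
  obtain ⟨α, hα⟩ := exists_resLift_sub_lt hs
  refine ⟨α, hϖ.2.2 _ ?_⟩
  have := valuation_quad_sum_lt_one h2 h.anisotropic hlt (valuation_quad_smul_lt_one hα hx₁)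
  rwa [sub_smul, sub_add_sub_cancel] at this

lemma IsQuaternionic.measure_le (h2 : (2 : F) ≠ 0) (h : IsQuaternionic Q)
    (hϖ : IsUniformizer ϖ) :
    addHaar.real (h.lattice h2 1 : Set V) ≤
      (Nat.card 𝓀[F] : ℝ) ^ 2 * addHaar.real (h.lattice h2 (valuation F ϖ) : Set V) := by
  have := Fintype.ofFinite 𝓀[F]
  obtain ⟨x₁, x₂, hx₁, hx₂, hgen⟩ := exists_two_generators h2 h.anisotropic
  have e : (Nat.card 𝓀[F] : ℝ) ^ 2 = Fintype.card (𝓀[F] × 𝓀[F]) := by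
    rw [Nat.card_eq_fintype_card, Fintype.card_prod, pow_two, Nat.cast_mul]
  rw [e]
  refine measureReal_le_of_cover addHaar (fun α => resLift α.1 • x₁ + resLift α.2 • x₂)
    (h.isCompactOpen h2 hϖ.valuation_pos.ne') fun y hy => ?_
  obtain ⟨s, t, hs, ht, hlt⟩ := hgen y hy
  obtain ⟨α, hα⟩ := exists_resLift_sub_lt hs
  obtain ⟨β, hβ⟩ := exists_resLift_sub_lt ht
  refine ⟨(α, β), hϖ.2.2 _ ?_⟩
  have := valuation_quad_sum_lt_one h2 h.anisotropic (valuation_quad_sum_lt_one h2 h.anisotropic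
    hlt (valuation_quad_smul_lt_one hα hx₁)) (valuation_quad_smul_lt_one hβ hx₂)
  convert this using 3
  rw [sub_smul, sub_smul]
  abel

/-- The residue form of a quaternionic form has dimension exactly two. -/
lemma IsQuaternionic.measure_eq (h2 : (2 : F) ≠ 0) (h : IsQuaternionic Q)
    (hϖ : IsUniformizer ϖ) :
    addHaar.real (h.lattice h2 1 : Set V) =
      (Nat.card 𝓀[F] : ℝ) ^ 2 * addHaar.real (h.lattice h2 (valuation F ϖ) : Set V) := by
  refine le_antisymm (h.measure_le h2 hϖ) ?_
  have hv := hϖ.valuation_pos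
  have h' := h.smul (inv_ne_zero hϖ.1)
  have e1 : (h'.lattice h2 1 : Set V) = (h.lattice h2 (valuation F ϖ) : Set V) := by
    ext x
    simp [inv_mul_le_iff₀ hv]
  have e2 : {x : V | ϖ • x ∈ (h'.lattice h2 (valuation F ϖ) : Set V)} =
      (h.lattice h2 1 : Set V) := by
    ext x
    simp only [SetLike.mem_coe, mem_quadLattice, _root_.smul_apply, QuadraticMap.map_smul,
      Set.mem_ofPred_eq, smul_eq_mul, map_mul, map_inv₀]
    rw [mul_assoc, inv_mul_cancel_left₀ hv.ne', mul_le_iff_le_one_right hv]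
  have hle := h'.measure_le h2 hϖ
  have hs := h.measure_scale ϖ (h'.lattice h2 (valuation F ϖ) : Set V) hϖ.1 hϖ.2.1
  rw [e2] at hs
  rw [e1] at hle
  calc _ ≤ (Nat.card 𝓀[F] : ℝ) ^ 2 * ((Nat.card 𝓀[F] : ℝ) ^ 2 *
        addHaar.real (h'.lattice h2 (valuation F ϖ) : Set V)) := by gcongr
    _ = (Nat.card 𝓀[F] : ℝ) ^ 4 * addHaar.real (h'.lattice h2 (valuation F ϖ) : Set V) := by ring
    _ ≤ _ := hs

lemma IsQuaternionic.not_generator (h2 : (2 : F) ≠ 0) (h : IsQuaternionic Q)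
    {x₁ : V} (hx₁ : valuation F (Q x₁) ≤ 1) :
    ∃ y, valuation F (Q y) ≤ 1 ∧ ∀ s : F, valuation F s ≤ 1 →
      ¬ valuation F (Q (y - s • x₁)) < 1 := by
  obtain ⟨ϖ, hϖ⟩ : ∃ ϖ : F, IsUniformizer ϖ := exists_uniformizer F
  by_contra! hgen
  have h1 := h.measure_le_of_generator h2 hϖ hx₁ hgen
  rw [h.measure_eq h2 hϖ, pow_two, mul_assoc] at h1
  have hq := one_lt_card_residue (F := F)
  have hpos := (h.isCompactOpen h2 hϖ.valuation_pos.ne').measureReal_pos addHaar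
  have h3 := le_of_mul_le_mul_left h1 (by linarith)
  nlinarith

lemma IsQuaternionic.exists_polar (h2 : (2 : F) ≠ 0) (h : IsQuaternionic Q) :
    ∃ x y, valuation F (Q x) ≤ 1 ∧ valuation F (Q y) ≤ 1 ∧ ¬ valuation F (polar Q x y) < 1 := by
  by_contra! hpol
  obtain ⟨x₁, hx₁, hgen⟩ := exists_generator_of_polar_lt hpol
  obtain ⟨y, hy, hs⟩ := h.not_generator h2 hx₁
  obtain ⟨s, hs1, hlt⟩ := hgen y hy
  exact hs s hs1 hlt

/-- The residue form of a quaternionic form is universal, so the similitude factors meet all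
residue classes of units. -/
lemma IsQuaternionic.exists_similitude_factor (h2 : (2 : F) ≠ 0) (h : IsQuaternionic Q) {t : F}
    (ht : valuation F t = 1) :
    ∃ (T : V ≃ₜ+ V) (l : F), (∀ z, Q (T z) = l * Q z) ∧ valuation F (l - t) < 1 := by
  obtain ⟨x₁, hx₁, hx₁'⟩ := h.not_generator h2 (x₁ := 0) (by simp)
  replace hx₁' : valuation F (Q x₁) = 1 :=
    le_antisymm hx₁ (not_lt.mp (by simpa using hx₁' 0 (by simp)))
  obtain ⟨x₂, hx₂, hx₂'⟩ := h.not_generator h2 hx₁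
  have hpol := valuation_polar_le h2 h.anisotropic hx₁ hx₂
  obtain ⟨s, hs, hunit, hlt⟩ := exists_primitive_zero_mod
    ![![Q x₁, polar Q x₁ x₂, 0], ![0, Q x₂, 0], ![0, 0, -(t * Q x₁)]] (by
      intro i j
      fin_cases i <;> fin_cases j <;> simp [hx₁, hx₂, hpol, ht])
  have hlt' : valuation F (Q (s 0 • x₁ + s 1 • x₂) - t * Q x₁ * (s 2 * s 2)) < 1 := by
    convert hlt using 2
    simp only [Fin.sum_univ_three, quad_add, QuadraticMap.map_smul,
      polar_smul_left, polar_smul_right]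
    simp
    ring
  have hne : ∀ {c : F}, valuation F c = 1 → c ≠ 0 := fun {c} hc h => by simp [h] at hc
  have hsm : ∀ {c : F} {x : V}, valuation F c = 1 → valuation F (Q (c • x)) < 1 →
      valuation F (Q x) < 1 := fun {c x} hc h => by
    rwa [valuation_quad_smul, hc, one_mul, one_mul] at h
  have h2u : valuation F (s 2) = 1 := by
    by_contra hn
    have hs2 : valuation F (s 2) < 1 := lt_of_le_of_ne (hs 2) hn
    have h3 : valuation F (Q (s 0 • x₁ + s 1 • x₂)) < 1 := by
      have h4 : valuation F (t * Q x₁ * (s 2 * s 2)) < 1 := by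
        simp only [map_mul, ht, hx₁', one_mul]
        exact (mul_le_of_le_one_right' hs2.le).trans_lt hs2
      simpa using (valuation F).map_add_lt hlt' h4
    by_cases h1u : valuation F (s 1) = 1
    · refine hx₂' (-(s 0 / s 1)) (by simpa [h1u] using hs 0) (hsm h1u ?_)
      convert h3 using 3
      rw [smul_sub, smul_smul, mul_neg, mul_div_cancel₀ _ (hne h1u), neg_smul, sub_neg_eq_add,
        add_comm]
    · have hs1 : valuation F (s 1) < 1 := lt_of_le_of_ne (hs 1) h1u
      have h4 := valuation_quad_sum_lt_one h2 h.anisotropic h3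
        (y := -(s 1 • x₂)) (by simpa using valuation_quad_smul_lt_one hs1 hx₂)
      rw [← sub_eq_add_neg, add_sub_cancel_right] at h4
      obtain ⟨i, hi⟩ := hunit
      fin_cases i
      · exact (hsm hi h4).ne hx₁'
      · exact h1u hi
      · exact hn hi
  have hx0 : ∀ {x : V}, valuation F (Q x) = 1 → x ≠ 0 := fun {x} hx h0 => by simp [h0] at hx
  set y : V := (s 2)⁻¹ • (s 0 • x₁ + s 1 • x₂) with hy
  have hyt : valuation F (Q y - t * Q x₁) < 1 := by
    have e : Q (s 0 • x₁ + s 1 • x₂) - t * Q x₁ * (s 2 * s 2) =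
        (s 2 * s 2) * (Q y - t * Q x₁) := by
      rw [hy, QuadraticMap.map_smul, smul_eq_mul]
      have := hne h2u
      field_simp
    rwa [e, map_mul, map_mul, h2u, one_mul, one_mul] at hlt'
  have hy1 : valuation F (Q y) = 1 := by
    have : valuation F (t * Q x₁) = 1 := by rw [map_mul, ht, hx₁', one_mul]
    rw [← this]
    exact (valuation F).map_eq_of_sub_lt (by rwa [this])
  obtain ⟨T, l, hT, hl⟩ := h.exists_similitude x₁ y (hx0 hx₁') (hx0 hy1)
  refine ⟨T, l, hl, ?_⟩
  rw [← hT, hl, ← sub_mul, map_mul, hx₁', mul_one] at hyt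
  exact hyt

end Layers

section Conductor

/-- `ψ` is trivial on the maximal ideal but not on the ring of integers. -/
def HasUnitConductor (ψ : AddChar F Circle) : Prop :=
  (∀ x, valuation F x < 1 → ψ x = 1) ∧ ∃ x, valuation F x ≤ 1 ∧ ψ x ≠ 1

/-- Every non-trivial continuous character is a multiple of one with unit conductor. -/
lemma exists_mulShift_hasUnitConductor (hψ : Continuous ψ) (hψ1 : ψ ≠ 1) :
    ∃ t : F, t ≠ 0 ∧ HasUnitConductor (ψ.mulShift t) := by
  obtain ⟨γ, hγ, htriv⟩ := exists_ball_trivial hψ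
  obtain ⟨x, hx, hx1⟩ := exists_ne_one hψ1
  obtain ⟨ϖ, hϖ⟩ : ∃ ϖ : F, IsUniformizer ϖ := exists_uniformizer F
  have hxv : valuation F x ≠ 0 := by simpa using hx
  have hex : ∃ n : ℕ, ∀ y, valuation F y ≤ valuation F (ϖ ^ n * x) → ψ y = 1 := by
    obtain ⟨n, hn⟩ := exists_pow_lt₀ hϖ.2.1 (Units.mk0 (γ / valuation F x) (div_ne_zero hγ hxv))
    refine ⟨n, fun y hy => htriv y (hy.trans ?_)⟩
    rw [Units.val_mk0, lt_div_iff₀ (zero_lt_iff.mpr hxv)] at hn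
    rw [map_mul, map_pow]
    exact hn.le
  classical
  obtain ⟨m, hm⟩ : ∃ m, Nat.find hex = m + 1 :=
    Nat.exists_eq_succ_of_ne_zero fun h0 => hx1 (Nat.find_spec hex x (by rw [h0]; simp))
  have hspec := Nat.find_spec hex
  have hmin := Nat.find_min hex (m := m) (by omega)
  rw [hm] at hspec
  have ht : ϖ ^ m * x ≠ 0 := mul_ne_zero (pow_ne_zero _ hϖ.1) hx
  refine ⟨ϖ ^ m * x, ht, fun y hy => hspec _ ?_, ?_⟩
  · rw [pow_succ, mul_right_comm, map_mul (valuation F) (ϖ ^ m * x) ϖ]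
    change valuation F (ϖ ^ m * x * y) ≤ _
    rw [map_mul]
    gcongr
    exact hϖ.2.2 y hy
  · push Not at hmin
    obtain ⟨y, hy, hy1⟩ := hmin
    refine ⟨y / (ϖ ^ m * x), ?_, ?_⟩
    · rw [map_div₀]
      exact div_le_one_of_le₀ hy zero_le
    · rwa [AddChar.mulShift_apply, mul_div_cancel₀ _ ht]

/-- The lattice `|Q| ≤ 1` is the orthogonal of the lattice `|Q| < 1`. -/
lemma IsQuaternionic.orth_lattice (h2 : (2 : F) ≠ 0) (h : IsQuaternionic Q) {ϖ : F}
    (hϖ : IsUniformizer ϖ) (hψ : HasUnitConductor ψ) :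
    orth ψ Q (h.lattice h2 (valuation F ϖ)) = h.lattice h2 1 := by
  apply le_antisymm
  · intro x hx
    rw [mem_quadLattice]
    by_contra! hlt
    have hx0 : x ≠ 0 := by
      rintro rfl
      simp at hlt
    have hQx : Q x ≠ 0 := fun h0 => hx0 (h.anisotropic x h0)
    -- the orthogonal is stable under similitudes with integral factor
    have hstab : ∀ y, valuation F (Q y) ≤ valuation F (Q x) →
        y ∈ orth ψ Q (h.lattice h2 (valuation F ϖ)) := by
      intro y hy k hk
      rcases eq_or_ne y 0 with rfl | hy0
      · simp
      obtain ⟨T, l, hT, hl⟩ := h.exists_similitude x y hx0 hy0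
      have hpol : ∀ z w, polar Q (T z) (T w) = l * polar Q z w := fun z w => by
        simp only [polar, ← map_add, hl]
        ring
      have hl1 : valuation F l ≤ 1 := by
        have : l = Q y / Q x := by rw [← hT, hl]; field_simp
        rw [this, map_div₀]
        exact div_le_one_of_le₀ hy zero_le
      have e : polar Q y k = polar Q x (l • T.symm k) := by
        rw [polar_smul_right, smul_eq_mul, ← hpol, hT]
        simp
      rw [e]
      refine hx _ ?_
      have e' : Q (l • T.symm k) = l * Q k := by
        rw [QuadraticMap.map_smul, smul_eq_mul, mul_assoc, ← hl]
        simp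
      rw [mem_quadLattice, e', map_mul]
      exact (mul_le_of_le_one_left' hl1).trans hk
    -- rescaling, `ϖ Q` would have a residue form with vanishing bicharacter
    have hlt' : (valuation F ϖ)⁻¹ ≤ valuation F (Q x) := by
      have : valuation F (Q x)⁻¹ ≤ valuation F ϖ := by
        apply hϖ.2.2
        rw [map_inv₀]
        exact inv_lt_one_of_one_lt₀ hlt
      rw [map_inv₀] at this
      exact (inv_le_comm₀ hϖ.valuation_pos (zero_lt_one.trans hlt)).mpr this
    obtain ⟨y, z, hy, hz, hyz⟩ := (h.smul hϖ.1).exists_polar h2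
    simp only [_root_.smul_apply, smul_eq_mul, map_mul] at hy hz
    have hy' := hstab y (le_trans ((le_inv_mul_iff₀ hϖ.valuation_pos).mpr hy |>.trans_eq
      (mul_one _)) hlt')
    obtain ⟨s, hs, hs1⟩ := hψ.2
    have hpol : polar (ϖ • Q) y z = ϖ * polar Q y z := by
      simp only [polar, _root_.smul_apply, smul_eq_mul]
      ring
    rw [hpol, not_lt] at hyz
    have hne : ϖ * polar Q y z ≠ 0 := fun h0 => by simp [h0] at hyz
    refine hs1 ?_
    have := hy' ((s / (ϖ * polar Q y z) * ϖ) • z) (by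
      rw [mem_quadLattice, valuation_quad_smul, map_mul, map_div₀]
      have hd : valuation F s / valuation F (ϖ * polar Q y z) ≤ 1 :=
        div_le_one_of_le₀ (hs.trans hyz) zero_le
      calc _ = (valuation F s / valuation F (ϖ * polar Q y z)) *
            (valuation F s / valuation F (ϖ * polar Q y z)) *
            (valuation F ϖ * (valuation F ϖ * valuation F (Q z))) := by
              simp only [mul_assoc, mul_comm, mul_left_comm]
        _ ≤ 1 * 1 * (valuation F ϖ * 1) := by gcongr
        _ = valuation F ϖ := by simp)
    rwa [polar_smul_right, smul_eq_mul, mul_assoc, div_mul_cancel₀ _ hne] at this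
  · intro x hx k hk
    refine hψ.1 _ ?_
    have h1 := (valuation_polar_sq_le h2 h.anisotropic x k).trans
      (mul_le_mul' (mem_quadLattice.mp hx) (mem_quadLattice.mp hk))
    rw [one_mul] at h1
    by_contra! hge
    exact absurd (h1.trans_lt hϖ.2.1) (not_lt.mpr (one_le_pow₀ hge))

/-- Orthogonality for the character of the residue field induced by `ψ(· s)`, for a unit `s`. -/
lemma sum_resLift_eq_zero [Fintype 𝓀[F]] (hψ : HasUnitConductor ψ) {s : F}
    (hs : valuation F s = 1) : ∑ α : 𝓀[F], (ψ (resLift α * s) : ℂ) = 0 := by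
  have hcongr : ∀ x y : F, valuation F (x - y) < 1 → ψ (x * s) = ψ (y * s) := fun x y hxy => by
    have e : x * s = y * s + (x - y) * s := by ring
    rw [e, AddChar.map_add_eq_mul, hψ.1 ((x - y) * s) (by rwa [map_mul, hs, mul_one]), mul_one]
  let χ : AddChar 𝓀[F] ℂ :=
    { toFun := fun α => ψ (resLift α * s)
      map_zero_eq_one' := by
        have : valuation F (resLift (0 : 𝓀[F]) - 0) < 1 := by
          rw [sub_zero]
          exact (residue_eq_zero_iff (x := ⟨_, valuation_resLift_le 0⟩)).mp (residue_resLift 0)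
        rw [hcongr _ _ this]
        simp
      map_add_eq_mul' := fun α β => by
        have : valuation F (resLift (α + β) - (resLift α + resLift β)) < 1 := by
          refine residue_eq_iff (x := ⟨_, valuation_resLift_le (α + β)⟩)
            (y := ⟨_, valuation_resLift_le α⟩ + ⟨_, valuation_resLift_le β⟩) |>.mp ?_
          rw [map_add, residue_resLift, residue_resLift, residue_resLift]
        rw [hcongr _ _ this, add_mul, AddChar.map_add_eq_mul, Circle.coe_mul] }
  refine AddChar.sum_eq_zero_of_ne_one (ψ := χ) ?_
  obtain ⟨x, hx, hx1⟩ := hψ.2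
  have hs0 : s ≠ 0 := fun h0 => by simp [h0] at hs
  obtain ⟨α, hα⟩ := exists_resLift_sub_lt (s := x / s) (by rwa [map_div₀, hs, div_one])
  refine AddChar.ne_one_iff.mpr ⟨α, fun h1 => hx1 ?_⟩
  have := hcongr _ _ hα
  rw [div_mul_cancel₀ _ hs0] at this
  rw [this]
  exact Circle.ext h1

/-- A similitude whose factor is a unit preserves Haar measure, since it preserves a lattice. -/
lemma IsQuaternionic.measurePreserving (h2 : (2 : F) ≠ 0) (h : IsQuaternionic Q) {T : V ≃ₜ+ V}
    {l : F} (hT : ∀ z, Q (T z) = l * Q z) (hl : valuation F l = 1) :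
    MeasurePreserving T (addHaar : Measure V) addHaar := by
  have hco := h.isCompactOpen h2 one_ne_zero
  have hpre : T ⁻¹' (h.lattice h2 1 : Set V) = h.lattice h2 1 := by
    ext x
    simp [hT, hl]
  have hm := addEquivAddHaarChar_smul_preimage (addHaar : Measure V)
    (X := (h.lattice h2 1 : Set V)) T
  rw [hpre] at hm
  have hc : addEquivAddHaarChar T = 1 := by
    have hr : (addEquivAddHaarChar T : ℝ) * addHaar.real (h.lattice h2 1 : Set V) =
        1 * addHaar.real (h.lattice h2 1 : Set V) := by
      have := congrArg ENNReal.toReal hm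
      rw [one_mul]
      simpa [ENNReal.smul_def, Measure.real] using this
    exact_mod_cast mul_right_cancel₀ (hco.measureReal_pos addHaar).ne' hr
  refine ⟨T.continuous.measurable, ?_⟩
  have := addEquivAddHaarChar_smul_map (addHaar : Measure V) T
  rwa [hc, one_smul] at this

/-- The integral over the critical lattice is negative: averaging over similitudes turns the
integral over the shell `|Q| = 1` into a sum of a non-trivial character over the non-zero elements
of the residue field. -/
lemma IsQuaternionic.integral_lattice (h2 : (2 : F) ≠ 0) (h : IsQuaternionic Q) {ϖ : F}
    (hϖ : IsUniformizer ϖ) (hψc : Continuous ψ) (hψ : HasUnitConductor ψ) :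
    ∫ x in (h.lattice h2 1 : Set V), (ψ (Q x) : ℂ) ∂addHaar =
      -(Nat.card 𝓀[F] * addHaar.real (h.lattice h2 (valuation F ϖ) : Set V) : ℝ) := by
  classical
  have := Fintype.ofFinite 𝓀[F]
  rw [Nat.card_eq_fintype_card]
  set A := h.lattice h2 1
  set B := h.lattice h2 (valuation F ϖ)
  have hA : IsCompactOpen A := h.isCompactOpen h2 one_ne_zero
  have hB : IsCompactOpen B := h.isCompactOpen h2 hϖ.valuation_pos.ne'
  have hBA : (B : Set V) ⊆ A := fun x hx => (mem_quadLattice.mp hx).trans hϖ.2.1.le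
  set S : Set V := (A : Set V) \ B
  have hSm : MeasurableSet S := hA.measurableSet.diff hB.measurableSet
  have hS : ∀ {x}, x ∈ S ↔ valuation F (Q x) = 1 := fun {x} => by
    change valuation F (Q x) ≤ 1 ∧ ¬ valuation F (Q x) ≤ valuation F ϖ ↔ _
    rw [← hϖ.lt_one_iff, not_lt]
    exact le_antisymm_iff.symm
  have hSfin : addHaar S ≠ ⊤ := ne_top_of_le_ne_top (hA.measure_ne_top _)
    (measure_mono Set.sdiff_subset)
  have hQc := h.continuous
  have hint : ∀ t : F, IntegrableOn (fun x => (ψ (t * Q x) : ℂ)) S addHaar := fun t =>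
    Measure.integrableOn_of_bounded (M := 1) hSfin (Continuous.aestronglyMeasurable (by fun_prop))
      (Filter.Eventually.of_forall fun x => (Circle.norm_coe _).le)
  set J := ∫ x in S, (ψ (Q x) : ℂ) ∂addHaar with hJ
  have hterm : ∀ α : 𝓀[F], α ≠ 0 → ∫ x in S, (ψ (resLift α * Q x) : ℂ) ∂addHaar = J := by
    intro α hα
    obtain ⟨T, l, hT, hl⟩ := h.exists_similitude_factor h2 (valuation_resLift_eq_one hα)
    have hl1 : valuation F l = 1 := by
      rw [← valuation_resLift_eq_one hα]
      exact (valuation F).map_eq_of_sub_lt (by rwa [valuation_resLift_eq_one hα])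
    have hpre : T ⁻¹' S = S := by
      ext x
      rw [Set.mem_preimage, hS, hS, hT, map_mul, hl1, one_mul]
    have hmp := (h.measurePreserving h2 hT hl1).setIntegral_preimage_emb
      T.toHomeomorph.measurableEmbedding (fun x => (ψ (Q x) : ℂ)) S
    rw [hpre] at hmp
    rw [hJ, ← hmp]
    refine setIntegral_congr_fun hSm fun x hx => ?_
    have e : Q (T x) = resLift α * Q x + (l - resLift α) * Q x := by rw [hT]; ring
    simp only [e, AddChar.map_add_eq_mul]
    rw [hψ.1 ((l - resLift α) * Q x) (by rwa [map_mul, hS.mp hx, mul_one]), mul_one]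
  have hzero : ∫ x in S, (ψ (resLift (0 : 𝓀[F]) * Q x) : ℂ) ∂addHaar = (addHaar.real S : ℂ) := by
    rw [setIntegral_congr_fun hSm (g := fun _ => (1 : ℂ)) fun x hx => ?_]
    · simp
    · have : valuation F (resLift (0 : 𝓀[F])) < 1 :=
        (residue_eq_zero_iff (x := ⟨_, valuation_resLift_le 0⟩)).mp (residue_resLift 0)
      simp only
      rw [hψ.1 _ (by rwa [map_mul, hS.mp hx, mul_one]), Circle.coe_one]
  have hsum : ∑ α : 𝓀[F], ∫ x in S, (ψ (resLift α * Q x) : ℂ) ∂addHaar = 0 := by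
    rw [← integral_finsetSum _ fun α _ => hint (resLift α)]
    exact setIntegral_eq_zero_of_forall_eq_zero fun x hx => sum_resLift_eq_zero hψ (hS.mp hx)
  rw [← Finset.add_sum_erase _ _ (Finset.mem_univ (0 : 𝓀[F])), hzero,
    Finset.sum_congr rfl fun α hα => hterm α (Finset.ne_of_mem_erase hα), Finset.sum_const,
    Finset.card_erase_of_mem (Finset.mem_univ _), Finset.card_univ, nsmul_eq_mul,
    Nat.cast_sub Fintype.card_pos, Nat.cast_one] at hsum
  have hvol : addHaar.real S = addHaar.real (A : Set V) - addHaar.real (B : Set V) :=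
    measureReal_sdiff hBA hB.measurableSet (hA.measure_ne_top _)
  have hAB := h.measure_eq h2 hϖ
  rw [Nat.card_eq_fintype_card] at hAB
  rw [hvol, hAB] at hsum
  have hsplit : ∫ x in (A : Set V), (ψ (Q x) : ℂ) ∂addHaar =
      (addHaar.real (B : Set V) : ℂ) + J := by
    rw [← integral_inter_add_sdiff hB.measurableSet (Measure.integrableOn_of_bounded (M := 1)
      (hA.measure_ne_top _) (Continuous.aestronglyMeasurable (by fun_prop))
      (Filter.Eventually.of_forall fun x => (Circle.norm_coe _).le)),
      Set.inter_eq_right.mpr hBA]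
    congr 1
    rw [setIntegral_congr_fun hB.measurableSet (g := fun _ => (1 : ℂ)) fun x hx => ?_]
    · simp
    · simp only
      rw [hψ.1 _ (hϖ.lt_one_iff.mpr hx), Circle.coe_one]
  rw [hsplit]
  have hq := one_lt_card_residue (F := F)
  rw [Nat.card_eq_fintype_card] at hq
  have hq' : ((Fintype.card 𝓀[F] : ℂ) - 1) ≠ 0 := by
    have : (Fintype.card 𝓀[F] : ℝ) - 1 ≠ 0 := (sub_pos.mpr hq).ne'
    exact_mod_cast this
  apply mul_left_cancel₀ hq'
  push_cast at hsum ⊢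
  linear_combination hsum

/-- The Weil index of a multiple of the norm form of a quaternion division algebra. -/
lemma IsQuaternionic.hasWeilPhase (h2 : (2 : F) ≠ 0) (h : IsQuaternionic Q)
    (hψ : Continuous ψ) (hψ1 : ψ ≠ 1) : HasWeilPhase ψ Q (-1) := by
  obtain ⟨ϖ, hϖ⟩ : ∃ ϖ : F, IsUniformizer ϖ := exists_uniformizer F
  obtain ⟨t, ht, hcond⟩ := exists_mulShift_hasUnitConductor hψ hψ1
  have hψt : Continuous (ψ.mulShift t) := (by fun_prop : Continuous fun x => ψ (t * x))
  have h' := h.smul (inv_ne_zero ht)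
  have hA := h'.isCompactOpen h2 one_ne_zero
  have hB := h'.isCompactOpen h2 hϖ.valuation_pos.ne'
  have hBA : h'.lattice h2 (valuation F ϖ) ≤ h'.lattice h2 1 :=
    fun x hx => (mem_quadLattice.mp hx).trans hϖ.2.1.le
  refine ⟨by simp, addHaar, inferInstance, _,
    mul_pos (zero_lt_one.trans (one_lt_card_residue (F := F)))
    (hB.measureReal_pos addHaar), _, hA, fun Λ hΛ hAΛ => ?_⟩
  have e : ∀ x, ψ (Q x) = (ψ.mulShift t) ((t⁻¹ • Q) x) := fun x => by
    simp [AddChar.mulShift_apply, ht]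
  simp only [e]
  rw [setIntegral_eq_inter_orth hψt h'.continuous addHaar hB hΛ (hBA.trans hAΛ)
    (fun k hk => hcond.1 _ (hϖ.lt_one_iff.mpr hk)), h'.orth_lattice h2 hϖ hcond,
    inf_eq_right.mpr hAΛ, h'.integral_lattice h2 hϖ hψt hcond]
  push_cast
  ring

end Conductor

end Quaternary

/-! ### Quaternion algebras, the Hilbert symbol and the Weil index -/

section Quaternion

open QuadraticMap ValuativeRel MeasureTheory MeasureTheory.Measure

section Algebra

variable {F : Type u} [Field F]

/-- Multiplication in the quaternion algebra with `i² = a`, `j² = b`, in the coordinates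
`((x₁, x₂), (x₃, x₄))` of `x₁ + x₂ i + x₃ j + x₄ ij`. -/
def quatMul (a b : F) (z x : (F × F) × (F × F)) : (F × F) × (F × F) :=
  ((z.1.1 * x.1.1 + a * z.1.2 * x.1.2 + b * z.2.1 * x.2.1 - a * b * z.2.2 * x.2.2,
    z.1.1 * x.1.2 + z.1.2 * x.1.1 - b * z.2.1 * x.2.2 + b * z.2.2 * x.2.1),
   (z.1.1 * x.2.1 + z.2.1 * x.1.1 + a * z.1.2 * x.2.2 - a * z.2.2 * x.1.2,
    z.1.1 * x.2.2 + z.2.2 * x.1.1 + z.1.2 * x.2.1 - z.2.1 * x.1.2))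

/-- The conjugation of the quaternion algebra. -/
def quatConj (x : (F × F) × (F × F)) : (F × F) × (F × F) :=
  ((x.1.1, -x.1.2), (-x.2.1, -x.2.2))

/-- The form `c ⟨1, -a, -b, ab⟩`, a multiple of the norm form of a quaternion algebra. -/
def quatForm (c a b : F) : QuadraticForm F ((F × F) × (F × F)) :=
  ((unary c).prod (unary (-(c * a)))).prod ((unary (-(c * b))).prod (unary (c * a * b)))

lemma quatForm_apply (c a b : F) (x : (F × F) × (F × F)) :
    quatForm c a b x = c * (x.1.1 * x.1.1 - a * (x.1.2 * x.1.2) - b * (x.2.1 * x.2.1) +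
      a * b * (x.2.2 * x.2.2)) := by
  simp only [quatForm, QuadraticMap.prod_apply, unary_apply]
  ring

lemma quatForm_eq_smul (c a b : F) : quatForm c a b = c • quatForm 1 a b := by
  ext x
  simp only [_root_.smul_apply, quatForm_apply, smul_eq_mul]
  ring

lemma quatForm_mul (a b : F) (z x : (F × F) × (F × F)) :
    quatForm 1 a b (quatMul a b z x) = quatForm 1 a b z * quatForm 1 a b x := by
  simp only [quatForm_apply, quatMul]
  ring

lemma quatMul_conj_left (a b : F) (z x : (F × F) × (F × F)) :
    quatMul a b (quatConj z) (quatMul a b z x) = quatForm 1 a b z • x := by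
  ext <;> simp [quatForm_apply, quatMul, quatConj] <;> ring

lemma quatMul_conj_right (a b : F) (z x : (F × F) × (F × F)) :
    quatMul a b z (quatMul a b (quatConj z) x) = quatForm 1 a b z • x := by
  ext <;> simp [quatForm_apply, quatMul, quatConj] <;> ring

lemma quatMul_mul_conj (a b : F) (x y : (F × F) × (F × F)) :
    quatMul a b (quatMul a b y (quatConj x)) x = quatForm 1 a b x • y := by
  ext <;> simp [quatForm_apply, quatMul, quatConj] <;> ring

lemma quatMul_smul_left (a b s : F) (z x : (F × F) × (F × F)) :
    quatMul a b (s • z) x = s • quatMul a b z x := by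
  ext <;> simp [quatMul] <;> ring

lemma quatMul_smul_right (a b s : F) (z x : (F × F) × (F × F)) :
    quatMul a b z (s • x) = s • quatMul a b z x := by
  ext <;> simp [quatMul] <;> ring

lemma quatMul_add (a b : F) (z x y : (F × F) × (F × F)) :
    quatMul a b z (x + y) = quatMul a b z x + quatMul a b z y := by
  ext <;> simp [quatMul] <;> ring

/-- If `(a, b)_F = -1`, the quaternion algebra is a division algebra. -/
lemma quatForm_anisotropic {a b : F}
    (hab : ¬ ∃ x y z : F, (x ≠ 0 ∨ y ≠ 0 ∨ z ≠ 0) ∧ z ^ 2 = a * x ^ 2 + b * y ^ 2) :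
    (quatForm 1 a b).Anisotropic := by
  have hN : ∀ s t : F, s * s - a * (t * t) = 0 → s = 0 ∧ t = 0 := fun s t h => by
    by_contra hne
    refine hab ⟨t, 0, s, ?_, by linear_combination h⟩
    tauto
  rintro ⟨⟨x₁, x₂⟩, x₃, x₄⟩ h
  rw [quatForm_apply] at h
  simp only [one_mul] at h
  by_cases hv : x₃ = 0 ∧ x₄ = 0
  · obtain ⟨rfl, rfl⟩ := hv
    obtain ⟨rfl, rfl⟩ := hN x₁ x₂ (by linear_combination h)
    rfl
  · exfalso
    have hn : x₃ * x₃ - a * (x₄ * x₄) ≠ 0 := fun h0 => hv (hN _ _ h0)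
    -- `b` is the norm of `(x₁ + x₂ √a) / (x₃ + x₄ √a)`
    refine hab ⟨x₁ * x₄ - x₂ * x₃, x₃ * x₃ - a * (x₄ * x₄), x₁ * x₃ - a * (x₂ * x₄),
      Or.inr (Or.inl hn), ?_⟩
    linear_combination (x₃ * x₃ - a * (x₄ * x₄)) * h

end Algebra

variable {F : Type u} [Field F] [ValuativeRel F] [TopologicalSpace F]
  [IsNonarchimedeanLocalField F] {ψ : AddChar F Circle}

instance t2Space : T2Space F :=
  IsTopologicalAddGroup.t2Space_of_zero_sep fun x hx =>
    ⟨{y | valuation F y < valuation F x}, (IsValuativeTopology.hasBasis_nhds_zero' F).mem_of_mem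
      (by simpa using hx), fun (h : valuation F x < valuation F x) => lt_irrefl _ h⟩

lemma continuous_quatMul (a b : F) (z : (F × F) × (F × F)) : Continuous (quatMul a b z) := by
  unfold quatMul
  fun_prop

/-- Left multiplication by a quaternion of non-zero norm. -/
def quatMulEquiv {a b : F} {z : (F × F) × (F × F)} (hz : quatForm 1 a b z ≠ 0) :
    (F × F) × (F × F) ≃ₜ+ (F × F) × (F × F) where
  toFun := quatMul a b z
  invFun x := (quatForm 1 a b z)⁻¹ • quatMul a b (quatConj z) x
  left_inv x := by
    change _ • quatMul a b (quatConj z) (quatMul a b z x) = x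
    rw [quatMul_conj_left, inv_smul_smul₀ hz]
  right_inv x := by rw [quatMul_smul_right, quatMul_conj_right, inv_smul_smul₀ hz]
  map_add' := quatMul_add a b z
  continuous_toFun := continuous_quatMul a b z
  continuous_invFun := Continuous.fun_const_smul (continuous_quatMul a b (quatConj z)) _

lemma continuous_quatForm (c a b : F) : Continuous (quatForm c a b) := by
  have : (quatForm c a b : (F × F) × (F × F) → F) = fun x =>
    c * (x.1.1 * x.1.1 - a * (x.1.2 * x.1.2) - b * (x.2.1 * x.2.1) +
      a * b * (x.2.2 * x.2.2)) := funext (quatForm_apply c a b)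
  rw [this]
  fun_prop

/-- By the Cauchy–Schwarz inequality, the coordinates are bounded where the norm form is. -/
lemma isCompact_quatForm_le (h2 : (2 : F) ≠ 0) {a b : F} (ha : a ≠ 0) (hb : b ≠ 0)
    (haniso : (quatForm 1 a b).Anisotropic) (γ : ValueGroupWithZero F) :
    IsCompact {x | valuation F (quatForm 1 a b x) ≤ γ} := by
  have key : ∀ (e : (F × F) × (F × F)) (d : F) (f : (F × F) × (F × F) → F), d ≠ 0 →
      (∀ x, polar (quatForm 1 a b) x e = d * f x) →
      ∃ δ, ∀ x, valuation F (quatForm 1 a b x) ≤ γ → valuation F (f x) ≤ δ := by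
    intro e d f hd hf
    have hdv : 0 < valuation F d ^ 2 := pow_pos (zero_lt_iff.mpr (by simpa using hd)) 2
    refine ⟨max 1 (γ * valuation F (quatForm 1 a b e) / valuation F d ^ 2), fun x hx => ?_⟩
    have h := valuation_polar_sq_le h2 haniso x e
    rw [hf, map_mul, mul_pow] at h
    by_contra! hlt
    obtain ⟨h1, h3⟩ := max_lt_iff.mp hlt
    refine absurd (h.trans (mul_le_mul_left hx _)) (not_le.mpr ?_)
    rw [div_lt_iff₀ hdv, mul_comm (valuation F (f x))] at h3
    refine h3.trans_le ?_
    gcongr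
    exact le_self_pow₀ h1.le two_ne_zero
  obtain ⟨δ₁, h₁⟩ := key ((1, 0), (0, 0)) 2 (fun x => x.1.1) h2 fun x => by
    simp [polar, quatForm_apply]; ring
  obtain ⟨δ₂, h₂⟩ := key ((0, 1), (0, 0)) (-(2 * a)) (fun x => x.1.2)
    (neg_ne_zero.mpr (mul_ne_zero h2 ha)) fun x => by simp [polar, quatForm_apply]; ring
  obtain ⟨δ₃, h₃⟩ := key ((0, 0), (1, 0)) (-(2 * b)) (fun x => x.2.1)
    (neg_ne_zero.mpr (mul_ne_zero h2 hb)) fun x => by simp [polar, quatForm_apply]; ring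
  obtain ⟨δ₄, h₄⟩ := key ((0, 0), (0, 1)) (2 * (a * b)) (fun x => x.2.2)
    (mul_ne_zero h2 (mul_ne_zero ha hb)) fun x => by simp [polar, quatForm_apply]; ring
  have hcl : IsClosed {x : F | valuation F x ≤ γ} := by
    rcases eq_or_ne γ 0 with rfl | hγ
    · have : {x : F | valuation F x ≤ 0} = {0} := by ext x; simp
      rw [this]
      exact isClosed_singleton
    · exact AddSubgroup.isClosed_of_isOpen (ball F γ) (ball_isCompactOpen hγ).2
  have hb := IsNonarchimedeanLocalField.isCompact_closedBall F
  exact (((hb δ₁).prod (hb δ₂)).prod ((hb δ₃).prod (hb δ₄))).of_isClosed_subset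
    (hcl.preimage (continuous_quatForm 1 a b))
    fun x hx => ⟨⟨h₁ x hx, h₂ x hx⟩, h₃ x hx, h₄ x hx⟩

variable [MeasurableSpace F] [BorelSpace F]

/-- The cosets of the maximal ideal in the ring of integers are disjoint. -/
lemma card_mul_measure_ball_le {ϖ : F} (hϖ0 : ϖ ≠ 0) (hϖ : valuation F ϖ < 1) :
    (Nat.card 𝓀[F] : ℝ) * (addHaar : Measure F).real (ball F (valuation F ϖ)) ≤
      (addHaar : Measure F).real (ball F 1) := by
  have := Fintype.ofFinite 𝓀[F]
  have hco : IsCompactOpen (ball F (valuation F ϖ)) := ball_isCompactOpen (by simpa using hϖ0)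
  have hm : ∀ α : 𝓀[F], addHaar ((fun y => y + -resLift α) ⁻¹' (ball F (valuation F ϖ) : Set F)) =
      (addHaar : Measure F) (ball F (valuation F ϖ)) := fun α => measure_preimage_add_right _ _ _
  have hU : (addHaar : Measure F).real
      (⋃ α : 𝓀[F], (fun y => y + -resLift α) ⁻¹' (ball F (valuation F ϖ) : Set F)) =
      (Nat.card 𝓀[F] : ℝ) * (addHaar : Measure F).real (ball F (valuation F ϖ)) := by
    rw [measureReal_iUnion_fintype (h' := fun α => by rw [hm]; exact hco.measure_ne_top _)]
    · simp [Measure.real, hm]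
    · intro α β hαβ
      refine Set.disjoint_left.mpr fun y hα hβ => hαβ ?_
      simp only [Set.mem_preimage, SetLike.mem_coe, mem_ball] at hα hβ
      rw [← residue_resLift α, ← residue_resLift β, residue_eq_iff]
      have := (valuation F).map_sub_lt (hβ.trans_lt hϖ) (hα.trans_lt hϖ)
      convert this using 2
      change resLift α - resLift β = _
      ring
    · exact fun α => hco.measurableSet.preimage (by fun_prop)
  rw [← hU]
  refine measureReal_mono (Set.iUnion_subset fun α y hy => ?_)
    ((ball_isCompactOpen one_ne_zero).measure_ne_top _)
  have h1 : valuation F (y + -resLift α) ≤ 1 := (mem_ball.mp hy).trans hϖ.le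
  have := (valuation F).map_add_le h1 (valuation_resLift_le α)
  simpa using this

/-- Multiplication by a scalar on the quaternions. -/
def quatScale {s : F} (hs : s ≠ 0) : (F × F) × (F × F) ≃ₜ+ (F × F) × (F × F) where
  toFun x := s • x
  invFun x := s⁻¹ • x
  left_inv x := inv_smul_smul₀ hs x
  right_inv x := smul_inv_smul₀ hs x
  map_add' := smul_add s
  continuous_toFun := continuous_const_smul s
  continuous_invFun := continuous_const_smul s⁻¹

/-- Multiplication by an element of the maximal ideal shrinks the measure of a set of quaternions
by a factor of at most `q⁻⁴`, as the quaternions have dimension four. -/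
lemma measure_scale_quaternion {ϖ : F} (hϖ0 : ϖ ≠ 0) (hϖ : valuation F ϖ < 1)
    (S : Set ((F × F) × (F × F))) :
    (Nat.card 𝓀[F] : ℝ) ^ 4 * (addHaar : Measure ((F × F) × (F × F))).real S ≤
      (addHaar : Measure ((F × F) × (F × F))).real {x | ϖ • x ∈ S} := by
  set μ : Measure ((F × F) × (F × F)) := addHaar
  set q : ℝ := (Nat.card 𝓀[F] : ℝ)
  set κ : ℝ := ((addEquivAddHaarChar (quatScale hϖ0) : NNReal) : ℝ)
  have hκ : ∀ X, κ * μ.real {x | ϖ • x ∈ X} = μ.real X := fun X => by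
    have := congrArg ENNReal.toReal
      (addEquivAddHaarChar_smul_preimage μ (X := X) (quatScale hϖ0))
    simp only [ENNReal.smul_def, smul_eq_mul, ENNReal.toReal_mul, ENNReal.coe_toReal] at this
    exact this
  let box : ValueGroupWithZero F → AddSubgroup ((F × F) × (F × F)) := fun γ =>
    ((ball F γ).prod (ball F γ)).prod ((ball F γ).prod (ball F γ))
  have hbox : ∀ {γ}, γ ≠ 0 → IsCompactOpen (box γ) := fun {γ} hγ =>
    have h := ball_isCompactOpen hγ
    (h.prod h).prod (h.prod h)
  let m : Measure F := addHaar
  let ν : Measure ((F × F) × (F × F)) := (m.prod m).prod (m.prod m)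
  have : (m.prod m).IsAddHaarMeasure :=
    inferInstanceAs (((addHaar : Measure F).prod (addHaar : Measure F)).IsAddHaarMeasure)
  have : SFinite (m.prod m) :=
    inferInstanceAs (SFinite ((addHaar : Measure F).prod (addHaar : Measure F)))
  have : ν.IsAddHaarMeasure := prod.instIsAddHaarMeasure (G := F × F) (H := F × F) _ _
  have hν : ∀ γ, ν.real (box γ) = m.real (ball F γ) ^ 4 := fun γ => by
    simp only [box, ν, AddSubgroup.coe_prod, measureReal_prod_prod]
    ring
  have hμν : ∀ γ, μ.real (box γ) = addHaarScalarFactor μ ν * m.real (ball F γ) ^ 4 := fun γ => by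
    rw [← hν]
    conv_lhs => rw [isAddLeftInvariant_eq_smul μ ν]
    rw [measureReal_nnreal_smul_apply]
  have hpre : {x | ϖ • x ∈ (box (valuation F ϖ) : Set ((F × F) × (F × F)))} =
      (box 1 : Set ((F × F) × (F × F))) := by
    have hv : 0 < valuation F ϖ := zero_lt_iff.mpr (by simpa using hϖ0)
    ext x
    simp [box, AddSubgroup.mem_prod, mul_le_iff_le_one_right hv]
  have h1 := hκ (box (valuation F ϖ) : Set ((F × F) × (F × F)))
  rw [hpre] at h1
  have hle : q ^ 4 * μ.real (box (valuation F ϖ) : Set ((F × F) × (F × F))) ≤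
      μ.real (box 1 : Set ((F × F) × (F × F))) := by
    rw [hμν, hμν]
    have := pow_le_pow_left₀ (by positivity) (card_mul_measure_ball_le hϖ0 hϖ) 4
    calc _ = (addHaarScalarFactor μ ν : ℝ) * (q * m.real (ball F (valuation F ϖ))) ^ 4 := by ring
      _ ≤ _ := by gcongr
  have hpos := (hbox one_ne_zero).measureReal_pos μ
  have hqκ : q ^ 4 * κ ≤ 1 := by
    rw [← h1, ← mul_assoc] at hle
    exact le_of_mul_le_mul_right (by linarith) hpos
  rw [← hκ S, ← mul_assoc]
  exact mul_le_of_le_one_left measureReal_nonneg hqκ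

lemma isQuaternionic_quatForm (h2 : (2 : F) ≠ 0) {a b : F} (ha : a ≠ 0) (hb : b ≠ 0)
    (hab : ¬ ∃ x y z : F, (x ≠ 0 ∨ y ≠ 0 ∨ z ≠ 0) ∧ z ^ 2 = a * x ^ 2 + b * y ^ 2) :
    IsQuaternionic (quatForm 1 a b) where
  continuous := continuous_quatForm 1 a b
  anisotropic := quatForm_anisotropic hab
  isCompact := isCompact_quatForm_le h2 ha hb (quatForm_anisotropic hab)
  exists_similitude x y hx hy := by
    have hA := quatForm_anisotropic hab
    have hx' : quatForm 1 a b x ≠ 0 := fun h => hx (hA x h)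
    have hy' : quatForm 1 a b y ≠ 0 := fun h => hy (hA y h)
    set z := (quatForm 1 a b x)⁻¹ • quatMul a b y (quatConj x) with hz
    have hzx : quatMul a b z x = y := by
      rw [hz, quatMul_smul_left, quatMul_mul_conj, inv_smul_smul₀ hx']
    have hzn : quatForm 1 a b z ≠ 0 := fun h => hy' (by rw [← hzx, quatForm_mul, h, zero_mul])
    exact ⟨quatMulEquiv hzn, quatForm 1 a b z, by exact hzx, fun w => quatForm_mul a b z w⟩
  measure_scale _ S h0 h1 := measure_scale_quaternion h0 h1 S

lemma weilIndex_ne_zero (h2 : (2 : F) ≠ 0) (hψ : Continuous ψ) (hψ1 : ψ ≠ 1) {c : F}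
    (hc : c ≠ 0) : weilIndex (ψ.mulShift c) ≠ 0 := fun h => by
  have := (hasWeilPhase_unary h2 hψ hψ1 hc).1
  rw [h] at this
  simp at this

/-- The Weil index of the quaternary form `c ⟨1, -a, -b, ab⟩` is the Hilbert symbol `(a, b)_F`. -/
theorem weilIndex_quaternion (h2 : (2 : F) ≠ 0) (hψ : Continuous ψ) (hψ1 : ψ ≠ 1) (a b : Fˣ)
    {c : F} (hc : c ≠ 0) :
    weilIndex (ψ.mulShift c) * weilIndex (ψ.mulShift (-(c * a))) =
      ((hilbertSymbol a b : ℤ) : ℂ) *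
        (weilIndex (ψ.mulShift (c * b)) * weilIndex (ψ.mulShift (-(c * a * b)))) := by
  have hca : c * a ≠ 0 := mul_ne_zero hc a.ne_zero
  have hcb : c * b ≠ 0 := mul_ne_zero hc b.ne_zero
  have hcab : c * a * b ≠ 0 := mul_ne_zero hca b.ne_zero
  unfold hilbertSymbol
  split_ifs with hab
  · rw [weilIndex_quaternion_split h2 hψ hψ1 a.ne_zero b.ne_zero hc hab]
    simp
  · have h := (isQuaternionic_quatForm h2 a.ne_zero b.ne_zero hab).smul hc
    rw [← quatForm_eq_smul] at h
    have h1 := h.hasWeilPhase h2 hψ hψ1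
    have h' := (hasWeilPhase_binary h2 hψ hψ1 hc (neg_ne_zero.mpr hca)).prod hψ
      (continuous_binary _ _) (continuous_binary _ _)
      ((isTame_unary h2 hψ hψ1 hc).prod (isTame_unary h2 hψ hψ1 (neg_ne_zero.mpr hca)))
      ((isTame_unary h2 hψ hψ1 (neg_ne_zero.mpr hcb)).prod (isTame_unary h2 hψ hψ1 hcab))
      (hasWeilPhase_binary h2 hψ hψ1 (neg_ne_zero.mpr hcb) hcab)
    have e := h'.unique h1
    rw [weilIndex_neg h2 hψ hψ1 hcb] at e
    rw [weilIndex_neg h2 hψ hψ1 hcab]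
    have n1 := weilIndex_ne_zero h2 hψ hψ1 hcb
    have n2 := weilIndex_ne_zero h2 hψ hψ1 hcab
    field_simp at e ⊢
    push_cast
    linear_combination e

lemma intUnits_cast_injective {x y : ℤˣ} (h : ((x : ℤ) : ℂ) = ((y : ℤ) : ℂ)) : x = y :=
  Units.ext (by exact_mod_cast h)

lemma intUnits_cast_mul_self (s : ℤˣ) : ((s : ℤ) : ℂ) * ((s : ℤ) : ℂ) = 1 := by
  rw [← Int.cast_mul, ← Units.val_mul, Int.units_mul_self]
  simp

/-- The Hilbert symbol is bimultiplicative. -/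
theorem hilbertBimult_of_char (h2 : (2 : F) ≠ 0) (hψ : Continuous ψ) (hψ1 : ψ ≠ 1) :
    HilbertBimult F := by
  intro a a' b
  rw [hilbertSymbol_comm _ b, hilbertSymbol_comm _ b, hilbertSymbol_comm _ b]
  apply intUnits_cast_injective
  have h1 := weilIndex_quaternion h2 hψ hψ1 b (a * a') one_ne_zero
  have h3 := weilIndex_quaternion h2 hψ hψ1 b a one_ne_zero
  have h4 := weilIndex_quaternion h2 hψ hψ1 b a' a.ne_zero
  simp only [Units.val_mul, one_mul] at h1 h3
  rw [mul_comm (a : F) (b : F)] at h4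
  rw [h3, h4, mul_assoc (b : F), ← mul_assoc ((_ : ℤ) : ℂ)] at h1
  have hne := mul_ne_zero
    (weilIndex_ne_zero h2 hψ hψ1 (mul_ne_zero a.ne_zero a'.ne_zero))
    (weilIndex_ne_zero h2 hψ hψ1
      (neg_ne_zero.mpr (mul_ne_zero b.ne_zero (mul_ne_zero a.ne_zero a'.ne_zero))))
  have := mul_right_cancel₀ hne h1
  push_cast
  exact this.symm

/-- The ratio `γ(ψ_{1/2}) / γ(ψ_{a/2})`, the value of `χ_ψ` at `(g, 1)` with `det g = a`. -/
def weilRatio (ψ : AddChar F Circle) (a : F) : ℂ :=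
  weilIndex (ψ.mulShift (1 / 2)) * (weilIndex (ψ.mulShift (a / 2)))⁻¹

/-- The ratio splits the Hilbert symbol. -/
theorem weilRatio_mul (h2 : (2 : F) ≠ 0) (hψ : Continuous ψ) (hψ1 : ψ ≠ 1) (a b : Fˣ) :
    weilRatio ψ (a * b) = weilRatio ψ a * weilRatio ψ b * ((hilbertSymbol a b : ℤ) : ℂ) := by
  have hh : (1 / 2 : F) ≠ 0 := one_div_ne_zero h2
  have h := weilIndex_quaternion h2 hψ hψ1 a b hh
  have e1 : (1 / 2 : F) * a = a / 2 := by ring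
  have e2 : (1 / 2 : F) * b = b / 2 := by ring
  have e3 : (a / 2 : F) * b = a * b / 2 := by ring
  have na := div_ne_zero a.ne_zero h2
  have nb := div_ne_zero b.ne_zero h2
  have nab := div_ne_zero (mul_ne_zero a.ne_zero b.ne_zero) h2
  rw [e1, e2, e3, weilIndex_neg h2 hψ hψ1 na, weilIndex_neg h2 hψ hψ1 nab] at h
  unfold weilRatio
  have n1 := weilIndex_ne_zero h2 hψ hψ1 hh
  have n2 := weilIndex_ne_zero h2 hψ hψ1 na
  have n3 := weilIndex_ne_zero h2 hψ hψ1 nb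
  have n4 := weilIndex_ne_zero h2 hψ hψ1 nab
  have hsq : ((hilbertSymbol a b : ℤ) : ℂ) * ((hilbertSymbol a b : ℤ) : ℂ) = 1 :=
    intUnits_cast_mul_self _
  generalize ((hilbertSymbol a b : ℤ) : ℂ) = ε at *
  field_simp at h ⊢
  linear_combination (-ε) * h -
    weilIndex (ψ.mulShift (a / 2)) * weilIndex (ψ.mulShift (b / 2)) * hsq

lemma weilRatio_one (h2 : (2 : F) ≠ 0) (hψ : Continuous ψ) (hψ1 : ψ ≠ 1) :
    weilRatio ψ (1 : F) = 1 :=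
  mul_inv_cancel₀ (weilIndex_ne_zero h2 hψ hψ1 (one_div_ne_zero h2))

lemma weilRatio_sq (h2 : (2 : F) ≠ 0) (hψ : Continuous ψ) (hψ1 : ψ ≠ 1) {s : F} (hs : s ≠ 0) :
    weilRatio ψ (s ^ 2) = 1 := by
  have hh : (1 / 2 : F) ≠ 0 := one_div_ne_zero h2
  have e : s ^ 2 / 2 = 1 / 2 * s ^ 2 := by ring
  rw [weilRatio, e, weilIndex_mul_sq h2 hψ hψ1 hh hs,
    mul_inv_cancel₀ (weilIndex_ne_zero h2 hψ hψ1 hh)]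

/-- Near `1` the ratio is `1`, since elements close to `1` are squares. -/
lemma eventually_weilRatio_eq_one (h2 : (2 : F) ≠ 0) (hψ : Continuous ψ) (hψ1 : ψ ≠ 1) :
    ∀ᶠ a in nhds (1 : F), weilRatio ψ a = 1 := by
  have h4 : (4 : F) ≠ 0 := by
    have : (4 : F) = 2 * 2 := by norm_num
    rw [this]
    exact mul_ne_zero h2 h2
  have hU : {x : F | valuation F x < 1} ∈ nhds (0 : F) :=
    (IsValuativeTopology.hasBasis_nhds_zero' F).mem_of_mem one_ne_zero
  have hc : Filter.Tendsto (fun a : F => (1 - a) / 4) (nhds 1) (nhds 0) := by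
    have : Continuous fun a : F => (1 - a) / 4 := by fun_prop
    simpa using this.tendsto 1
  filter_upwards [hc hU, isOpen_ne.mem_nhds (one_ne_zero (α := F))] with a ha ha0
  obtain ⟨s, hs⟩ := exists_sq_eq_one_sub_four_mul ha
  have e : a = s ^ 2 := by rw [hs]; field_simp; ring
  rw [e]
  refine weilRatio_sq h2 hψ hψ1 fun h0 => ha0 ?_
  rw [e, h0]
  simp

end Quaternion

/-! ### Representations that agree up to a pullback and a twist -/

section Twist

/-- `ρ'` is isomorphic to the twist by `χ` of the pullback of `ρ` along `φ`. -/
def IsTwistOf {G G' V V' : Type*} [Group G] [Group G'] [AddCommMonoid V] [Module ℂ V]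
    [AddCommMonoid V'] [Module ℂ V'] (φ : G' →* G) (χ : G' →* ℂ) (ρ : Representation ℂ G V)
    (ρ' : Representation ℂ G' V') : Prop :=
  ∃ e : V ≃ₗ[ℂ] V', ∀ g v, ρ' g (e v) = χ g • e (ρ (φ g) v)

variable {G G' H H' : Type*} [Group G] [Group G'] [Group H] [Group H']
  {V V' W W' : Type*} [AddCommGroup V] [Module ℂ V] [AddCommGroup V'] [Module ℂ V']
  [AddCommGroup W] [Module ℂ W] [AddCommGroup W'] [Module ℂ W']
  {φ : G' →* G} {χ : G' →* ℂ} {φ₁ : H' →* H} {χ₁ : H' →* ℂ}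
  {ρ : Representation ℂ G V} {ρ' : Representation ℂ G' V'}
  {σ : Representation ℂ G W} {σ' : Representation ℂ G' W'}

lemma char_ne_zero (χ : G' →* ℂ) (g : G') : χ g ≠ 0 := fun h => by
  have := map_mul χ g g⁻¹
  rw [mul_inv_cancel, map_one, h, zero_mul] at this
  exact one_ne_zero this

/-- Invariant subspaces correspond under a twist. -/
def twistSubrep (hφ : Function.Surjective φ) (e : V ≃ₗ[ℂ] V')
    (he : ∀ g v, ρ' g (e v) = χ g • e (ρ (φ g) v)) :
    Subrepresentation ρ ≃o Subrepresentation ρ' where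
  toFun A := ⟨A.toSubmodule.map e.toLinearMap, by
    rintro g _ ⟨v, hv, rfl⟩
    refine ⟨χ g • ρ (φ g) v, A.toSubmodule.smul_mem _ (A.apply_mem_toSubmodule _ hv), ?_⟩
    simp [he]⟩
  invFun A := ⟨A.toSubmodule.comap e.toLinearMap, by
    intro g v hv
    obtain ⟨g, rfl⟩ := hφ g
    have h : ρ' g (e v) ∈ A.toSubmodule := A.apply_mem_toSubmodule g hv
    rw [he] at h
    exact (A.toSubmodule.smul_mem_iff (char_ne_zero χ g)).mp h⟩
  left_inv A := Subrepresentation.toSubmodule_injective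
    (Submodule.comap_map_eq_of_injective e.injective _)
  right_inv A := Subrepresentation.toSubmodule_injective
    (Submodule.map_comap_eq_of_surjective e.surjective _)
  map_rel_iff' {A B} :=
    Submodule.map_le_map_iff_of_injective e.injective A.toSubmodule B.toSubmodule

lemma mem_twistSubrep (hφ : Function.Surjective φ) (e : V ≃ₗ[ℂ] V')
    (he : ∀ g v, ρ' g (e v) = χ g • e (ρ (φ g) v)) (A : Subrepresentation ρ) (v : V) :
    e v ∈ (twistSubrep hφ e he A).toSubmodule ↔ v ∈ A.toSubmodule := by
  change e.toLinearMap v ∈ A.toSubmodule.map e.toLinearMap ↔ _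
  exact ⟨fun ⟨w, hw, h⟩ => e.injective h ▸ hw, fun h => ⟨v, h, rfl⟩⟩

/-- Subquotients in terms of linear maps instead of bundled intertwining maps. -/
lemma isSubquotient_iff {A B : Subrepresentation ρ} :
    IsSubquotient A B σ ↔ A.toSubmodule ≤ B.toSubmodule ∧ ∃ f : B.toSubmodule →ₗ[ℂ] W,
      (∀ g (v : B.toSubmodule), f ⟨ρ g v, B.apply_mem_toSubmodule g v.2⟩ = σ g (f v)) ∧
      Function.Surjective f ∧ ∀ v, f v = 0 ↔ (v : V) ∈ A.toSubmodule := by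
  refine and_congr_right fun _ => ⟨fun ⟨f, hf⟩ => ⟨f.toLinearMap, fun g v => ?_, hf⟩,
    fun ⟨f, hf, hf'⟩ => ⟨⟨f, fun g => LinearMap.ext fun v => hf g v⟩, hf'⟩⟩
  exact LinearMap.congr_fun (f.isIntertwining' g) v

lemma isSubquotient_twistSubrep (hφ : Function.Surjective φ) (e : V ≃ₗ[ℂ] V')
    (he : ∀ g v, ρ' g (e v) = χ g • e (ρ (φ g) v)) (hσ : IsTwistOf φ χ σ σ')
    (A B : Subrepresentation ρ) :
    IsSubquotient (twistSubrep hφ e he A) (twistSubrep hφ e he B) σ' ↔ IsSubquotient A B σ := by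
  obtain ⟨d, hd⟩ := hσ
  rw [isSubquotient_iff, isSubquotient_iff]
  refine and_congr ((twistSubrep hφ e he).le_iff_le) ?_
  let eB : B.toSubmodule ≃ₗ[ℂ] (twistSubrep hφ e he B).toSubmodule :=
    e.submoduleMap B.toSubmodule
  have heB : ∀ v, (eB v : V') = e v := fun v => rfl
  have hact : ∀ g (v : B.toSubmodule),
      (⟨ρ' g (eB v), (twistSubrep hφ e he B).apply_mem_toSubmodule g (eB v).2⟩ :
        (twistSubrep hφ e he B).toSubmodule) =
      χ g • eB ⟨ρ (φ g) v, B.apply_mem_toSubmodule _ v.2⟩ := fun g v =>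
    Subtype.ext (he g v)
  constructor
  · rintro ⟨f, hf, hs, hk⟩
    refine ⟨d.symm.toLinearMap ∘ₗ f ∘ₗ eB.toLinearMap, fun g v => ?_,
      d.symm.surjective.comp (hs.comp eB.surjective), fun v => ?_⟩
    · obtain ⟨g, rfl⟩ := hφ g
      have h := hf g (eB v)
      rw [hact, map_smul] at h
      have h' := hd g (d.symm (f (eB v)))
      rw [d.apply_symm_apply, ← h] at h'
      have h'' := smul_right_injective _ (char_ne_zero χ g) h'
      change d.symm (f (eB _)) = σ (φ g) (d.symm (f (eB v)))
      rw [h'', d.symm_apply_apply]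
    · change d.symm (f (eB v)) = 0 ↔ _
      rw [LinearEquiv.map_eq_zero_iff, hk, heB, mem_twistSubrep]
  · rintro ⟨f, hf, hs, hk⟩
    refine ⟨d.toLinearMap ∘ₗ f ∘ₗ eB.symm.toLinearMap, fun g v => ?_,
      d.surjective.comp (hs.comp eB.symm.surjective), fun v => ?_⟩
    · obtain ⟨v, rfl⟩ := eB.surjective v
      rw [hact]
      simp only [LinearMap.comp_apply, LinearEquiv.coe_coe, map_smul, eB.symm_apply_apply, hf, hd]
    · obtain ⟨v, rfl⟩ := eB.surjective v
      simp only [LinearMap.comp_apply, LinearEquiv.coe_coe, eB.symm_apply_apply, heB,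
        mem_twistSubrep, LinearEquiv.map_eq_zero_iff, hk]

/-- Jordan–Hölder multiplicities are invariant under twists. -/
theorem IsTwistOf.jhMult_eq (hφ : Function.Surjective φ) (hρ : IsTwistOf φ χ ρ ρ')
    (hσ : IsTwistOf φ χ σ σ') : jhMult ρ' σ' = jhMult ρ σ := by
  obtain ⟨e, he⟩ := hρ
  unfold jhMult
  congr 1
  ext m
  let E := Equiv.arrowCongr (Equiv.refl (Fin m)) (twistSubrep hφ e he).toEquiv
  refine E.surjective.exists.trans (exists_congr fun A =>
    E.surjective.exists.trans (exists_congr fun B => and_congr ?_ ?_))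
  · exact forall₃_congr fun i j _ => (twistSubrep hφ e he).le_iff_le
  · exact forall_congr' fun i => isSubquotient_twistSubrep hφ e he hσ (A i) (B i)

lemma IsTwistOf.isIrreducible (hφ : Function.Surjective φ) (hρ : IsTwistOf φ χ ρ ρ') :
    ρ'.IsIrreducible ↔ ρ.IsIrreducible := by
  obtain ⟨e, he⟩ := hρ
  exact ((twistSubrep hφ e he).isSimpleOrder_iff).symm

lemma IsTwistOf.isSmoothVec [TopologicalSpace G] [TopologicalSpace G']
    (hn : ∀ p : G → Prop, (∀ᶠ g in nhds (1 : G'), p (φ g)) ↔ ∀ᶠ g in nhds 1, p g)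
    (hχ : ∀ᶠ g in nhds (1 : G'), χ g = 1) (e : V ≃ₗ[ℂ] V')
    (he : ∀ g v, ρ' g (e v) = χ g • e (ρ (φ g) v)) (v : V) :
    IsSmoothVec ρ' (e v) ↔ IsSmoothVec ρ v := by
  unfold IsSmoothVec
  rw [← hn fun g => ρ g v = v]
  refine Filter.eventually_congr ?_
  filter_upwards [hχ] with g hg
  rw [he, hg, one_smul, e.injective.eq_iff]

lemma IsTwistOf.isSmoothRep [TopologicalSpace G] [TopologicalSpace G']
    (hn : ∀ p : G → Prop, (∀ᶠ g in nhds (1 : G'), p (φ g)) ↔ ∀ᶠ g in nhds 1, p g)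
    (hχ : ∀ᶠ g in nhds (1 : G'), χ g = 1) (h : IsTwistOf φ χ ρ ρ') :
    IsSmoothRep ρ' ↔ IsSmoothRep ρ := by
  obtain ⟨e, he⟩ := h
  refine e.surjective.forall.trans (forall_congr' fun v => ?_)
  exact IsTwistOf.isSmoothVec hn hχ e he v

lemma IsTwistOf.smoothPart [TopologicalSpace G] [TopologicalSpace G']
    (hc : ∀ g : G, Continuous fun x : G => g * x * g⁻¹)
    (hc' : ∀ g : G', Continuous fun x : G' => g * x * g⁻¹)
    (hn : ∀ p : G → Prop, (∀ᶠ g in nhds (1 : G'), p (φ g)) ↔ ∀ᶠ g in nhds 1, p g)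
    (hχ : ∀ᶠ g in nhds (1 : G'), χ g = 1) (h : IsTwistOf φ χ ρ ρ') :
    IsTwistOf φ χ (smoothPart hc ρ).toRepresentation (smoothPart hc' ρ').toRepresentation := by
  obtain ⟨e, he⟩ := h
  refine ⟨e.ofSubmodules _ _ ?_, fun g v => Subtype.ext (he g v)⟩
  ext v
  obtain ⟨v, rfl⟩ := e.surjective v
  have key := IsTwistOf.isSmoothVec hn hχ e he v
  exact ⟨fun ⟨w, hw, h⟩ => key.mpr (e.injective h ▸ hw), fun h => ⟨v, key.mp h, rfl⟩⟩

/-- The dual of the twist by `χ` is the twist by `χ⁻¹` of the dual. -/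
lemma IsTwistOf.dual (h : IsTwistOf φ χ ρ ρ') :
    ∃ e : Module.Dual ℂ V ≃ₗ[ℂ] Module.Dual ℂ V',
      ∀ g f, ρ'.dual g (e f) = (χ g)⁻¹ • e (ρ.dual (φ g) f) := by
  obtain ⟨e, he⟩ := h
  refine ⟨e.symm.dualMap, fun g f => LinearMap.ext fun w => ?_⟩
  obtain ⟨v, rfl⟩ := e.surjective w
  simp [Representation.dual_apply, Module.Dual.transpose_apply, he]

lemma IsTwistOf.extTensor {τ : Representation ℂ H W} {τ' : Representation ℂ H' W'}
    (h : IsTwistOf φ χ ρ ρ') (h' : IsTwistOf φ₁ χ₁ τ τ') :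
    IsTwistOf (φ.prodMap φ₁) (χ.coprod χ₁) (extTensor ρ τ) (extTensor ρ' τ') := by
  obtain ⟨e, he⟩ := h
  obtain ⟨d, hd⟩ := h'
  refine ⟨TensorProduct.congr e d, fun g v => ?_⟩
  induction v with
  | zero => simp
  | add x y hx hy => rw [map_add, map_add, hx, hy, map_add, map_add, smul_add]
  | tmul x y =>
    simp only [Metaplectic.extTensor, MonoidHom.coe_mk, OneHom.coe_mk, TensorProduct.congr_tmul,
      TensorProduct.map_tmul, he, hd, MonoidHom.coprod_apply, MonoidHom.prodMap,
      MonoidHom.prod_apply, MonoidHom.comp_apply, MonoidHom.coe_fst, MonoidHom.coe_snd]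
    rw [TensorProduct.smul_tmul_smul]

lemma IsTwistOf.twist {β : G →* ℂ} {β' χ' : G' →* ℂ} (h : IsTwistOf φ χ ρ ρ')
    (hβ : ∀ g, β' g * χ g = χ' g * β (φ g)) :
    IsTwistOf φ χ' (twist β ρ) (twist β' ρ') := by
  obtain ⟨e, he⟩ := h
  refine ⟨e, fun g v => ?_⟩
  change β' g • ρ' g (e v) = χ' g • e (β (φ g) • ρ (φ g) v)
  rw [he, map_smul, smul_smul, smul_smul, hβ]

end Twist

/-! ### Twisting a tower of groups -/

section Tower

variable {F : Type u} [Field F]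

/-- The data by which the representations of the groups `T' n` of a tower, with the prescribed
action of the central elements `z`, are the twists by characters `χ n` of the representations of
the groups `T n`, pulled back along epimorphisms `φ n`. The epimorphisms are local homeomorphisms,
as far as neighbourhoods of `1` are concerned, and compatible with parabolic subgroups; the
characters are locally trivial, multiplicative on Levi subgroups and trivial on unipotent radicals.
The kernel of `φ n` is `{1, z n}`, and it comes from the first factor of each Levi subgroup. -/
structure TowerTwist (T T' : GLTower F) where
  φ : ∀ n, T'.G n →* T.G n
  χ : ∀ n, T'.G n →* ℂ
  surjective : ∀ n, Function.Surjective (φ n)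
  eventually_iff : ∀ n (p : T.G n → Prop),
    (∀ᶠ g in nhds (1 : T'.G n), p (φ n g)) ↔ ∀ᶠ g in nhds (1 : T.G n), p g
  eventually_χ : ∀ n, ∀ᶠ g in nhds (1 : T'.G n), χ n g = 1
  proj : ∀ n g, T'.proj n g = T.proj n (φ n g)
  levi : ∀ {k l n : ℕ} (h : k + l = n) (x : T'.G k × T'.G l),
    φ n (T'.levi h x) = T.levi h (φ k x.1, φ l x.2)
  χ_levi : ∀ {k l n : ℕ} (h : k + l = n) (x : T'.G k × T'.G l),
    χ n (T'.levi h x) = χ k x.1 * χ l x.2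
  unip : ∀ {k l n : ℕ} (h : k + l = n) (X : Matrix (Fin k) (Fin l) F),
    φ n (T'.unip h X) = T.unip h X
  χ_unip : ∀ {k l n : ℕ} (h : k + l = n) (X : Matrix (Fin k) (Fin l) F), χ n (T'.unip h X) = 1
  unip_zero : ∀ {k l n : ℕ} (h : k + l = n), T'.unip h (0 : Matrix (Fin k) (Fin l) F) = 1
  exists_levi : ∀ {k l n : ℕ} (h : k + l = n) (g : T'.G n), φ n g = 1 →
    ∃ c, φ k c = 1 ∧ g = T'.levi h (c, 1)
  z_eq_one : ∀ n, T.z n = 1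
  s_eq_one : T.s = 1
  φ_z : ∀ n, φ n (T'.z n) = 1
  χ_z : ∀ n, χ n (T'.z n) = ((T'.s : ℤ) : ℂ)
  eq_z : ∀ n g, φ n g = 1 → g = 1 ∨ g = T'.z n

namespace TowerTwist

variable {T T' : GLTower F} (Θ : TowerTwist T T')

/-- `ρ'` is isomorphic to the twist of `ρ`. -/
abbrev Rel {n : ℕ} {V V' : Type u} [AddCommMonoid V] [Module ℂ V]
    [AddCommMonoid V'] [Module ℂ V'] (ρ : Representation ℂ (T.G n) V)
    (ρ' : Representation ℂ (T'.G n) V') : Prop :=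
  IsTwistOf (Θ.φ n) (Θ.χ n) ρ ρ'

/-- `ρ'` is isomorphic to the twist of `ρ`, for representations of `G k × G l`. -/
abbrev RelProd {k l : ℕ} {V V' : Type u} [AddCommMonoid V] [Module ℂ V] [AddCommMonoid V']
    [Module ℂ V'] (ρ : Representation ℂ (T.G k × T.G l) V)
    (ρ' : Representation ℂ (T'.G k × T'.G l) V') : Prop :=
  IsTwistOf ((Θ.φ k).prodMap (Θ.φ l)) ((Θ.χ k).coprod (Θ.χ l)) ρ ρ'

lemma surjective_prodMap (k l : ℕ) : Function.Surjective ((Θ.φ k).prodMap (Θ.φ l)) :=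
  (Θ.surjective k).prodMap (Θ.surjective l)

section Functors

variable [ValuativeRel F] [TopologicalSpace F] [IsNonarchimedeanLocalField F]
  {k l n : ℕ} {V V' W W' : Type u} [AddCommGroup V] [Module ℂ V] [AddCommGroup V'] [Module ℂ V']
  [AddCommGroup W] [Module ℂ W] [AddCommGroup W'] [Module ℂ W']

lemma towerSqrtMod_eq (m : T'.G k × T'.G l) :
    towerSqrtMod T' k l m = towerSqrtMod T k l (Θ.φ k m.1, Θ.φ l m.2) := by
  change sqrtMod k l (T'.proj k m.1, T'.proj l m.2) = sqrtMod k l (T.proj k _, T.proj l _)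
  rw [Θ.proj, Θ.proj]
  rfl

/-- Jacquet modules commute with twisting, as `χ n` is trivial on the unipotent radical. -/
theorem jacquet (h : k + l = n) {ρ : Representation ℂ (T.G n) V}
    {ρ' : Representation ℂ (T'.G n) V'} (hρ : Θ.Rel ρ ρ') :
    Θ.RelProd (jacquet h ρ) (jacquet h ρ') := by
  refine IsTwistOf.twist (χ := (Θ.χ k).coprod (Θ.χ l)) ?_ fun m => ?_
  · obtain ⟨e, he⟩ := hρ
    have hu : ∀ X v, ρ' (T'.unip h X) (e v) - e v = e (ρ (T.unip h X) v - v) := fun X v => by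
      rw [he, Θ.χ_unip, one_smul, Θ.unip, map_sub]
    have hk : (jacquetKer h ρ).map e.toLinearMap = jacquetKer h ρ' := by
      rw [jacquetKer, jacquetKer, Submodule.map_span]
      congr 1
      ext w
      constructor
      · rintro ⟨_, ⟨X, v, rfl⟩, rfl⟩
        exact ⟨X, e v, (hu X v).symm⟩
      · rintro ⟨X, v, rfl⟩
        obtain ⟨v, rfl⟩ := e.surjective v
        exact ⟨_, ⟨X, v, rfl⟩, (hu X v).symm⟩
    refine ⟨Submodule.Quotient.equiv _ _ e hk, fun m v => ?_⟩
    obtain ⟨v, rfl⟩ := Submodule.Quotient.mk_surjective _ v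
    change Submodule.Quotient.mk (ρ' (T'.levi h m) (e v)) =
      (Θ.χ k m.1 * Θ.χ l m.2) • Submodule.Quotient.mk (e (ρ (T.levi h (Θ.φ k m.1, Θ.φ l m.2)) v))
    rw [he, Θ.χ_levi, Θ.levi, Submodule.Quotient.mk_smul]
  · change (towerSqrtMod T' k l m)⁻¹ * _ = _ * (towerSqrtMod T k l _)⁻¹
    rw [Θ.towerSqrtMod_eq, mul_comm]
    rfl

/-- The contragredient of a twist by `χ` is a twist by `χ⁻¹`, which `α' = χ² α` turns into a twist
by `χ`. -/
theorem contragredient {α : ∀ n, T.G n →* ℂ} {α' : ∀ n, T'.G n →* ℂ}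
    (hα : ∀ n g, α' n g = Θ.χ n g ^ 2 * α n (Θ.φ n g)) {ρ : Representation ℂ (T.G n) V}
    {ρ' : Representation ℂ (T'.G n) V'} (hρ : Θ.Rel ρ ρ') :
    Θ.Rel (twist (α n) (contragredient ρ)) (twist (α' n) (contragredient ρ')) := by
  let χ' : T'.G n →* ℂ :=
    { toFun := fun g => (Θ.χ n g)⁻¹
      map_one' := by simp
      map_mul' := fun x y => by rw [map_mul, mul_inv] }
  have hd : IsTwistOf (Θ.φ n) χ' ρ.dual ρ'.dual := hρ.dual
  have hχ' : ∀ᶠ g in nhds (1 : T'.G n), χ' g = 1 := by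
    filter_upwards [Θ.eventually_χ n] with g hg
    change (Θ.χ n g)⁻¹ = 1
    rw [hg, inv_one]
  refine IsTwistOf.twist (hd.smoothPart (T.continuous_conj n) (T'.continuous_conj n)
    (Θ.eventually_iff n) hχ') fun g => ?_
  change α' n g * (Θ.χ n g)⁻¹ = _
  rw [hα]
  field_simp [char_ne_zero (Θ.χ n) g]

/-- The function `χ f` on `T' n` descends to `T n` when `f` is in a space of parabolic
induction, because the kernel of `φ n` lies in the Levi subgroup. -/
theorem indFull (h : k + l = n) {τ : Representation ℂ (T.G k × T.G l) V}
    {τ' : Representation ℂ (T'.G k × T'.G l) V'} (hτ : Θ.RelProd τ τ') :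
    Θ.Rel (indFull h τ) (indFull h τ') := by
  obtain ⟨e, he⟩ := hτ
  replace he : ∀ (m : T'.G k × T'.G l) v, τ' m (e v) =
    (Θ.χ k m.1 * Θ.χ l m.2) • e (τ (Θ.φ k m.1, Θ.φ l m.2) v) := he
  have hsec : ∀ g, Θ.φ n (Function.surjInv (Θ.surjective n) g) = g :=
    Function.surjInv_eq (Θ.surjective n)
  have hmem : ∀ f : T.G n → V,
      (∀ m X g, f (T.levi h m * T.unip h X * g) = towerSqrtMod T k l m • τ m (f g)) →
      ∀ m X g, Θ.χ n (T'.levi h m * T'.unip h X * g) •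
        e (f (Θ.φ n (T'.levi h m * T'.unip h X * g))) =
        towerSqrtMod T' k l m • τ' m (Θ.χ n g • e (f (Θ.φ n g))) := by
    intro f hf m X g
    simp only [map_mul, Θ.levi, Θ.unip, Θ.χ_levi, Θ.χ_unip, hf, map_smul, he,
      Θ.towerSqrtMod_eq, mul_one, smul_smul]
    congr 1
    ring
  refine ⟨LinearEquiv.ofBijective
    { toFun := fun f => ⟨fun g => Θ.χ n g • e (f.1 (Θ.φ n g)), hmem f.1 f.2⟩
      map_add' := ?_
      map_smul' := ?_ } ⟨?_, ?_⟩, ?_⟩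
  · intro f f'
    ext g
    simp
  · intro c f
    ext g
    simp [smul_comm c]
  · intro f f' hff
    ext g
    obtain ⟨g, rfl⟩ := Θ.surjective n g
    have := congrFun (congrArg Subtype.val hff) g
    exact e.injective (smul_right_injective _ (char_ne_zero (Θ.χ n) g) this)
  · intro f'
    -- `χ⁻¹ f'` is constant on the fibres of `φ n`
    have hc : ∀ g g', Θ.φ n g = Θ.φ n g' →
        (Θ.χ n g)⁻¹ • e.symm (f'.1 g) = (Θ.χ n g')⁻¹ • e.symm (f'.1 g') := by
      intro g g' hgg
      obtain ⟨c, hc, hcg⟩ := Θ.exists_levi h (g * g'⁻¹)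
        (by rw [map_mul, map_inv, hgg, mul_inv_cancel])
      rw [mul_inv_eq_iff_eq_mul] at hcg
      have hf := f'.2 (c, 1) 0 g'
      obtain ⟨w, hw⟩ := e.surjective (f'.1 g')
      rw [Θ.unip_zero, mul_one, ← hcg, ← hw, he, Θ.towerSqrtMod_eq] at hf
      simp only [hc, map_one] at hf
      rw [← Prod.one_eq_mk, map_one, map_one] at hf
      rw [hf, ← hw, hcg, map_mul, Θ.χ_levi]
      have h1 := char_ne_zero (Θ.χ k) c
      have h2 := char_ne_zero (Θ.χ n) g'
      simp only [map_one, mul_one, map_smul, Module.End.one_apply, e.symm_apply_apply,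
        smul_smul]
      congr 1
      field_simp
    refine ⟨⟨fun g => (Θ.χ n (Function.surjInv (Θ.surjective n) g))⁻¹ •
      e.symm (f'.1 (Function.surjInv (Θ.surjective n) g)), ?_⟩, ?_⟩
    · intro m X g
      obtain ⟨m₁, hm₁⟩ := Θ.surjective k m.1
      obtain ⟨m₂, hm₂⟩ := Θ.surjective l m.2
      obtain ⟨g, rfl⟩ := Θ.surjective n g
      have hm : m = (Θ.φ k m₁, Θ.φ l m₂) := by rw [hm₁, hm₂]
      subst hm
      beta_reduce
      rw [hc _ g (hsec _), hc _ (T'.levi h (m₁, m₂) * T'.unip h X * g) (by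
        rw [hsec, map_mul, map_mul, Θ.levi, Θ.unip]), f'.2]
      obtain ⟨w, hw⟩ := e.surjective (f'.1 g)
      rw [← hw, he, Θ.towerSqrtMod_eq]
      simp only [map_mul, Θ.χ_levi, Θ.χ_unip, map_smul, e.symm_apply_apply, smul_smul, mul_one]
      have h1 := char_ne_zero (Θ.χ k) m₁
      have h2 := char_ne_zero (Θ.χ l) m₂
      have h3 := char_ne_zero (Θ.χ n) g
      congr 1
      field_simp
    · ext g
      change Θ.χ n g • e ((Θ.χ n (Function.surjInv _ (Θ.φ n g)))⁻¹ • e.symm (f'.1 _)) = f'.1 g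
      rw [hc _ g (hsec _), map_smul, e.apply_symm_apply, smul_inv_smul₀ (char_ne_zero _ g)]
  · intro g f
    ext x
    change Θ.χ n (x * g) • e (f.1 (Θ.φ n (x * g))) = Θ.χ n g • Θ.χ n x • e (f.1 (Θ.φ n x * Θ.φ n g))
    rw [map_mul, map_mul, smul_smul, mul_comm]

/-- Parabolic induction commutes with twisting. -/
theorem ind (h : k + l = n) {ρ : Representation ℂ (T.G k) V} {ρ' : Representation ℂ (T'.G k) V'}
    {σ : Representation ℂ (T.G l) W} {σ' : Representation ℂ (T'.G l) W'} (hρ : Θ.Rel ρ ρ')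
    (hσ : Θ.Rel σ σ') : Θ.Rel (ind h ρ σ) (ind h ρ' σ') :=
  IsTwistOf.smoothPart (T.continuous_conj n) (T'.continuous_conj n) (Θ.eventually_iff n)
    (Θ.eventually_χ n) (Θ.indFull h (IsTwistOf.extTensor hρ hσ))

end Functors

end TowerTwist

end Tower

/-! ### Twisting Grothendieck groups -/

section Grothendieck

variable {F : Type u} [Field F]

section Equiv

variable {G G' V W V' W' : Type*} [Group G] [Group G'] [AddCommGroup V] [Module ℂ V]
  [AddCommGroup W] [Module ℂ W] [AddCommGroup V'] [Module ℂ V'] [AddCommGroup W'] [Module ℂ W']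
  {φ : G' →* G} {χ : G' →* ℂ} {ρ : Representation ℂ G V} {σ : Representation ℂ G W}
  {ρ' : Representation ℂ G' V'} {σ' : Representation ℂ G' W'}

lemma IsTwistOf.trans_equiv (h : IsTwistOf φ χ ρ ρ') (f : Representation.Equiv ρ' σ') :
    IsTwistOf φ χ ρ σ' := by
  obtain ⟨e, he⟩ := h
  refine ⟨e.trans f.toLinearEquiv, fun g v => ?_⟩
  have hf := LinearMap.congr_fun (f.isIntertwining' g) (e v)
  change f.toLinearEquiv (ρ' g (e v)) = σ' g (f.toLinearEquiv (e v)) at hf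
  rw [LinearEquiv.trans_apply, ← hf, he, map_smul, LinearEquiv.trans_apply]

lemma IsTwistOf.equiv_trans (h : IsTwistOf φ χ ρ ρ') (f : Representation.Equiv σ ρ) :
    IsTwistOf φ χ σ ρ' := by
  obtain ⟨e, he⟩ := h
  refine ⟨f.toLinearEquiv.trans e, fun g v => ?_⟩
  have hf := LinearMap.congr_fun (f.isIntertwining' (φ g)) v
  change f.toLinearEquiv (σ (φ g) v) = ρ (φ g) (f.toLinearEquiv v) at hf
  rw [LinearEquiv.trans_apply, he, ← hf, LinearEquiv.trans_apply]

lemma IsTwistOf.equiv_right (h : IsTwistOf φ χ ρ ρ') (h' : IsTwistOf φ χ ρ σ') :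
    Nonempty (Representation.Equiv ρ' σ') := by
  obtain ⟨e, he⟩ := h
  obtain ⟨d, hd⟩ := h'
  refine ⟨Representation.Equiv.mk (e.symm.trans d) fun g => LinearMap.ext fun v => ?_⟩
  obtain ⟨v, rfl⟩ := e.surjective v
  change d (e.symm (ρ' g (e v))) = σ' g (d (e.symm (e v)))
  rw [he, e.symm_apply_apply, hd, map_smul, map_smul, e.symm_apply_apply]

lemma IsTwistOf.equiv_left (hφ : Function.Surjective φ) (h : IsTwistOf φ χ ρ ρ')
    (h' : IsTwistOf φ χ σ ρ') : Nonempty (Representation.Equiv ρ σ) := by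
  obtain ⟨e, he⟩ := h
  obtain ⟨d, hd⟩ := h'
  refine ⟨Representation.Equiv.mk (e.trans d.symm) fun g => LinearMap.ext fun v => ?_⟩
  obtain ⟨g, rfl⟩ := hφ g
  change d.symm (e (ρ (φ g) v)) = σ (φ g) (d.symm (e v))
  rw [d.symm_apply_eq]
  refine smul_right_injective _ (char_ne_zero χ g) ?_
  change χ g • _ = χ g • _
  rw [← he, ← hd, d.apply_symm_apply]

end Equiv

namespace TowerTwist

variable {T T' : GLTower F} (Θ : TowerTwist T T')

/-- The twist of an irreducible representation. -/
def irr {n : ℕ} (π : IrrRep T n) : IrrRep T' n where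
  V := π.V
  ρ := twist (Θ.χ n) (π.ρ.comp (Θ.φ n))
  irreducible := (IsTwistOf.isIrreducible (Θ.surjective n)
    ⟨LinearEquiv.refl ℂ π.V, fun _ _ => rfl⟩).mpr π.irreducible
  smooth := (IsTwistOf.isSmoothRep (Θ.eventually_iff n) (Θ.eventually_χ n)
    ⟨LinearEquiv.refl ℂ π.V, fun _ _ => rfl⟩).mpr π.smooth
  central v := by
    change Θ.χ n (T'.z n) • π.ρ (Θ.φ n (T'.z n)) v = _
    rw [Θ.φ_z, map_one, Θ.χ_z, Module.End.one_apply]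

lemma rel_irr {n : ℕ} (π : IrrRep T n) : Θ.Rel π.ρ (Θ.irr π).ρ :=
  ⟨LinearEquiv.refl ℂ π.V, fun _ _ => rfl⟩

/-- Every irreducible representation for the second tower is a twist. -/
lemma exists_rel_irrRep {n : ℕ} (π' : IrrRep T' n) :
    ∃ π : IrrRep T n, Θ.Rel π.ρ π'.ρ := by
  -- the twist of `π'` by `χ⁻¹` is trivial on the kernel of `φ n`, which is `{1, z n}`
  let s := Function.surjInv (Θ.surjective n)
  have hs : ∀ g, Θ.φ n (s g) = g := Function.surjInv_eq (Θ.surjective n)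
  have hc : ∀ g g', Θ.φ n g = Θ.φ n g' →
      (Θ.χ n g)⁻¹ • π'.ρ g = (Θ.χ n g')⁻¹ • π'.ρ g' := by
    intro g g' h
    obtain ⟨k, rfl⟩ : ∃ k, g = g' * k := ⟨g'⁻¹ * g, by group⟩
    have hk : Θ.φ n k = 1 := by simpa using h
    have hkv : π'.ρ k = Θ.χ n k • 1 := by
      rcases Θ.eq_z n k hk with rfl | rfl
      · simp
      · exact LinearMap.ext fun v => by rw [π'.central, Θ.χ_z]; rfl
    have h1 := char_ne_zero (Θ.χ n) k
    have h2 := char_ne_zero (Θ.χ n) g'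
    rw [map_mul, map_mul, hkv, mul_smul_comm, mul_one, smul_smul]
    congr 1
    field_simp
  let ρ : Representation ℂ (T.G n) π'.V :=
    { toFun := fun g => (Θ.χ n (s g))⁻¹ • π'.ρ (s g)
      map_one' := by
        rw [hc (s 1) 1 (by rw [hs, map_one])]
        simp
      map_mul' := fun x y => by
        rw [hc (s (x * y)) (s x * s y) (by rw [hs, map_mul, hs, hs]), map_mul, map_mul,
          mul_inv, smul_mul_smul_comm] }
  have hρ : ∀ g, ρ (Θ.φ n g) = (Θ.χ n g)⁻¹ • π'.ρ g := fun g => hc _ _ (hs _)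
  have hrel : Θ.Rel ρ π'.ρ := ⟨LinearEquiv.refl ℂ π'.V, fun g v => by
    rw [hρ]
    exact (smul_inv_smul₀ (char_ne_zero (Θ.χ n) g) (π'.ρ g v)).symm⟩
  refine ⟨⟨π'.V, ρ, (hrel.isIrreducible (Θ.surjective n)).mp π'.irreducible,
    (hrel.isSmoothRep (Θ.eventually_iff n) (Θ.eventually_χ n)).mp π'.smooth, fun v => ?_⟩, hrel⟩
  simp [Θ.z_eq_one, Θ.s_eq_one]

/-- The twist of a class of irreducible representations. -/
def irrClass {n : ℕ} (c : IrrClass T n) : IrrClass T' n :=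
  Quotient.mk (irrSetoid T' n) (Θ.irr c.rep)

lemma rep_mk {n : ℕ} (π : IrrRep T n) :
    Nonempty (Representation.Equiv (IrrClass.rep (Quotient.mk (irrSetoid T n) π)).ρ π.ρ) :=
  Quotient.mk_out (s := irrSetoid T n) π

lemma eq_of_rep {n : ℕ} {c d : IrrClass T n} (h : Nonempty (Representation.Equiv c.rep.ρ d.rep.ρ)) :
    c = d :=
  Quotient.out_equiv_out.mp h

lemma rel_irrClass {n : ℕ} (c : IrrClass T n) : Θ.Rel c.rep.ρ (Θ.irrClass c).rep.ρ :=
  have ⟨f⟩ := rep_mk (Θ.irr c.rep)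
  (Θ.rel_irr c.rep).trans_equiv f.symm

/-- Twisting is a bijection on the classes of irreducible representations. -/
def irrEquiv (n : ℕ) : IrrClass T n ≃ IrrClass T' n :=
  Equiv.ofBijective Θ.irrClass
    ⟨fun c d h => eq_of_rep <|
      IsTwistOf.equiv_left (Θ.surjective n) (Θ.rel_irrClass c) (h ▸ Θ.rel_irrClass d),
    fun c' => by
      obtain ⟨π, hπ⟩ := Θ.exists_rel_irrRep c'.rep
      obtain ⟨f⟩ := rep_mk π
      exact ⟨_, eq_of_rep (IsTwistOf.equiv_right (Θ.rel_irrClass _) (hπ.equiv_trans f))⟩⟩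

/-- The isomorphism of Grothendieck groups given by twisting. -/
def mapR : R T ≃ₗ[ℤ] R T' :=
  Finsupp.domLCongr (Equiv.sigmaCongrRight Θ.irrEquiv)

lemma mapR_single (a : Σ n, IrrClass T n) (x : ℤ) :
    Θ.mapR (Finsupp.single a x) = Finsupp.single ⟨a.1, Θ.irrClass a.2⟩ x :=
  Finsupp.domLCongr_single _ _ _

lemma mapR_basis {n : ℕ} (c : IrrClass T n) : Θ.mapR c.basis = (Θ.irrClass c).basis :=
  Θ.mapR_single ⟨n, c⟩ 1

variable {k l n : ℕ} {V V' : Type u} [AddCommGroup V] [Module ℂ V] [AddCommGroup V'] [Module ℂ V']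

/-- Semisimplification commutes with twisting; the finite sums that define it need no
restriction on the representation, as the bijection of classes carries one to the other. -/
theorem mapR_cls {ρ : Representation ℂ (T.G n) V} {ρ' : Representation ℂ (T'.G n) V'}
    (h : Θ.Rel ρ ρ') : Θ.mapR (cls ρ) = cls ρ' := by
  unfold cls
  refine (AddEquiv.map_finsum Θ.mapR.toAddEquiv _).trans ?_
  rw [← finsum_comp_equiv (Θ.irrEquiv n)]
  refine finsum_congr fun c => ?_
  change Θ.mapR (_ • c.basis) = (jhMult ρ' (Θ.irrClass c).rep.ρ : ℤ) • (Θ.irrClass c).basis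
  rw [map_smul, mapR_basis, h.jhMult_eq (Θ.surjective n) (Θ.rel_irrClass c)]

theorem mapR_clsProd {ρ : Representation ℂ (T.G k × T.G l) V}
    {ρ' : Representation ℂ (T'.G k × T'.G l) V'} (h : Θ.RelProd ρ ρ') :
    TensorProduct.map Θ.mapR.toLinearMap Θ.mapR.toLinearMap (clsProd ρ) = clsProd ρ' := by
  unfold clsProd
  refine (AddEquiv.map_finsum (TensorProduct.congr Θ.mapR Θ.mapR).toAddEquiv _).trans ?_
  rw [← finsum_comp_equiv ((Θ.irrEquiv k).prodCongr (Θ.irrEquiv l))]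
  refine finsum_congr fun c => ?_
  change TensorProduct.congr Θ.mapR Θ.mapR ((_ : ℤ) • (c.1.basis ⊗ₜ[ℤ] c.2.basis)) =
    (jhMult ρ' (extTensor (Θ.irrClass c.1).rep.ρ (Θ.irrClass c.2).rep.ρ) : ℤ) •
      ((Θ.irrClass c.1).basis ⊗ₜ[ℤ] (Θ.irrClass c.2).basis)
  rw [map_smul, TensorProduct.congr_tmul, mapR_basis, mapR_basis,
    h.jhMult_eq (Θ.surjective_prodMap k l)
      ((Θ.rel_irrClass c.1).extTensor (Θ.rel_irrClass c.2))]

section Hopf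

variable [ValuativeRel F] [TopologicalSpace F] [IsNonarchimedeanLocalField F]

lemma addHom_ext_basis {M : Type*} [AddCommGroup M] {f g : R T →+ M}
    (h : ∀ n (c : IrrClass T n), f c.basis = g c.basis) : f = g :=
  Finsupp.addHom_ext' fun a => AddMonoidHom.ext_int (h a.1 a.2)

/-- The space of the representation induced from a pair of irreducible representations. -/
abbrev IndSpace (c : IrrClass T k) (d : IrrClass T l) : Type u :=
  (smoothPart (T.continuous_conj (k + l))
    (Metaplectic.indFull rfl (extTensor c.rep.ρ d.rep.ρ))).toSubmodule

lemma mulMap_basis (c : IrrClass T k) (d : IrrClass T l) :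
    mulMap T (c.basis ⊗ₜ[ℤ] d.basis) =
      cls (V := IndSpace c d) (Metaplectic.ind rfl c.rep.ρ d.rep.ρ) := by
  refine (TensorProduct.lift.tmul _ _).trans ?_
  refine (LinearMap.congr_fun (Finsupp.linearCombination_single ℤ (1 : ℤ)
    (⟨k, c⟩ : Σ n, IrrClass T n)) d.basis).trans ?_
  refine (LinearMap.congr_fun (one_smul ℤ _) d.basis).trans ?_
  exact (Finsupp.linearCombination_single ℤ (1 : ℤ) (⟨l, d⟩ : Σ n, IrrClass T n)).trans
    (one_smul ℤ _)

lemma comulMap_basis (c : IrrClass T n) : comulMap T c.basis =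
    ∑ p ∈ (Finset.HasAntidiagonal.antidiagonal n).attach,
      clsProd (Metaplectic.jacquet (Finset.HasAntidiagonal.mem_antidiagonal.mp p.2) c.rep.ρ) :=
  (Finsupp.linearCombination_single ℤ (1 : ℤ) (⟨n, c⟩ : Σ n, IrrClass T n)).trans
    (one_smul ℤ _)

lemma contraMap_basis (α : ∀ n, T.G n →* ℂ) (c : IrrClass T n) : contraMap T α c.basis =
    cls (twist (α n) (Metaplectic.contragredient c.rep.ρ)) :=
  (Finsupp.linearCombination_single ℤ (1 : ℤ) (⟨n, c⟩ : Σ n, IrrClass T n)).trans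
    (one_smul ℤ _)

theorem mapR_mulMap (x y : R T) :
    Θ.mapR (mulMap T (x ⊗ₜ[ℤ] y)) = mulMap T' (Θ.mapR x ⊗ₜ[ℤ] Θ.mapR y) := by
  have hx : ∀ {k} (c : IrrClass T k) (y : R T), Θ.mapR (mulMap T (c.basis ⊗ₜ[ℤ] y)) =
      mulMap T' (Θ.mapR c.basis ⊗ₜ[ℤ] Θ.mapR y) := fun {k} c y => by
    have := addHom_ext_basis (T := T)
      (f := Θ.mapR.toAddEquiv.toAddMonoidHom.comp ((mulMap T).toAddMonoidHom.comp
        (TensorProduct.mk ℤ (R T) (R T) c.basis).toAddMonoidHom))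
      (g := (mulMap T').toAddMonoidHom.comp
        ((TensorProduct.mk ℤ (R T') (R T') (Θ.mapR c.basis)).toAddMonoidHom.comp
          Θ.mapR.toAddEquiv.toAddMonoidHom)) fun l d => by
      change Θ.mapR (mulMap T (c.basis ⊗ₜ[ℤ] d.basis)) =
        mulMap T' (Θ.mapR c.basis ⊗ₜ[ℤ] Θ.mapR d.basis)
      rw [mulMap_basis, mapR_basis, mapR_basis, mulMap_basis]
      exact Θ.mapR_cls (V := IndSpace c d) (V' := IndSpace (Θ.irrClass c) (Θ.irrClass d))
        (Θ.ind rfl (Θ.rel_irrClass c) (Θ.rel_irrClass d))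
    exact DFunLike.congr_fun this y
  have := addHom_ext_basis (T := T)
    (f := Θ.mapR.toAddEquiv.toAddMonoidHom.comp ((mulMap T).toAddMonoidHom.comp
      ((TensorProduct.mk ℤ (R T) (R T)).flip y).toAddMonoidHom))
    (g := (mulMap T').toAddMonoidHom.comp
      (((TensorProduct.mk ℤ (R T') (R T')).flip (Θ.mapR y)).toAddMonoidHom.comp
        Θ.mapR.toAddEquiv.toAddMonoidHom)) fun k c => hx c y
  exact DFunLike.congr_fun this x

theorem mapR_comulMap (x : R T) :
    TensorProduct.map Θ.mapR.toLinearMap Θ.mapR.toLinearMap (comulMap T x) =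
      comulMap T' (Θ.mapR x) := by
  have := addHom_ext_basis (T := T)
    (f := (TensorProduct.map Θ.mapR.toLinearMap Θ.mapR.toLinearMap).toAddMonoidHom.comp
      (comulMap T).toAddMonoidHom)
    (g := (comulMap T').toAddMonoidHom.comp Θ.mapR.toAddEquiv.toAddMonoidHom) fun n c => by
    change TensorProduct.map Θ.mapR.toLinearMap Θ.mapR.toLinearMap (comulMap T c.basis) =
      comulMap T' (Θ.mapR c.basis)
    rw [comulMap_basis, mapR_basis, comulMap_basis, map_sum]
    exact Finset.sum_congr rfl fun p _ => Θ.mapR_clsProd (Θ.jacquet _ (Θ.rel_irrClass c))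
  exact DFunLike.congr_fun this x

variable {α : ∀ n, T.G n →* ℂ} {α' : ∀ n, T'.G n →* ℂ}

theorem mapR_contraMap (hα : ∀ n g, α' n g = Θ.χ n g ^ 2 * α n (Θ.φ n g)) (x : R T) :
    Θ.mapR (contraMap T α x) = contraMap T' α' (Θ.mapR x) := by
  have := addHom_ext_basis (T := T)
    (f := Θ.mapR.toAddEquiv.toAddMonoidHom.comp (contraMap T α).toAddMonoidHom)
    (g := (contraMap T' α').toAddMonoidHom.comp Θ.mapR.toAddEquiv.toAddMonoidHom) fun n c => by
    change Θ.mapR (contraMap T α c.basis) = contraMap T' α' (Θ.mapR c.basis)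
    rw [contraMap_basis, mapR_basis, contraMap_basis]
    exact Θ.mapR_cls (Θ.contragredient hα (Θ.rel_irrClass c))
  exact DFunLike.congr_fun this x

theorem mapR_MStar (hα : ∀ n g, α' n g = Θ.χ n g ^ 2 * α n (Θ.φ n g)) (x : R T) :
    TensorProduct.map Θ.mapR.toLinearMap Θ.mapR.toLinearMap (MStar T α x) =
      MStar T' α' (Θ.mapR x) := by
  -- the maps that follow the first comultiplication
  let A : R T ⊗[ℤ] R T →+ R T ⊗[ℤ] R T :=
    (TensorProduct.map (mulMap T) LinearMap.id).toAddMonoidHom.comp <|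
    (TensorProduct.assoc ℤ (R T) (R T) (R T)).symm.toLinearMap.toAddMonoidHom.comp <|
    (TensorProduct.map (contraMap T α) (comulMap T)).toAddMonoidHom.comp
    (TensorProduct.comm ℤ (R T) (R T)).toLinearMap.toAddMonoidHom
  let A' : R T' ⊗[ℤ] R T' →+ R T' ⊗[ℤ] R T' :=
    (TensorProduct.map (mulMap T') LinearMap.id).toAddMonoidHom.comp <|
    (TensorProduct.assoc ℤ (R T') (R T') (R T')).symm.toLinearMap.toAddMonoidHom.comp <|
    (TensorProduct.map (contraMap T' α') (comulMap T')).toAddMonoidHom.comp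
    (TensorProduct.comm ℤ (R T') (R T')).toLinearMap.toAddMonoidHom
  let B : R T ⊗[ℤ] R T →+ R T' ⊗[ℤ] R T' :=
    (TensorProduct.map Θ.mapR.toLinearMap Θ.mapR.toLinearMap).toAddMonoidHom
  have hA : ∀ t, B (A t) = A' (B t) := fun t => by
    induction t with
    | zero => simp only [map_zero]
    | add s t hs ht => rw [map_add, map_add, hs, ht, map_add, map_add]
    | tmul x y =>
      let C : R T ⊗[ℤ] R T →+ R T ⊗[ℤ] R T :=
        (TensorProduct.map (mulMap T) LinearMap.id).toAddMonoidHom.comp <|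
        (TensorProduct.assoc ℤ (R T) (R T) (R T)).symm.toLinearMap.toAddMonoidHom.comp
        (TensorProduct.mk ℤ (R T) (R T ⊗[ℤ] R T) (contraMap T α y)).toAddMonoidHom
      let C' : R T' ⊗[ℤ] R T' →+ R T' ⊗[ℤ] R T' :=
        (TensorProduct.map (mulMap T') LinearMap.id).toAddMonoidHom.comp <|
        (TensorProduct.assoc ℤ (R T') (R T') (R T')).symm.toLinearMap.toAddMonoidHom.comp
        (TensorProduct.mk ℤ (R T') (R T' ⊗[ℤ] R T') (contraMap T' α' (Θ.mapR y))).toAddMonoidHom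
      have hC : ∀ s, B (C s) = C' (B s) := fun s => by
        induction s with
        | zero => simp only [map_zero]
        | add s t hs ht => rw [map_add, map_add, hs, ht, map_add, map_add]
        | tmul u w =>
          change Θ.mapR (mulMap T (contraMap T α y ⊗ₜ[ℤ] u)) ⊗ₜ[ℤ] Θ.mapR w =
            mulMap T' (contraMap T' α' (Θ.mapR y) ⊗ₜ[ℤ] Θ.mapR u) ⊗ₜ[ℤ] Θ.mapR w
          rw [mapR_mulMap, Θ.mapR_contraMap hα]
      change B (C (comulMap T x)) = C' (comulMap T' (Θ.mapR x))
      rw [hC, ← mapR_comulMap]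
      rfl
  change B (A (comulMap T x)) = A' (comulMap T' (Θ.mapR x))
  rw [hA, ← mapR_comulMap]
  rfl

end Hopf

end TowerTwist

end Grothendieck

/-! ### The covering groups as twists of the linear groups -/

section Main

open Matrix.GeneralLinearGroup (det)

variable {F : Type u} [Field F]

lemma hilbertSymbol_neg_self (a : Fˣ) : hilbertSymbol a (-a) = 1 := by
  unfold hilbertSymbol
  rw [if_pos ⟨1, 1, 0, Or.inl one_ne_zero, by push_cast; ring⟩]

lemma HilbertBimult.self_eq (hH : HilbertBimult F) (a : Fˣ) :
    hilbertSymbol a a = hilbertSymbol a (-1) := by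
  have h := hH.right a (-1) (-a)
  rwa [hilbertSymbol_neg_self, mul_one, neg_one_mul, neg_neg] at h

variable [ValuativeRel F] [TopologicalSpace F] [IsNonarchimedeanLocalField F]
  {ψ : AddChar F Circle} {hH : HilbertBimult F}

lemma chiFun_eq {n : ℕ} (x : CoverGL hH n) :
    chiFun ψ hH x = ((x.sgn : ℤ) : ℂ) * weilRatio ψ ((det x.mat : Fˣ) : F) :=
  mul_assoc _ _ _

theorem isChiCharacter (h2 : (2 : F) ≠ 0) (hψ : Continuous ψ) (hψ1 : ψ ≠ 1)
    (hH : HilbertBimult F) : IsChiCharacter ψ hH := by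
  let _ : MeasurableSpace F := borel F
  have : BorelSpace F := ⟨rfl⟩
  refine fun n => ⟨?_, fun x y => ?_⟩
  · simp [chiFun_eq, weilRatio_one h2 hψ hψ1]
  · simp only [chiFun_eq, CoverGL.mul_mat, CoverGL.mul_sgn, map_mul, Units.val_mul,
      weilRatio_mul h2 hψ hψ1]
    have h : ((hilbertSymbol (det x.mat) (det y.mat) : ℤ) : ℂ) *
        ((hilbertSymbol (det x.mat) (det y.mat) : ℤ) : ℂ) = 1 := intUnits_cast_mul_self _
    push_cast
    linear_combination ((x.sgn : ℤ) : ℂ) * ((y.sgn : ℤ) : ℂ) *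
      weilRatio ψ ((det x.mat : Fˣ) : F) * weilRatio ψ ((det y.mat : Fˣ) : F) * h

lemma chiFun_levi (h2 : (2 : F) ≠ 0) (hψ : Continuous ψ) (hψ1 : ψ ≠ 1) {k l n : ℕ}
    (h : k + l = n) (x : CoverGL hH k × CoverGL hH l) :
    chiFun ψ hH (CoverGL.levi hH h x) = chiFun ψ hH x.1 * chiFun ψ hH x.2 := by
  let _ : MeasurableSpace F := borel F
  have : BorelSpace F := ⟨rfl⟩
  simp only [chiFun_eq, CoverGL.levi, MonoidHom.coe_mk, OneHom.coe_mk, det_glDiag,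
    Units.val_mul, weilRatio_mul h2 hψ hψ1]
  have h1 : ((hilbertSymbol (det x.1.mat) (det x.2.mat) : ℤ) : ℂ) *
      ((hilbertSymbol (det x.1.mat) (det x.2.mat) : ℤ) : ℂ) = 1 := intUnits_cast_mul_self _
  push_cast
  linear_combination ((x.1.sgn : ℤ) : ℂ) * ((x.2.sgn : ℤ) : ℂ) *
    weilRatio ψ ((det x.1.mat : Fˣ) : F) * weilRatio ψ ((det x.2.mat : Fˣ) : F) * h1

lemma continuous_mat_sgn (n : ℕ) :
    Continuous fun x : CoverGL hH n => (x.mat, x.sgn) :=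
  continuous_induced_dom

/-- The twists by `χ_ψ` carry the representations of the groups `GL(n, F)` to the genuine
representations of their covers. -/
def chiTowerTwist (h2 : (2 : F) ≠ 0) (hψ : Continuous ψ) (hψ1 : ψ ≠ 1)
    (hχ : IsChiCharacter ψ hH) : TowerTwist (linTower F) (coverTower hH) where
  φ n := CoverGL.proj hH n
  χ n := chi hχ n
  surjective n g := ⟨(⟨g, 1⟩ : CoverGL hH n), rfl⟩
  eventually_iff n p := by
    have h1 : Filter.Tendsto (fun x : CoverGL hH n => x.mat) (nhds 1) (nhds 1) :=
      (continuous_fst.comp (continuous_mat_sgn n)).tendsto 1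
    have h2 : Filter.Tendsto (fun g : GL (Fin n) F => (⟨g, 1⟩ : CoverGL hH n)) (nhds 1) (nhds 1) :=
      Continuous.tendsto (continuous_induced_rng.mpr (by fun_prop)) 1
    exact ⟨fun h => h2.eventually h, fun h => h1.eventually h⟩
  eventually_χ n := by
    let _ : MeasurableSpace F := borel F
    have : BorelSpace F := ⟨rfl⟩
    have h1 : Filter.Tendsto (fun x : CoverGL hH n => (x.mat : Matrix (Fin n) (Fin n) F).det)
        (nhds 1) (nhds 1) := by
      have hc : Continuous fun x : CoverGL hH n => (x.mat : Matrix (Fin n) (Fin n) F).det :=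
        (Units.continuous_val.comp (continuous_fst.comp (continuous_mat_sgn n))).matrix_det
      simpa using hc.tendsto 1
    have h3 : ∀ᶠ x in nhds (1 : CoverGL hH n), x.sgn = 1 := by
      have hc : Continuous fun x : CoverGL hH n => ((x.sgn : ℤˣ) : ℤ) :=
        Units.continuous_val.comp (continuous_snd.comp (continuous_mat_sgn n))
      filter_upwards [((isOpen_discrete {(1 : ℤ)}).preimage hc).mem_nhds rfl] with x hx
      exact Units.ext hx
    filter_upwards [h1.eventually (eventually_weilRatio_eq_one h2 hψ hψ1), h3] with x hx hs
    refine (chiFun_eq x).trans ?_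
    rw [hs]
    simpa using! hx
  proj n g := rfl
  levi h x := rfl
  χ_levi h x := chiFun_levi h2 hψ hψ1 h x
  unip h X := rfl
  χ_unip h X := by
    let _ : MeasurableSpace F := borel F
    have : BorelSpace F := ⟨rfl⟩
    refine (chiFun_eq (CoverGL.unip hH h X)).trans ?_
    simp [CoverGL.unip, det_glUnip, weilRatio_one h2 hψ hψ1]
  unip_zero {k l n} h := by
    refine CoverGL.ext ?_ rfl
    change glReindex F h (glUnipAux 0) = 1
    have h1 : glUnipAux (0 : Matrix (Fin k) (Fin l) F) = 1 := Units.ext Matrix.fromBlocks_one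
    rw [h1, map_one]
  exists_levi {k l n} h g hg := by
    refine ⟨(⟨1, CoverGL.sgn g⟩ : CoverGL hH k), rfl, CoverGL.ext ?_ ?_⟩
    · exact hg.trans (map_one (glDiag h)).symm
    · change CoverGL.sgn g = CoverGL.sgn g * 1 * hilbertSymbol (det 1) (det 1)
      rw [map_one, hH.one_left, mul_one, mul_one]
  z_eq_one n := rfl
  s_eq_one := rfl
  φ_z n := rfl
  χ_z n := by
    let _ : MeasurableSpace F := borel F
    have : BorelSpace F := ⟨rfl⟩
    refine (chiFun_eq (⟨1, -1⟩ : CoverGL hH n)).trans ?_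
    simp [coverTower, weilRatio_one h2 hψ hψ1]
  eq_z n g hg := by
    rcases Int.units_eq_one_or (CoverGL.sgn g) with h | h
    · exact Or.inl (CoverGL.ext hg h)
    · exact Or.inr (CoverGL.ext hg h)

/-- The square of `χ_ψ` is `α`; this is why `α` enters the formula for the covers. -/
lemma alphaChar_eq (h2 : (2 : F) ≠ 0) (hψ : Continuous ψ) (hψ1 : ψ ≠ 1)
    (hχ : IsChiCharacter ψ hH) (n : ℕ) (g : CoverGL hH n) :
    alphaChar hH n g = chi hχ n g ^ 2 := by
  let _ : MeasurableSpace F := borel F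
  have : BorelSpace F := ⟨rfl⟩
  have h := weilRatio_mul h2 hψ hψ1 (det g.mat) (det g.mat)
  rw [hH.self_eq, ← pow_two, weilRatio_sq h2 hψ hψ1 (det g.mat).ne_zero] at h
  change ((hilbertSymbol (det g.mat) (-1) : ℤ) : ℂ) = chiFun ψ hH g ^ 2
  rw [chiFun_eq, mul_pow]
  have h3 := intUnits_cast_mul_self g.sgn
  have h4 := intUnits_cast_mul_self (hilbertSymbol (det g.mat) (-1))
  generalize ((hilbertSymbol (det g.mat) (-1) : ℤ) : ℂ) = ε at *
  generalize weilRatio ψ _ = w at *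
  linear_combination ε * h + w * w * h4 - w ^ 2 * h3

end Main

end Metaplectic

end

theorem mainTheorem2 {F : Type u} [Field F] [ValuativeRel F] [TopologicalSpace F]
    [IsNonarchimedeanLocalField F] (h2 : (2 : F) ≠ 0)
    (ψ : AddChar F Circle) (hψ : Continuous ψ) (hψ1 : ψ ≠ 1) :
    ∃ (hH : Metaplectic.HilbertBimult F) (hχ : Metaplectic.IsChiCharacter ψ hH)
      (X : Metaplectic.RLin F ≃ₗ[ℤ] Metaplectic.RGen hH),
      (∀ (n : ℕ) (V : Type u) [AddCommGroup V] [Module ℂ V]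
        (π : Representation ℂ (Matrix.GeneralLinearGroup (Fin n) F) V),
        Metaplectic.IsSmoothRep π → Metaplectic.IsFiniteLengthRep π →
        X (Metaplectic.clsLin π) = Metaplectic.clsGen (Metaplectic.chiTwist hχ π)) ∧
      Metaplectic.MStarGen hH =
        (TensorProduct.map X.toLinearMap X.toLinearMap) ∘ₗ
          (Metaplectic.MStarLin F) ∘ₗ X.symm.toLinearMap ∧
      (∀ (n : ℕ) (V : Type u) [AddCommGroup V] [Module ℂ V]
        (π : Representation ℂ (Matrix.GeneralLinearGroup (Fin n) F) V),
        Metaplectic.IsSmoothRep π → Metaplectic.IsFiniteLengthRep π →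
        ∀ (ι : Type) [Fintype ι] (β γ : ι → Metaplectic.RLin F),
          Metaplectic.MStarLin F (Metaplectic.clsLin π) = ∑ i, β i ⊗ₜ[ℤ] γ i →
          Metaplectic.MStarGen hH (Metaplectic.clsGen (Metaplectic.chiTwist hχ π)) =
            ∑ i, X (β i) ⊗ₜ[ℤ] X (γ i)) := by
  have hH : Metaplectic.HilbertBimult F := by
    let _ : MeasurableSpace F := borel F
    have : BorelSpace F := ⟨rfl⟩
    exact Metaplectic.hilbertBimult_of_char h2 hψ hψ1
  have hχ : Metaplectic.IsChiCharacter ψ hH := Metaplectic.isChiCharacter h2 hψ hψ1 hH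
  let Θ := Metaplectic.chiTowerTwist h2 hψ hψ1 hχ
  have hcls : ∀ (n : ℕ) (V : Type u) [AddCommGroup V] [Module ℂ V]
      (π : Representation ℂ (Matrix.GeneralLinearGroup (Fin n) F) V),
      Θ.mapR (Metaplectic.clsLin π) = Metaplectic.clsGen (Metaplectic.chiTwist hχ π) :=
    fun n V _ _ π => Θ.mapR_cls (n := n) ⟨LinearEquiv.refl ℂ V, fun _ _ => rfl⟩
  have hM : ∀ x : Metaplectic.RLin F, TensorProduct.map Θ.mapR.toLinearMap Θ.mapR.toLinearMap
      (Metaplectic.MStarLin F x) = Metaplectic.MStarGen hH (Θ.mapR x) :=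
    Θ.mapR_MStar (α := fun _ => 1) fun n g =>
      (Metaplectic.alphaChar_eq h2 hψ hψ1 hχ n g).trans (mul_one _).symm
  refine ⟨hH, hχ, Θ.mapR, fun n V _ _ π _ _ => hcls n V π, LinearMap.ext fun x => ?_,
    fun n V _ _ π _ _ ι _ β γ h => ?_⟩
  · have h := hM (Θ.mapR.symm x)
    rw [LinearEquiv.apply_symm_apply] at h
    exact h.symm
  · rw [← hcls, ← hM, h, map_sum]
    exact Finset.sum_congr rfl fun i _ => TensorProduct.map_tmul _ _ _ _
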